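/- **Setting.** Let $n\ge 0$ and $0\le\lambda_1<\dots<\lambda_n<2\pi$ be marked points on the circle $S^1=\mathbb R/2\pi\mathbb Z$. Let $S$ be a $2$-dimensional hermitian space with antihermitian $e_1,e_2,e_3$ satisfying $e_j^2=-1$, $e_je_{j+1}=-e_{j+1}e_j=e_{j+2}$ (Latin indices modulo $3$); put $e_0=\bar e_0=\mathrm{id}$, $\bar e_j=-e_j$, and $\bar e_{[\nu}e_{\mu]}=\bar e_\nu e_\mu-\bar e_\mu e_\nu$. Greek indices run over $0,1,2,3$. Let $E\to S^1$ be a hermitian vector bundle of finite rank; in a global unitary trivialization, $E$ also denotes the fibre. For a hermitian bundle $V$, $\Gamma'_\Lambda(V)$ is the space of sections that are smooth up to the boundary on each interval between consecutive marked points (undefined at the marked points), and $\Gamma_\Lambda(V)\subset\Gamma'_\Lambda(V)$ consists of the continuous ones. If $n=0$, both are the smooth sections. **Nahm data.** Let $\nabla=\frac d{ds}-iT_0$ with $T_0,T_1,T_2,T_3$ hermitian endomorphisms of $E$, smooth up to the boundary between marked points. Let $W_\alpha$ be finite-dimensional hermitian spaces, let $Q_\alpha^\dagger:S\otimes E_{\lambda_\alpha}\to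 W_\alpha$ be linear with adjoints $Q_\alpha$, and let $W_\Lambda=\bigoplus_\alpha W_\alpha$ (orthogonal sum). Put $\mathbf Q^\dagger f=(Q^\dagger_\alpha f(\lambda_\alpha))_\alpha$ and $\mathbf Qv=\sum_\alpha\delta(s-\lambda_\alpha)Q_\alpha v_\alpha$, and write $Q_\alpha Q_\alpha^\dagger=\sum_\mu e_\mu\otimes(Q_\alpha Q_\alpha^\dagger)_\mu$. Assume the Nahm equations with boundary conditions $$[i\nabla,T_j]-[T_{j+1},T_{j+2}]+(\mathbf Q\mathbf Q^\dagger)_j=0,\qquad j=1,2,3,$$ that is, $iT_j'+[T_0,T_j]-[T_{j+1},T_{j+2}]=0$ away from the marked points and $i\,(T_j(\lambda_\alpha+)-T_j(\lambda_\alpha-))+(Q_\alpha Q_\alpha^\dagger)_j=0$ at each $\lambda_\alpha$. **Operators.** For $t\in\mathbb R^4$ let $D_t=\mathrm{id}\otimes(i\nabla+t_0)+\sum_je_j\otimes(T_j+t_j):\Gamma_\Lambda(S\otimes E)\to\Gamma'_\Lambda(S\otimes E)$ and $\mathcal D_t=D_t\oplus\mathbf Q^\dagger:\Gamma_\Lambda(S\otimes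 E)\to\Gamma'_\Lambda(S\otimes E)\oplus W_\Lambda$. Their adjoints, in the $L^2$ product and the product of $W_\Lambda$, are $D_t^\dagger$ (on $\Gamma'_\Lambda(S\otimes E)$) and $\mathcal D_t^\dagger=D_t^\dagger+\mathbf Q$ (on $\Gamma'_\Lambda(S\otimes E)\oplus W_\Lambda$), with values in the linear functionals on $\Gamma_\Lambda(S\otimes E)$. Let $U\subset\mathbb R^4$ be open such that $D_t$ and $D_t^\dagger$ have zero kernel for all $t\in U$. **Claim.** 1. For every $t\in U$ there is exactly one family $F_t(x,y)\in\mathrm{End}(E)$, $x,y\in S^1$, such that $\mathrm{id}\otimes F_t(x,y)$ is the Green's function of $\mathcal D_t^\dagger\mathcal D_t$: for all $y$ and $u\in S\otimes E$ the section $f=(\mathrm{id}\otimes F_t(\cdot,y))u$ is of class $\Gamma_{\Lambda\cup\{y\}}$ and $\mathcal D_t^\dagger\mathcal D_tf=\delta(\cdot-y)u$ as functionals on $\Gamma_{\Lambda\cup\{y\}}(S\otimes E)$. The values $F_t(\lambda_\beta,\lambda_\alpha)$ are smooth in $t\in U$. 2. For $A\in\mathrm{End}(S)$ and a family $K(\lambda_*,\lambda_*)=(K(\lambda_\beta,\lambda_\alpha))_{\beta,\alpha}$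 in $\mathrm{End}(E)$ let $Q^\dagger(A\otimes K(\lambda_*,\lambda_*))Q$ be the operator $(v_\alpha)_\alpha\mapsto\big(\sum_\alpha Q_\beta^\dagger(A\otimes K(\lambda_\beta,\lambda_\alpha))Q_\alpha v_\alpha\big)_\beta$ on $W_\Lambda$, and let $\mathbf Q^\dagger\mathbf F_t\mathbf Q=Q^\dagger(\mathrm{id}\otimes F_t(\lambda_*,\lambda_*))Q$. Then $\mathrm{id}-\mathbf Q^\dagger\mathbf F_t\mathbf Q$ is positive and invertible for $t\in U$. 3. Let $\mathcal W$ be a finite-dimensional hermitian space. An isometric trivialization of $\ker\mathcal D_t^\dagger$ over $U$ is a family $\Psi_t=(\psi_t,\chi_t):\mathcal W\to\ker\mathcal D_t^\dagger\subset\Gamma'_\Lambda(S\otimes E)\oplus W_\Lambda$ of linear isometries onto, smooth in $t$ (for $\psi_t$: smooth in $(t,s)$, up to the boundary in $s$, between marked points). A family of linear maps $\chi_t:\mathcal W\to W_\Lambda$, $t\in U$, is the second component of such a trivialization if and only if it is smooth in $t$, every $\chi_t$ is invertible, and $$\chi_t\chi_t^\dagger=\mathrm{id}-\mathbf Q^\dagger\mathbf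 F_t\mathbf Q ,\qquad t\in U;$$ in that case $\psi_t$ is determined by $\chi$. 4. Let $\tilde\nabla$ be the connection induced on $\ker\mathcal D_t^\dagger$, the orthogonal projection of the trivial connection of $U\times(\Gamma'_\Lambda(S\otimes E)\oplus W_\Lambda)$. For every isometric trivialization $(\psi,\chi)$ over $U$, $\tilde\nabla_{\partial/\partial t_\mu}=\partial_\mu+A_\mu$ (that is, $\tilde\nabla_\mu(\Psi w)=\Psi(\partial_\mu w+A_\mu w)$ for all smooth $w:U\to\mathcal W$) holds for all $\mu$ if and only if, for all $\mu$ and on all of $U$, $$2A_\mu=-\tfrac12\sum_\nu\chi^{-1}Q^\dagger\big(\bar e_{[\nu}e_{\mu]}\otimes\partial_\nu F(\lambda_*,\lambda_*)\big)Q\,(\chi^\dagger)^{-1}+\chi^{-1}\partial_\mu\chi-(\partial_\mu\chi^\dagger)(\chi^\dagger)^{-1}.$$ -/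

import Mathlib

open scoped TensorProduct ContDiff

noncomputable section

namespace Caloron

/-! ### Adjoints and function classes on the circle

Functions and sections on the circle of length `2π` are `2π`-periodic functions on `ℝ`.  A function
that is only defined off a set of break points is represented by its right-continuous
representative, so that no information is added at the break points. -/

/-- The hermitian adjoint of a linear map between finite-dimensional hermitian spaces. -/
def adj {V₁ V₂ : Type*} [NormedAddCommGroup V₁] [InnerProductSpace ℂ V₁] [FiniteDimensional ℂ V₁]
    [NormedAddCommGroup V₂] [InnerProductSpace ℂ V₂] [FiniteDimensional ℂ V₂]
    (A : V₁ →L[ℂ] V₂) : V₂ →L[ℂ] V₁ :=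
  haveI : CompleteSpace V₁ := FiniteDimensional.complete ℂ V₁
  haveI : CompleteSpace V₂ := FiniteDimensional.complete ℂ V₂
  ContinuousLinearMap.adjoint A

theorem adj_inner_right {V₁ V₂ : Type*} [NormedAddCommGroup V₁] [InnerProductSpace ℂ V₁]
    [FiniteDimensional ℂ V₁] [NormedAddCommGroup V₂] [InnerProductSpace ℂ V₂]
    [FiniteDimensional ℂ V₂] (A : V₁ →L[ℂ] V₂) (x : V₁) (y : V₂) :
    inner ℂ x (adj A y) = inner ℂ (A x) y := by
  have : CompleteSpace V₁ := FiniteDimensional.complete ℂ V₁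
  have : CompleteSpace V₂ := FiniteDimensional.complete ℂ V₂
  exact ContinuousLinearMap.adjoint_inner_right A x y

/-- The class `𝒞'` for the set `P` of break points: periodic, and smooth up to the boundary on
every interval free of break points. -/
def IsPiecewiseSmooth {V : Type*} [NormedAddCommGroup V] [NormedSpace ℝ V] (P : Set ℝ)
    (f : ℝ → V) : Prop :=
  Function.Periodic f (2 * Real.pi) ∧
    ∀ a b : ℝ, a < b → Disjoint (Set.Ioo a b) P →
      ∃ g : ℝ → V, ContDiffOn ℝ ∞ g (Set.Icc a b) ∧ Set.EqOn f g (Set.Ico a b)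

/-- The class `𝒞`: continuous on the circle and piecewise smooth. -/
def IsContPiecewiseSmooth {V : Type*} [NormedAddCommGroup V] [NormedSpace ℝ V] (P : Set ℝ)
    (f : ℝ → V) : Prop :=
  IsPiecewiseSmooth P f ∧ Continuous f

/-- A family `f t`, `t ∈ U`, of functions of class `𝒞'` that depends smoothly on `t`: it is smooth
in `(t, s)`, up to the boundary in `s`, over every interval free of break points. -/
def IsSmoothFamily {V : Type*} [NormedAddCommGroup V] [NormedSpace ℝ V] (P : Set ℝ)
    (U : Set (Fin 4 → ℝ)) (f : (Fin 4 → ℝ) → ℝ → V) : Prop :=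
  (∀ t ∈ U, Function.Periodic (f t) (2 * Real.pi)) ∧
    ∀ a b : ℝ, a < b → Disjoint (Set.Ioo a b) P →
      ∃ g : (Fin 4 → ℝ) × ℝ → V, ContDiffOn ℝ ∞ g (U ×ˢ Set.Icc a b) ∧
        ∀ t ∈ U, ∀ s ∈ Set.Ico a b, f t s = g (t, s)

/-- The partial derivative `∂_μ` with respect to `t_μ`. -/
def pd {V : Type*} [NormedAddCommGroup V] [NormedSpace ℝ V] (μ : Fin 4)
    (f : (Fin 4 → ℝ) → V) (t : Fin 4 → ℝ) : V :=
  lineDeriv ℝ f t (Pi.single μ 1)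

/-- The `L²` product over the circle, antilinear in the first argument. -/
def l2Inner {V : Type*} [NormedAddCommGroup V] [InnerProductSpace ℂ V] (f g : ℝ → V) : ℂ :=
  ∫ s in (0 : ℝ)..(2 * Real.pi), inner ℂ (f s) (g s)

/-! ### Nahm data -/

/-- Caloron Nahm data in a unitary trivialization of the hermitian bundle over the circle with
fibre `E`, where the hermitian connection is `d/ds - i T₀`.  `S` is the fibre of the spinor bundle,
with the quaternion units `e 0, e 1, e 2` (indices modulo three) acting by antihermitian maps. -/
structure NahmData (S E : Type*) [NormedAddCommGroup S] [InnerProductSpace ℂ S]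
    [FiniteDimensional ℂ S] [NormedAddCommGroup E] [InnerProductSpace ℂ E]
    [FiniteDimensional ℂ E] (n : ℕ) (W : Fin n → Type*) [∀ α, NormedAddCommGroup (W α)]
    [∀ α, InnerProductSpace ℂ (W α)] [∀ α, FiniteDimensional ℂ (W α)] where
  finrank_spinor : Module.finrank ℂ S = 2
  e : Fin 3 → S →L[ℂ] S
  e_adj : ∀ j, adj (e j) = -e j
  e_sq : ∀ j, e j * e j = -1
  e_mul : ∀ j, e j * e (j + 1) = e (j + 2)
  e_mul' : ∀ j, e (j + 1) * e j = -e (j + 2)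
  lam : Fin n → ℝ
  lam_nonneg : ∀ α, 0 ≤ lam α
  lam_lt : ∀ α, lam α < 2 * Real.pi
  lam_strictMono : StrictMono lam
  T : Fin 4 → ℝ → E →L[ℂ] E
  T_hermitian : ∀ μ s, adj (T μ s) = T μ s
  T_smooth : ∀ μ, IsPiecewiseSmooth {x : ℝ | ∃ α, ∃ l : ℤ, x = lam α + 2 * Real.pi * l} (T μ)
  Qdag : ∀ α, S ⊗[ℂ] E →L[ℂ] W α

namespace NahmData

variable {S E : Type*} [NormedAddCommGroup S] [InnerProductSpace ℂ S]
  [FiniteDimensional ℂ S] [NormedAddCommGroup E] [InnerProductSpace ℂ E]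
  [FiniteDimensional ℂ E] {n : ℕ} {W : Fin n → Type*} [∀ α, NormedAddCommGroup (W α)]
  [∀ α, InnerProductSpace ℂ (W α)] [∀ α, FiniteDimensional ℂ (W α)]

/-- The marked points, as a `2π`-periodic subset of `ℝ`. -/
def marks (N : NahmData S E n W) : Set ℝ :=
  {x : ℝ | ∃ α, ∃ l : ℤ, x = N.lam α + 2 * Real.pi * l}

/-- The marked points together with the point `y` of the circle. -/
def marksWith (N : NahmData S E n W) (y : ℝ) : Set ℝ :=
  N.marks ∪ {x : ℝ | ∃ l : ℤ, x = y + 2 * Real.pi * l}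

/-- `e_μ`, with `e_0 = id`. -/
def eMu (N : NahmData S E n W) : Fin 4 → S →L[ℂ] S := Fin.cons 1 N.e

/-- The quaternion conjugates of the `e_μ`. -/
def eBar (N : NahmData S E n W) : Fin 4 → S →L[ℂ] S := Fin.cons 1 (fun j => -N.e j)

/-- `ē_{[ν} e_{μ]} = ē_ν e_μ - ē_μ e_ν`. -/
def eBracket (N : NahmData S E n W) (ν μ : Fin 4) : S →L[ℂ] S :=
  N.eBar ν * N.eMu μ - N.eBar μ * N.eMu ν

/-- `Q_α`, the adjoint of `Q_α†`. -/
def Q (N : NahmData S E n W) (α : Fin n) : W α →L[ℂ] S ⊗[ℂ] E := adj (N.Qdag α)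

/-- The Nahm equations with boundary conditions: the endomorphism-valued generalized function
`[i∇, T_j] - [T_{j+1}, T_{j+2}] + (𝐐𝐐†)_j` vanishes.  Its regular part is
`i T_j' + [T_0, T_j] - [T_{j+1}, T_{j+2}]`, and the coefficient of the delta function at `λ_α` is
`i (T_j(λ_α+) - T_j(λ_α-)) + (Q_α Q_α†)_j`, where the components are determined by
`Q_α Q_α† = ∑ e_μ ⊗ (Q_α Q_α†)_μ`. -/
structure NahmEquations (N : NahmData S E n W) : Prop where
  regular : ∀ s ∉ N.marks, ∀ j : Fin 3,
    Complex.I • deriv (N.T j.succ) s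
      + (N.T 0 s * N.T j.succ s - N.T j.succ s * N.T 0 s)
      - (N.T (j + 1).succ s * N.T (j + 2).succ s
          - N.T (j + 2).succ s * N.T (j + 1).succ s) = 0
  singular : ∀ α : Fin n, ∃ R : Fin 4 → E →L[ℂ] E,
    N.Q α ∘L N.Qdag α = ∑ μ, TensorProduct.mapL (N.eMu μ) (R μ) ∧
    ∀ j : Fin 3, ∃ L : E →L[ℂ] E,
      Filter.Tendsto (N.T j.succ) (nhdsWithin (N.lam α) (Set.Iio (N.lam α))) (nhds L) ∧
      Complex.I • (N.T j.succ (N.lam α) - L) + R j.succ = 0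

/-! ### The operators -/

/-- `D_t = id ⊗ (i∇ + t_0) + ∑ e_j ⊗ (T_j + t_j)`, with `i∇ = i d/ds + T_0`; the derivative is taken
from the right, in accordance with right-continuous representatives. -/
def dirac (N : NahmData S E n W) (t : Fin 4 → ℝ) (f : ℝ → S ⊗[ℂ] E) : ℝ → S ⊗[ℂ] E := fun s =>
  Complex.I • derivWithin f (Set.Ici s) s
    + TensorProduct.mapL (1 : S →L[ℂ] S) (N.T 0 s + (t 0 : ℂ) • 1) (f s)
    + ∑ j : Fin 3, TensorProduct.mapL (N.e j) (N.T j.succ s + (t j.succ : ℂ) • 1) (f s)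

/-- `𝐐†`, with values in the orthogonal direct sum of the `W_α`. -/
def bdry (N : NahmData S E n W) (f : ℝ → S ⊗[ℂ] E) : PiLp 2 W :=
  WithLp.toLp 2 fun α => N.Qdag α (f (N.lam α))

/-- The Weyl operator `𝒟_t = D_t ⊕ 𝐐†`. -/
def weyl (N : NahmData S E n W) (t : Fin 4 → ℝ) (f : ℝ → S ⊗[ℂ] E) :
    (ℝ → S ⊗[ℂ] E) × PiLp 2 W :=
  (N.dirac t f, N.bdry f)

/-- The hermitian product on `Γ'(S ⊗ E) ⊕ W_Λ`. -/
def pairInner (p q : (ℝ → S ⊗[ℂ] E) × PiLp 2 W) : ℂ :=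
  l2Inner p.1 q.1 + inner ℂ p.2 q.2

/-- The generalized section `D_t† f`, as a functional of test sections. -/
def diracAdj (N : NahmData S E n W) (t : Fin 4 → ℝ) (f : ℝ → S ⊗[ℂ] E)
    (g : ℝ → S ⊗[ℂ] E) : ℂ :=
  l2Inner f (N.dirac t g)

/-- The generalized section `𝒟_t† (f, v) = D_t† f + 𝐐 v`, as a functional of test sections. -/
def weylAdj (N : NahmData S E n W) (t : Fin 4 → ℝ) (p : (ℝ → S ⊗[ℂ] E) × PiLp 2 W)
    (g : ℝ → S ⊗[ℂ] E) : ℂ :=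
  N.diracAdj t p.1 g + inner ℂ p.2 (N.bdry g)

/-- `D_t` and `D_t†` have zero kernel. -/
def IsRegular (N : NahmData S E n W) (t : Fin 4 → ℝ) : Prop :=
  (∀ f : ℝ → S ⊗[ℂ] E, IsContPiecewiseSmooth N.marks f → N.dirac t f = 0 → f = 0) ∧
  (∀ f : ℝ → S ⊗[ℂ] E, IsPiecewiseSmooth N.marks f →
    (∀ g : ℝ → S ⊗[ℂ] E, IsContPiecewiseSmooth N.marks g → N.diracAdj t f g = 0) → f = 0)

/-- `ker 𝒟_t† ⊆ Γ'(S ⊗ E) ⊕ W_Λ`. -/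
def weylKer (N : NahmData S E n W) (t : Fin 4 → ℝ) : Set ((ℝ → S ⊗[ℂ] E) × PiLp 2 W) :=
  {p | IsPiecewiseSmooth N.marks p.1 ∧
    ∀ g : ℝ → S ⊗[ℂ] E, IsContPiecewiseSmooth N.marks g → N.weylAdj t p g = 0}

/-- `F(x, y)` is the Green's function of `𝒟_t† 𝒟_t`, which acts as `id ⊗ F(x, y)` on `S ⊗ E`:
`𝒟_t† 𝒟_t (id ⊗ F(·, y)) u = δ(· - y) u` for all `y` and `u`. -/
def IsGreen (N : NahmData S E n W) (t : Fin 4 → ℝ) (F : ℝ → ℝ → E →L[ℂ] E) : Prop :=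
  ∀ (y : ℝ) (u : S ⊗[ℂ] E),
    IsContPiecewiseSmooth (N.marksWith y)
      (fun s => TensorProduct.mapL (1 : S →L[ℂ] S) (F s y) u) ∧
    ∀ g : ℝ → S ⊗[ℂ] E, IsContPiecewiseSmooth (N.marksWith y) g →
      N.weylAdj t (N.weyl t (fun s => TensorProduct.mapL (1 : S →L[ℂ] S) (F s y) u)) g
        = inner ℂ u (g y)

/-- `Q† (A ⊗ K) Q : W_Λ → W_Λ`, that is
`(v_α)_α ↦ (∑_α Q_β† (A ⊗ K(β, α)) Q_α v_α)_β`. -/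
def sandwich (N : NahmData S E n W) (A : S →L[ℂ] S) (K : Fin n → Fin n → E →L[ℂ] E) :
    PiLp 2 W →L[ℂ] PiLp 2 W :=
  (PiLp.continuousLinearEquiv 2 ℂ W).symm.toContinuousLinearMap ∘L
    ContinuousLinearMap.pi fun β =>
      ∑ α, N.Qdag β ∘L TensorProduct.mapL A (K β α) ∘L N.Q α ∘L PiLp.proj 2 W α

theorem sandwich_apply (N : NahmData S E n W) (A : S →L[ℂ] S)
    (K : Fin n → Fin n → E →L[ℂ] E) (v : PiLp 2 W) (β : Fin n) :
    N.sandwich A K v β = ∑ α, N.Qdag β (TensorProduct.mapL A (K β α) (N.Q α (v α))) := by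
  simp [sandwich]

/-- `id - 𝐐† 𝐅 𝐐 : W_Λ → W_Λ`, where `𝐅` has the integral kernel `id ⊗ F(x, y)`. -/
def chiGram (N : NahmData S E n W) (F : ℝ → ℝ → E →L[ℂ] E) : PiLp 2 W →L[ℂ] PiLp 2 W :=
  1 - N.sandwich 1 fun β α => F (N.lam β) (N.lam α)

/-! ### Isometric trivializations and the induced connection -/

section Frames

variable {V : Type*} [NormedAddCommGroup V] [InnerProductSpace ℂ V] [FiniteDimensional ℂ V]

/-- `Ψ_t = (ψ_t, χ_t) : V → ker 𝒟_t†`, `t ∈ U`, is a linear isometry onto, smooth in `t`. -/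
structure IsFrame (N : NahmData S E n W) (U : Set (Fin 4 → ℝ))
    (ψ : (Fin 4 → ℝ) → V →ₗ[ℂ] (ℝ → S ⊗[ℂ] E)) (χ : (Fin 4 → ℝ) → V →L[ℂ] PiLp 2 W) : Prop where
  mem_ker : ∀ t ∈ U, ∀ w : V, (ψ t w, χ t w) ∈ N.weylKer t
  surj : ∀ t ∈ U, ∀ p ∈ N.weylKer t, ∃ w : V, (ψ t w, χ t w) = p
  isometry : ∀ t ∈ U, ∀ w w' : V,
    pairInner (ψ t w, χ t w) (ψ t w', χ t w') = inner ℂ w w'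
  smooth_fst : ∀ w : V, IsSmoothFamily N.marks U (fun t => ψ t w)
  smooth_snd : ContDiffOn ℝ ∞ χ U

/-- The trivial connection `∂_μ` on families in `Γ'(S ⊗ E) ⊕ W_Λ`. -/
def pdPair (μ : Fin 4) (σ : (Fin 4 → ℝ) → (ℝ → S ⊗[ℂ] E) × PiLp 2 W) (t : Fin 4 → ℝ) :
    (ℝ → S ⊗[ℂ] E) × PiLp 2 W :=
  (fun s => pd μ (fun t' => (σ t').1 s) t, pd μ (fun t' => (σ t').2) t)

/-- `q` is the orthogonal projection of `p ∈ Γ'(S ⊗ E) ⊕ W_Λ` to `ker 𝒟_t†`. -/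
def IsKerProj (N : NahmData S E n W) (t : Fin 4 → ℝ)
    (p q : (ℝ → S ⊗[ℂ] E) × PiLp 2 W) : Prop :=
  IsPiecewiseSmooth N.marks p.1 ∧ q ∈ N.weylKer t ∧
    ∀ r ∈ N.weylKer t, pairInner r (p - q) = 0

/-- The induced connection on `ker 𝒟_t†`, the orthogonal projection of the trivial connection, is
`∂_μ + A_μ` in the trivialization `(ψ, χ)` over `U`. -/
def IsInducedConnection (N : NahmData S E n W) (U : Set (Fin 4 → ℝ))
    (ψ : (Fin 4 → ℝ) → V →ₗ[ℂ] (ℝ → S ⊗[ℂ] E)) (χ : (Fin 4 → ℝ) → V →L[ℂ] PiLp 2 W)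
    (A : Fin 4 → (Fin 4 → ℝ) → V →L[ℂ] V) : Prop :=
  ∀ w : (Fin 4 → ℝ) → V, ContDiffOn ℝ ∞ w U → ∀ t ∈ U, ∀ μ : Fin 4,
    N.IsKerProj t (pdPair μ (fun t' => (ψ t' (w t'), χ t' (w t'))) t)
      (ψ t (pd μ w t + A μ t (w t)), χ t (pd μ w t + A μ t (w t)))

end Frames

end NahmData

end Caloron

end

set_option linter.unusedSectionVars false

open scoped TensorProduct ContDiff

noncomputable section

namespace Caloron

open Filter Topology Set MeasureTheory

/-! Analysis. Since `D_t` is an ordinary differential operator on a circle, its zero kernel and that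
of `D_t†` mean that no solution closes up over a period, that is, that 1 is not an eigenvalue of
either monodromy (`isUnit_opMonodromy`, `isUnit_adjMonodromy`). Hence `(D_t†)⁻¹` and `(D_t† D_t)⁻¹`
have explicit kernels, obtained by solving first order equations. The solution operators are
inverses of `1 - K_t` with `K_t` a Volterra operator affine in `t`, which makes everything smooth in
`t`, and on intervals without break points jointly smooth in `(t, s)`. The operator `𝒟_t† 𝒟_t = D_t†
D_t + 𝐐 𝐐†` is a finite rank perturbation, inverted by the Woodbury formula (`weylForm_weylGreen`).

Scalar Green's function. The Nahm equations give a Weitzenböck formula (`exists_weitzenboeck`). With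
`D_t = ∑ e_μ ⊗ X_μ`, the parts of `D_t† D_t` along the imaginary units are commutators of the `X_μ`;
away from the marked points they vanish, and at the marked points their delta functions cancel the
imaginary parts of `𝐐 𝐐†`. So `𝒟_t† 𝒟_t` commutes with `End(S)` (`weylForm_spin`), its Green's
function does so too by uniqueness, and an endomorphism of `S ⊗ E` commuting with `End(S)` has the
form `id ⊗ F` (`mapL_reduce`).

The kernel. Because `D_t†` is injective and has a right inverse on the sources `𝐐 x`, the second
component identifies `ker 𝒟_t†` with `W_Λ`. Let `f_v = (𝒟_t† 𝒟_t)⁻¹ 𝐐 v` and `G = id - 𝐐† 𝐅 𝐐`. Then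
`(0, v) - 𝒟_t f_v` lies in the kernel and has second component `G v`. As kernel elements are
orthogonal to `𝒟_t f_v`, the elements over `x` and over `G v` have product `⟨x, v⟩`
(`pairInner_kerPair_gram`). So the metric carried over to `W_Λ` is `G⁻¹`: positivity and
invertibility of `G` follow, and `χ` belongs to an isometric trivialization exactly when it is
smooth and invertible with `χ χ† = G`.

The connection. Differentiation of the equation for the kernel (`l2Inner_kerFst_pd`) shows that
`A_μ` is characterized by `⟨v', (∂_μ χ - χ A_μ) χ† v⟩ = ⟨e_μ f_v', D_t f_v⟩`. The right side is half
of a sum minus half of a difference. The sum `⟨D_t f_v', e_μ f_v⟩ + ⟨e_μ f_v', D_t f_v⟩` is the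
derivative of `χ χ† = G` (`inner_pd_gram`). The difference is the contraction of `∂_ν F` with
`ē_{[ν} e_{μ]}`: a resolvent identity computes `∂_ν F` (`hasLineDerivAt_inner_bdry_spin`), and the
Clifford relations collapse the contraction (`sum_l2Inner_eBracket`). Solving for `A_μ` gives the
stated formula. -/

/-! ### Calculus of piecewise smooth functions -/

/-- A countable set of reals without accumulation points. -/
structure IsSparse (P : Set ℝ) : Prop where
  countable : P.Countable
  eventually : ∀ s, ∀ᶠ x in 𝓝[≠] s, x ∉ P

theorem IsSparse.exists_right {P : Set ℝ} (hP : IsSparse P) (s : ℝ) :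
    ∃ b > s, Disjoint (Ioo s b) P := by
  have h : ∀ᶠ x in 𝓝[>] s, x ∉ P :=
    (hP.eventually s).filter_mono (nhdsWithin_mono s fun x hx => ne_of_gt hx)
  obtain ⟨b, hb, hbP⟩ := (mem_nhdsGT_iff_exists_Ioo_subset).1 h
  exact ⟨b, hb, Set.disjoint_left.2 fun x hx => hbP hx⟩

theorem IsSparse.exists_left {P : Set ℝ} (hP : IsSparse P) (s : ℝ) :
    ∃ a < s, Disjoint (Ioo a s) P := by
  have h : ∀ᶠ x in 𝓝[<] s, x ∉ P :=
    (hP.eventually s).filter_mono (nhdsWithin_mono s fun x hx => ne_of_lt hx)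
  obtain ⟨b, hb, hbP⟩ := (mem_nhdsLT_iff_exists_Ioo_subset).1 h
  exact ⟨b, hb, Set.disjoint_left.2 fun x hx => hbP hx⟩

theorem IsSparse.exists_around {P : Set ℝ} (hP : IsSparse P) {s : ℝ} (hs : s ∉ P) :
    ∃ a < s, ∃ b > s, Disjoint (Ioo a b) P := by
  obtain ⟨b, hb, hb'⟩ := hP.exists_right s
  obtain ⟨a, ha, ha'⟩ := hP.exists_left s
  refine ⟨a, ha, b, hb, Set.disjoint_left.2 fun x hx hxP => ?_⟩
  rcases lt_trichotomy x s with h | h | h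
  · exact Set.disjoint_left.1 ha' ⟨hx.1, h⟩ hxP
  · exact hs (h ▸ hxP)
  · exact Set.disjoint_left.1 hb' ⟨h, hx.2⟩ hxP

theorem IsSparse.isOpen_compl {P : Set ℝ} (hP : IsSparse P) : IsOpen Pᶜ := by
  rw [isOpen_iff_mem_nhds]
  intro s hs
  obtain ⟨a, ha, b, hb, h⟩ := hP.exists_around hs
  exact mem_of_superset (Ioo_mem_nhds ha hb) fun x hx => Set.disjoint_left.1 h hx

theorem IsSparse.union {P P' : Set ℝ} (hP : IsSparse P) (hP' : IsSparse P') :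
    IsSparse (P ∪ P') :=
  ⟨hP.countable.union hP'.countable, fun s => by
    filter_upwards [hP.eventually s, hP'.eventually s] with x h h'
    simp [h, h']⟩

theorem IsSparse.iUnion {ι : Type*} [Finite ι] {P : ι → Set ℝ} (hP : ∀ i, IsSparse (P i)) :
    IsSparse (⋃ i, P i) :=
  ⟨countable_iUnion fun i => (hP i).countable, fun s => by
    have := eventually_all.2 fun i => (hP i).eventually s
    filter_upwards [this] with x h
    simpa using h⟩

/-- Distinct translates are at least `2π` apart, so at most one of them lies within distance `π` of
a given point, and a punctured neighbourhood avoids that one. -/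
theorem isSparse_translates (c : ℝ) : IsSparse {x : ℝ | ∃ l : ℤ, x = c + 2 * Real.pi * l} := by
  refine ⟨?_, fun s => ?_⟩
  · refine (countable_range fun l : ℤ => c + 2 * Real.pi * l).mono ?_
    rintro x ⟨l, rfl⟩
    exact ⟨l, rfl⟩
  · have hp := Real.two_pi_pos
    have hlt : ∀ᶠ x in 𝓝[≠] s, |x - s| < Real.pi := by
      refine nhdsWithin_le_nhds ?_
      filter_upwards [Metric.ball_mem_nhds s Real.pi_pos] with x hx
      simpa [Real.dist_eq] using hx
    by_cases hs : ∃ l : ℤ, |c + 2 * Real.pi * l - s| < Real.pi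
    · obtain ⟨l, hl⟩ := hs
      have hl2 : ∀ᶠ x in 𝓝[≠] s, x ≠ c + 2 * Real.pi * l := by
        by_cases h : s = c + 2 * Real.pi * l
        · rw [← h]; exact self_mem_nhdsWithin
        · exact nhdsWithin_le_nhds (isOpen_ne.mem_nhds h)
      filter_upwards [hlt, hl2] with x hx hx'
      rintro ⟨m, rfl⟩
      have : |(m - l : ℝ)| < 1 := by
        have h1 : |2 * Real.pi * (m - l : ℝ)| < 2 * Real.pi := by
          rw [abs_lt] at *
          constructor <;> nlinarith
        rw [abs_mul, abs_of_pos hp] at h1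
        nlinarith
      have h2 : |m - l| < 1 := by exact_mod_cast this
      rw [Int.abs_lt_one_iff] at h2
      exact hx' (by rw [sub_eq_zero.1 h2])
    · push Not at hs
      filter_upwards [hlt] with x hx
      rintro ⟨m, rfl⟩
      exact absurd hx (not_lt.2 (hs m))

/-! ### Closure properties, regularity and integration of piecewise smooth functions -/

section PS

variable {V V' V'' : Type*} [NormedAddCommGroup V] [NormedSpace ℝ V]
  [NormedAddCommGroup V'] [NormedSpace ℝ V'] [NormedAddCommGroup V''] [NormedSpace ℝ V'']
  {P P' : Set ℝ} {f : ℝ → V}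

theorem IsPiecewiseSmooth.mono (hf : IsPiecewiseSmooth P f) (h : P ⊆ P') :
    IsPiecewiseSmooth P' f :=
  ⟨hf.1, fun a b hab hd => hf.2 a b hab (hd.mono_right h)⟩

theorem IsContPiecewiseSmooth.mono (hf : IsContPiecewiseSmooth P f) (h : P ⊆ P') :
    IsContPiecewiseSmooth P' f :=
  ⟨hf.1.mono h, hf.2⟩

theorem IsPiecewiseSmooth.comp {F : V → V'} (hF : ContDiff ℝ ∞ F) (hf : IsPiecewiseSmooth P f) :
    IsPiecewiseSmooth P fun s => F (f s) := by
  refine ⟨fun s => by simp [hf.1 s], fun a b hab hd => ?_⟩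
  obtain ⟨g, hg, hfg⟩ := hf.2 a b hab hd
  exact ⟨fun s => F (g s), hF.comp_contDiffOn hg, fun s hs => by simp [hfg hs]⟩

theorem IsPiecewiseSmooth.prodMk {g : ℝ → V'} (hf : IsPiecewiseSmooth P f)
    (hg : IsPiecewiseSmooth P g) : IsPiecewiseSmooth P fun s => (f s, g s) := by
  refine ⟨fun s => by simp [hf.1 s, hg.1 s], fun a b hab hd => ?_⟩
  obtain ⟨f', hf', h⟩ := hf.2 a b hab hd
  obtain ⟨g', hg', h'⟩ := hg.2 a b hab hd
  exact ⟨fun s => (f' s, g' s), hf'.prodMk hg', fun s hs => by simp [h hs, h' hs]⟩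

theorem IsPiecewiseSmooth.comp₂ {F : V × V' → V''} (hF : ContDiff ℝ ∞ F) {g : ℝ → V'}
    (hf : IsPiecewiseSmooth P f) (hg : IsPiecewiseSmooth P g) :
    IsPiecewiseSmooth P fun s => F (f s, g s) :=
  (hf.prodMk hg).comp hF

theorem isPiecewiseSmooth_const (c : V) : IsPiecewiseSmooth P fun _ => c :=
  ⟨fun _ => rfl, fun _ _ _ _ => ⟨fun _ => c, contDiffOn_const, fun _ _ => rfl⟩⟩

theorem IsPiecewiseSmooth.add {g : ℝ → V} (hf : IsPiecewiseSmooth P f)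
    (hg : IsPiecewiseSmooth P g) : IsPiecewiseSmooth P fun s => f s + g s :=
  hf.comp₂ (F := fun p : V × V => p.1 + p.2) contDiff_add hg

theorem IsPiecewiseSmooth.sub {g : ℝ → V} (hf : IsPiecewiseSmooth P f)
    (hg : IsPiecewiseSmooth P g) : IsPiecewiseSmooth P fun s => f s - g s :=
  hf.comp₂ (F := fun p : V × V => p.1 - p.2) (contDiff_fst.sub contDiff_snd) hg

theorem IsPiecewiseSmooth.neg (hf : IsPiecewiseSmooth P f) :
    IsPiecewiseSmooth P fun s => - f s :=
  hf.comp contDiff_neg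

theorem IsPiecewiseSmooth.sum {ι : Type*} (t : Finset ι) {f : ι → ℝ → V}
    (hf : ∀ i ∈ t, IsPiecewiseSmooth P (f i)) : IsPiecewiseSmooth P fun s => ∑ i ∈ t, f i s := by
  classical
  induction t using Finset.induction_on with
  | empty => simpa using isPiecewiseSmooth_const (0 : V)
  | insert i t hi ih =>
    simp only [Finset.sum_insert hi]
    exact (hf i (by simp)).add (ih fun j hj => hf j (by simp [hj]))

theorem IsPiecewiseSmooth.clm {G G' : Type*} [NormedAddCommGroup G] [NormedSpace ℂ G]
    [NormedAddCommGroup G'] [NormedSpace ℂ G'] (L : G →L[ℂ] G') {f : ℝ → G}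
    (hf : IsPiecewiseSmooth P f) : IsPiecewiseSmooth P fun s => L (f s) :=
  hf.comp (L.restrictScalars ℝ).contDiff

theorem IsPiecewiseSmooth.const_smul {G : Type*} [NormedAddCommGroup G] [NormedSpace ℂ G]
    (c : ℂ) {f : ℝ → G} (hf : IsPiecewiseSmooth P f) : IsPiecewiseSmooth P fun s => c • f s :=
  hf.clm (c • ContinuousLinearMap.id ℂ G)

theorem IsPiecewiseSmooth.clm_apply {G G' : Type*} [NormedAddCommGroup G] [NormedSpace ℂ G]
    [NormedAddCommGroup G'] [NormedSpace ℂ G'] {L : ℝ → G →L[ℂ] G'} {f : ℝ → G}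
    (hL : IsPiecewiseSmooth P L) (hf : IsPiecewiseSmooth P f) :
    IsPiecewiseSmooth P fun s => L s (f s) := by
  refine hL.comp₂ (F := fun p : (G →L[ℂ] G') × G => p.1 p.2) ?_ hf
  have h : IsBoundedBilinearMap ℝ fun p : (G →L[ℂ] G') × G => p.1 p.2 :=
    { add_left := fun x₁ x₂ y => by simp
      smul_left := fun c x y => by simp
      add_right := fun x y₁ y₂ => by simp
      smul_right := fun c x y => by simp
      bound := ⟨1, one_pos, fun x y => by simpa using x.le_opNorm y⟩ }
  exact h.contDiff

theorem IsPiecewiseSmooth.innerProd {G : Type*} [NormedAddCommGroup G] [InnerProductSpace ℂ G]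
    {f g : ℝ → G} (hf : IsPiecewiseSmooth P f) (hg : IsPiecewiseSmooth P g) :
    IsPiecewiseSmooth P fun s => inner ℂ (f s) (g s) :=
  hf.comp₂ (F := fun p : G × G => inner ℂ p.1 p.2) (contDiff_inner (𝕜 := ℂ)) hg

theorem IsPiecewiseSmooth.exists_hasDerivWithinAt (hP : IsSparse P)
    (hf : IsPiecewiseSmooth P f) (s : ℝ) :
    HasDerivWithinAt f (derivWithin f (Ici s) s) (Ici s) s := by
  obtain ⟨b, hb, hd⟩ := hP.exists_right s
  obtain ⟨g, hg, hfg⟩ := hf.2 s b hb hd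
  have h1 : DifferentiableWithinAt ℝ g (Icc s b) s :=
    (hg.differentiableOn (by simp)) s ⟨le_rfl, hb.le⟩
  have h2 : DifferentiableWithinAt ℝ g (Ico s b) s := h1.mono Ico_subset_Icc_self
  have h3 : DifferentiableWithinAt ℝ f (Ico s b) s :=
    h2.congr (fun x hx => hfg hx) (hfg ⟨le_rfl, hb⟩)
  have h4 : DifferentiableWithinAt ℝ f (Ici s) s :=
    h3.mono_of_mem_nhdsWithin (Ico_mem_nhdsGE hb)
  exact h4.hasDerivWithinAt

theorem IsPiecewiseSmooth.continuousWithinAt (hP : IsSparse P)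
    (hf : IsPiecewiseSmooth P f) (s : ℝ) : ContinuousWithinAt f (Ici s) s :=
  (hf.exists_hasDerivWithinAt hP s).continuousWithinAt

theorem IsPiecewiseSmooth.exists_tendsto_left (hP : IsSparse P)
    (hf : IsPiecewiseSmooth P f) (s : ℝ) : ∃ L, Tendsto f (𝓝[<] s) (𝓝 L) := by
  obtain ⟨a, ha, hd⟩ := hP.exists_left s
  obtain ⟨g, hg, hfg⟩ := hf.2 a s ha hd
  refine ⟨g s, ?_⟩
  have h1 : Tendsto g (𝓝[Ico a s] s) (𝓝 (g s)) :=
    (hg.continuousOn s ⟨ha.le, le_rfl⟩).mono_left (nhdsWithin_mono _ Ico_subset_Icc_self)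
  have h2 : 𝓝[Ico a s] s = 𝓝[<] s := nhdsWithin_Ico_eq_nhdsLT ha
  rw [h2] at h1
  refine h1.congr' ?_
  filter_upwards [Ico_mem_nhdsLT ha] with x hx using (hfg hx).symm

theorem IsPiecewiseSmooth.contDiffAt (hP : IsSparse P)
    (hf : IsPiecewiseSmooth P f) {s : ℝ} (hs : s ∉ P) : ContDiffAt ℝ ∞ f s := by
  obtain ⟨a, ha, b, hb, hd⟩ := hP.exists_around hs
  obtain ⟨g, hg, hfg⟩ := hf.2 a b (ha.trans hb) hd
  refine (hg.contDiffAt (Icc_mem_nhds ha hb)).congr_of_eventuallyEq ?_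
  filter_upwards [Ico_mem_nhds ha hb] with x hx using hfg hx

theorem derivWithin_Ici_eq_deriv {s : ℝ} (h : DifferentiableAt ℝ f s) :
    derivWithin f (Ici s) s = deriv f s :=
  h.derivWithin (uniqueDiffWithinAt_Ici s)

/-- Keeps first order operators within the class. On `[a, b)` the right derivative is the derivative
within `Icc a b` of a smooth representative, also at the left end. -/
theorem IsPiecewiseSmooth.derivRight (hf : IsPiecewiseSmooth P f) :
    IsPiecewiseSmooth P fun s => derivWithin f (Ici s) s := by
  refine ⟨fun s => ?_, fun a b hab hd => ?_⟩
  · have h := derivWithin_comp_add_const f (2 * Real.pi) (s := Ici s) (x := s)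
    have h2 : (fun x => f (x + 2 * Real.pi)) = f := funext hf.1
    rw [h2] at h
    change derivWithin f (Ici (s + 2 * Real.pi)) (s + 2 * Real.pi) = derivWithin f (Ici s) s
    rw [h]
    congr 1
    ext x
    simp only [mem_vadd_set, mem_Ici, vadd_eq_add]
    exact ⟨fun hx => ⟨x - 2 * Real.pi, by linarith, by ring⟩, by rintro ⟨y, hy, rfl⟩; linarith⟩
  · obtain ⟨g, hg, hfg⟩ := hf.2 a b hab hd
    refine ⟨derivWithin g (Icc a b),
      hg.derivWithin (uniqueDiffOn_Icc hab) (by simp), fun s hs => ?_⟩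
    have h1 : HasDerivWithinAt g (derivWithin g (Icc a b) s) (Icc a b) s :=
      ((hg.differentiableOn (by simp)) s ⟨hs.1, hs.2.le⟩).hasDerivWithinAt
    have h2 : HasDerivWithinAt f (derivWithin g (Icc a b) s) (Ico s b) s :=
      (h1.mono fun x hx => ⟨hs.1.trans hx.1, hx.2.le⟩).congr
        (fun x hx => hfg ⟨hs.1.trans hx.1, hx.2⟩) (hfg hs)
    exact (h2.mono_of_mem_nhdsWithin (Ico_mem_nhdsGE hs.2)).derivWithin (uniqueDiffWithinAt_Ici s)

/-- Right continuity and the existence of left limits bound the function near every point;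
compactness then bounds it on one period. -/
theorem IsPiecewiseSmooth.exists_bound (hP : IsSparse P) (hf : IsPiecewiseSmooth P f) :
    ∃ C, ∀ s, ‖f s‖ ≤ C := by
  have hloc : ∀ s : ℝ, ∃ C, ∀ᶠ x in 𝓝 s, ‖f x‖ ≤ C := by
    intro s
    obtain ⟨L, hL⟩ := hf.exists_tendsto_left hP s
    have h1 : ∀ᶠ x in 𝓝[<] s, ‖f x‖ ≤ ‖L‖ + 1 :=
      (hL.norm.eventually (gt_mem_nhds (lt_add_one _))).mono fun _ h => h.le
    have h2 : ∀ᶠ x in 𝓝[≥] s, ‖f x‖ ≤ ‖f s‖ + 1 :=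
      ((hf.continuousWithinAt hP s).norm.eventually
        (gt_mem_nhds (lt_add_one _))).mono fun _ h => h.le
    refine ⟨max (‖L‖ + 1) (‖f s‖ + 1), ?_⟩
    rw [← nhdsLT_sup_nhdsGE, eventually_sup]
    exact ⟨h1.mono fun x h => h.trans (le_max_left _ _),
      h2.mono fun x h => h.trans (le_max_right _ _)⟩
  obtain ⟨C, hC⟩ : ∃ C, ∀ x ∈ Icc 0 (2 * Real.pi), ‖f x‖ ≤ C := by
    refine isCompact_Icc.induction_on (p := fun t => ∃ C, ∀ x ∈ t, ‖f x‖ ≤ C) ⟨0, by simp⟩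
      ?_ ?_ ?_
    · rintro s t hst ⟨C, hC⟩
      exact ⟨C, fun x hx => hC x (hst hx)⟩
    · rintro s t ⟨C, hC⟩ ⟨C', hC'⟩
      refine ⟨max C C', fun x hx => hx.elim (fun h => (hC x h).trans (le_max_left _ _))
        fun h => (hC' x h).trans (le_max_right _ _)⟩
    · intro x _
      obtain ⟨C, hC⟩ := hloc x
      exact ⟨_, nhdsWithin_le_nhds hC, C, fun y hy => hy⟩
  refine ⟨C, fun s => ?_⟩
  obtain ⟨y, hy, hys⟩ := hf.1.exists_mem_Ico₀ Real.two_pi_pos s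
  rw [hys]
  exact hC y ⟨hy.1, hy.2.le⟩

theorem IsPiecewiseSmooth.aestronglyMeasurable (hP : IsSparse P) (hf : IsPiecewiseSmooth P f) :
    AEStronglyMeasurable f volume := by
  have h1 : ContinuousOn f Pᶜ := fun s hs =>
    (hf.contDiffAt hP hs).continuousAt.continuousWithinAt
  have h2 : AEStronglyMeasurable f (volume.restrict Pᶜ) :=
    h1.aestronglyMeasurable hP.isOpen_compl.measurableSet
  rwa [Measure.restrict_eq_self_of_ae_mem] at h2
  have : volume P = 0 := hP.countable.measure_zero _
  exact measure_eq_zero_iff_ae_notMem.1 this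

theorem IsPiecewiseSmooth.intervalIntegrable (hP : IsSparse P) (hf : IsPiecewiseSmooth P f)
    (a b : ℝ) : IntervalIntegrable f volume a b := by
  obtain ⟨C, hC⟩ := hf.exists_bound hP
  refine (intervalIntegrable_const (c := C)).mono_fun
    (hf.aestronglyMeasurable hP).restrict (Eventually.of_forall fun x => ?_)
  exact (hC x).trans (le_abs_self C)

/-- For a continuous function an integrable right derivative suffices in the fundamental theorem of
calculus, so break points need no separate treatment. This is what makes right derivatives a
workable convention. -/
theorem IsContPiecewiseSmooth.integral_derivWithin [CompleteSpace V] (hP : IsSparse P)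
    (hf : IsContPiecewiseSmooth P f) (a b : ℝ) :
    ∫ s in a..b, derivWithin f (Ici s) s = f b - f a :=
  intervalIntegral.integral_eq_sub_of_hasDeriv_right hf.2.continuousOn
    (fun s _ => (hf.1.exists_hasDerivWithinAt hP s).mono Ioi_subset_Ici_self)
    (hf.1.derivRight.intervalIntegrable hP a b)

/-- Two periodic right-continuous functions agreeing almost everywhere agree. -/
theorem IsPiecewiseSmooth.eq_zero_of_ae (hP : IsSparse P) (hf : IsPiecewiseSmooth P f)
    (h : ∀ᵐ s ∂volume.restrict (Ioc 0 (2 * Real.pi)), f s = 0) : f = 0 := by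
  have key : ∀ s ∈ Ico 0 (2 * Real.pi), f s = 0 := by
    intro s hs
    by_contra hne
    -- By right continuity a nonzero value persists on an interval to the right of `s`, which has
    -- positive measure.
    have h1 : ∀ᶠ x in 𝓝[>] s, f x ≠ 0 :=
      ((hf.continuousWithinAt hP s).mono Ioi_subset_Ici_self).eventually_ne hne
    obtain ⟨b, hb, hbs⟩ := (mem_nhdsGT_iff_exists_Ioo_subset' hs.2).1 h1
    have h2 : volume (Ioo s (min b (2 * Real.pi))) = 0 := by
      rw [ae_restrict_iff' measurableSet_Ioc] at h
      refine measure_mono_null (t := {x | ¬ (x ∈ Ioc 0 (2 * Real.pi) → f x = 0)})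
        (fun x hx hx0 => ?_) h
      exact hbs ⟨hx.1, hx.2.trans_le (min_le_left _ _)⟩
        (hx0 ⟨hs.1.trans_lt hx.1, (hx.2.trans_le (min_le_right _ _)).le⟩)
    rw [Real.volume_Ioo, ENNReal.ofReal_eq_zero] at h2
    have := lt_min (show s < b from hb) hs.2
    linarith
  funext s
  obtain ⟨y, hy, hys⟩ := hf.1.exists_mem_Ico₀ Real.two_pi_pos s
  rw [hys]
  exact key y hy

end PS

/-! ### Periodic extension from one period -/

section Periodization

variable {V : Type*}

/-- The number of periods removed by `toIcoMod` changes only at translates of `y`. Without such a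
point in `(a, b)` a single integer serves all of `[a, b)`, and the reduction is a translation there.
-/
theorem exists_toIcoMod_eq_sub {y a b : ℝ}
    (hd : Disjoint (Ioo a b) {x : ℝ | ∃ l : ℤ, x = y + 2 * Real.pi * l}) :
    ∃ l : ℤ, ∀ s ∈ Ico a b, toIcoMod Real.two_pi_pos y s = s - 2 * Real.pi * l ∧
      s - 2 * Real.pi * l ∈ Ico y (y + 2 * Real.pi) := by
  refine ⟨toIcoDiv Real.two_pi_pos y a, fun s hs => ?_⟩
  set l := toIcoDiv Real.two_pi_pos y a with hl
  have h1 := toIcoMod_mem_Ico Real.two_pi_pos y a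
  have h2 : toIcoMod Real.two_pi_pos y a = a - 2 * Real.pi * l := by
    rw [toIcoMod, zsmul_eq_mul, mul_comm]
  rw [h2] at h1
  have h3 : s - 2 * Real.pi * l ∈ Ico y (y + 2 * Real.pi) := by
    refine ⟨by linarith [h1.1, hs.1], ?_⟩
    by_contra hcon
    push Not at hcon
    have hmem : y + 2 * Real.pi * ((l + 1 : ℤ) : ℝ) ∈ Ioo a b := ?_
    · exact Set.disjoint_left.1 hd hmem ⟨l + 1, rfl⟩
    constructor
    · push_cast; linarith [h1.2]
    · push_cast; linarith [hs.2]
  refine ⟨?_, h3⟩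
  have h4 := toIcoMod_sub_zsmul Real.two_pi_pos y s l
  rw [(toIcoMod_eq_self Real.two_pi_pos).2 (by simpa [mul_comm] using h3)] at h4
  rw [← h4, zsmul_eq_mul, mul_comm]

/-- The `2π`-periodic extension of a function on `[y, y + 2π)`. -/
def periodize (y : ℝ) (φ : ℝ → V) (s : ℝ) : V := φ (toIcoMod Real.two_pi_pos y s)

theorem periodize_periodic (y : ℝ) (φ : ℝ → V) :
    Function.Periodic (periodize y φ) (2 * Real.pi) := fun s => by
  simp [periodize]

theorem periodize_of_mem {y s : ℝ} (φ : ℝ → V) (hs : s ∈ Ico y (y + 2 * Real.pi)) :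
    periodize y φ s = φ s := by
  rw [periodize, (toIcoMod_eq_self Real.two_pi_pos).2 hs]

/-- On approach from the left the reduced variable tends to its representative in the interval
closed on the right. At a translate of `y` the limit is therefore the value of `φ` at `y + 2π`,
while the periodization itself takes the value at `y`: this is its jump. -/
theorem periodize_tendsto_left [TopologicalSpace V] {y : ℝ} {φ : ℝ → V}
    (hφ : ContinuousOn φ (Icc y (y + 2 * Real.pi))) (s : ℝ) :
    Tendsto (periodize y φ) (𝓝[<] s) (𝓝 (φ (toIocMod Real.two_pi_pos y s))) := by
  have hp := Real.two_pi_pos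
  have h1 : Tendsto (toIocMod hp y) (𝓝[<] s)
      (𝓝[Icc y (y + 2 * Real.pi)] (toIocMod hp y s)) := by
    refine tendsto_nhdsWithin_iff.2 ⟨?_, Eventually.of_forall fun x =>
      Ioc_subset_Icc_self (toIocMod_mem_Ioc hp y x)⟩
    exact (continuousWithinAt_toIocMod_Iic hp y s).mono_left (nhdsWithin_mono _ Iio_subset_Iic_self)
  have h2 := (hφ _ (Ioc_subset_Icc_self (toIocMod_mem_Ioc hp y s))).tendsto.comp h1
  refine h2.congr' ?_
  have h3 := ((isSparse_translates y).eventually s).filter_mono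
    (nhdsWithin_mono s fun x (hx : x < s) => ne_of_lt hx)
  filter_upwards [h3] with x hx
  have : toIcoMod hp y x = toIocMod hp y x := by
    by_contra hne
    have h4 : x ≡ y [PMOD (2 * Real.pi)] := by
      by_contra hm
      exact hne ((AddCommGroup.not_modEq_iff_toIcoMod_eq_toIocMod hp).1 fun h => hm h.symm)
    obtain ⟨l, hl⟩ := AddCommGroup.modEq_iff_eq_add_zsmul.1 h4.symm
    exact hx ⟨l, by rw [hl, zsmul_eq_mul, mul_comm]⟩
  simp [periodize, this]

theorem toIocMod_eq_toIcoMod {y s : ℝ} (h : ¬ ∃ l : ℤ, s = y + 2 * Real.pi * l) :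
    toIocMod Real.two_pi_pos y s = toIcoMod Real.two_pi_pos y s := by
  by_contra hne
  have h4 : s ≡ y [PMOD (2 * Real.pi)] := by
    by_contra hm
    exact hne ((AddCommGroup.not_modEq_iff_toIcoMod_eq_toIocMod _).1 fun h => hm h.symm).symm
  obtain ⟨l, hl⟩ := AddCommGroup.modEq_iff_eq_add_zsmul.1 h4.symm
  exact h ⟨l, by rw [hl, zsmul_eq_mul, mul_comm]⟩

theorem periodize_hasDerivWithinAt [NormedAddCommGroup V] [NormedSpace ℝ V] {y : ℝ} {φ φ' : ℝ → V}
    (h : ∀ s ∈ Ico y (y + 2 * Real.pi), HasDerivWithinAt φ (φ' s) (Ici s) s) (s : ℝ) :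
    HasDerivWithinAt (periodize y φ) (periodize y φ' s) (Ici s) s := by
  obtain ⟨b, hb, hd⟩ := (isSparse_translates y).exists_right s
  obtain ⟨l, hl⟩ := exists_toIcoMod_eq_sub hd
  have hs := hl s ⟨le_rfl, hb⟩
  have h1 := h _ hs.2
  have h2 : HasDerivWithinAt (fun x => φ (x - 2 * Real.pi * l)) (φ' (s - 2 * Real.pi * l))
      (Ici s) s := by
    have := h1.scomp_of_eq s (h := fun x => x - 2 * Real.pi * l) (h' := 1) (s := Ici s)
      ((hasDerivWithinAt_id _ _).sub_const _) (fun x hx => by simpa using hx) rfl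
    simpa [Function.comp_def] using this
  have h3 : HasDerivWithinAt (periodize y φ) (φ' (s - 2 * Real.pi * l)) (Ico s b) s :=
    (h2.mono Ico_subset_Ici_self).congr (fun x hx => by simp [periodize, (hl x hx).1])
      (by simp [periodize, hs.1])
  have h4 := h3.mono_of_mem_nhdsWithin (Ico_mem_nhdsGE hb)
  simpa [periodize, hs.1] using h4

theorem isPiecewiseSmooth_toIcoMod (y : ℝ) :
    IsPiecewiseSmooth {x : ℝ | ∃ l : ℤ, x = y + 2 * Real.pi * l}
      (toIcoMod Real.two_pi_pos y) := by
  refine ⟨fun s => by simp, fun a b hab hd => ?_⟩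
  obtain ⟨l, hl⟩ := exists_toIcoMod_eq_sub hd
  exact ⟨fun s => s - 2 * Real.pi * l, by fun_prop, fun s hs => (hl s hs).1⟩

end Periodization

/-! ### Regularity of solutions of linear equations, and jumps on the circle -/

section ODE

variable {V : Type*} [NormedAddCommGroup V] [NormedSpace ℝ V] [CompleteSpace V]

/-- Bootstrapping. Continuity and the right derivative give an integral equation; its integrand is
continuous, so `g` has a derivative within `Icc a b` everywhere, ends included. Each order of
smoothness of `g` on the right of the equation then yields one more on the left. -/
theorem contDiffOn_of_hasDerivWithinAt_Ici {a b : ℝ} (hab : a < b) {g : ℝ → V}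
    {A : ℝ → V →L[ℝ] V} {h : ℝ → V} (hA : ContDiffOn ℝ ∞ A (Icc a b))
    (hh : ContDiffOn ℝ ∞ h (Icc a b)) (hg : ContinuousOn g (Icc a b))
    (hd : ∀ s ∈ Ioo a b, HasDerivWithinAt g (A s (g s) + h s) (Ici s) s) :
    ContDiffOn ℝ ∞ g (Icc a b) := by
  have hc : ContinuousOn (fun s => A s (g s) + h s) (Icc a b) :=
    (hA.continuousOn.clm_apply hg).add hh.continuousOn
  have hint : ∀ s ∈ Icc a b, g s = g a + ∫ z in a..s, (A z (g z) + h z) := by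
    intro s hs
    rw [intervalIntegral.integral_eq_sub_of_hasDeriv_right_of_le hs.1
      (hg.mono (Icc_subset_Icc_right hs.2))
      (fun x hx => (hd x ⟨hx.1, hx.2.trans_le hs.2⟩).mono Ioi_subset_Ici_self)
      ((hc.mono (Icc_subset_Icc_right hs.2)).intervalIntegrable_of_Icc hs.1)]
    abel
  have hder : ∀ s ∈ Icc a b, HasDerivWithinAt g (A s (g s) + h s) (Icc a b) s := by
    intro s hs
    have : Fact (s ∈ Icc a b) := ⟨hs⟩
    have h1 : HasDerivWithinAt (fun u => ∫ z in a..u, (A z (g z) + h z)) (A s (g s) + h s)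
        (Icc a b) s := by
      refine intervalIntegral.integral_hasDerivWithinAt_right
        ((hc.mono (Icc_subset_Icc_right hs.2)).intervalIntegrable_of_Icc hs.1) ?_ (hc s hs)
      exact hc.stronglyMeasurableAtFilter_nhdsWithin measurableSet_Icc s
    exact (h1.const_add (g a)).congr hint (hint s hs)
  have hu := uniqueDiffOn_Icc hab
  rw [contDiffOn_infty]
  intro n
  induction n with
  | zero => exact contDiffOn_zero.2 hg
  | succ n ih =>
    push_cast
    rw [contDiffOn_succ_iff_derivWithin hu]
    refine ⟨fun s hs => (hder s hs).differentiableWithinAt, by simp, ?_⟩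
    have : ContDiffOn ℝ n (fun s => A s (g s) + h s) (Icc a b) :=
      ((hA.of_le (by exact_mod_cast le_top)).clm_apply ih).add (hh.of_le (by exact_mod_cast le_top))
    exact this.congr fun s hs => (hder s hs).derivWithin (hu s hs)

/-- A periodic solution of a linear equation with piecewise smooth coefficients is piecewise
smooth. -/
theorem isPiecewiseSmooth_of_hasDerivWithinAt {P : Set ℝ} {f h : ℝ → V} {A : ℝ → V →L[ℝ] V}
    (hA : IsPiecewiseSmooth P A) (hh : IsPiecewiseSmooth P h)
    (hf : Function.Periodic f (2 * Real.pi)) (hc : ∀ s ∉ P, ContinuousAt f s)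
    (hl : ∀ s, ∃ L, Tendsto f (𝓝[<] s) (𝓝 L))
    (hd : ∀ s, HasDerivWithinAt f (A s (f s) + h s) (Ici s) s) : IsPiecewiseSmooth P f := by
  refine ⟨hf, fun a b hab hP => ?_⟩
  obtain ⟨A', hA', hAA⟩ := hA.2 a b hab hP
  obtain ⟨h', hh', hhh⟩ := hh.2 a b hab hP
  obtain ⟨L, hL⟩ := hl b
  have hcont : ContinuousOn f (Ico a b) := by
    intro s hs
    rcases hs.1.eq_or_lt with h | h
    · subst h
      exact (hd a).continuousWithinAt.mono Ico_subset_Ici_self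
    · exact (hc s (Set.disjoint_left.1 hP ⟨h, hs.2⟩)).continuousWithinAt
  have hEq : ∀ s ∈ Ico a b, Function.update f b L s = f s := fun s hs =>
    Function.update_of_ne hs.2.ne _ _
  -- Replacing the value at `b` by the left limit makes the function continuous on the closed
  -- interval; the class ignores that value.
  refine ⟨Function.update f b L, ?_, fun s hs => (hEq s hs).symm⟩
  refine contDiffOn_of_hasDerivWithinAt_Ici hab hA' hh' ?_ fun s hs => ?_
  · have h1 : Icc a b \ {b} = Ico a b := by simp
    intro s hs
    rcases hs.2.eq_or_lt with h | h
    · subst h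
      rw [continuousWithinAt_update_same, h1, nhdsWithin_Ico_eq_nhdsLT hab]
      exact hL
    · rw [continuousWithinAt_update_of_ne h.ne]
      refine (hcont s ⟨hs.1, h⟩).mono_of_mem_nhdsWithin ?_
      filter_upwards [inter_mem_nhdsWithin (Icc a b) (Iio_mem_nhds h)] with x hx
      exact ⟨hx.1.1, hx.2⟩
  · have hs' := Ioo_subset_Ico_self hs
    rw [hEq s hs', ← hAA hs', ← hhh hs']
    refine (hd s).congr_of_eventuallyEq ?_ (hEq s hs')
    filter_upwards [Ico_mem_nhdsGE hs.2] with x hx using hEq x ⟨hs.1.le.trans hx.1, hx.2⟩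

end ODE

/-- The fundamental theorem of calculus on the circle for a function with jumps. -/
theorem integral_derivRight_eq_neg_sum_jumps {n : ℕ} {lam : Fin n → ℝ}
    (h0 : ∀ α, 0 ≤ lam α) (h2 : ∀ α, lam α < 2 * Real.pi) (hinj : Function.Injective lam)
    {P : Set ℝ} (hP : IsSparse P) (hPl : ∀ α, {x : ℝ | ∃ l : ℤ, x = lam α + 2 * Real.pi * l} ⊆ P)
    {φ : ℝ → ℂ} (hφ : IsPiecewiseSmooth P φ)
    (hc : ∀ s, (¬ ∃ α, ∃ l : ℤ, s = lam α + 2 * Real.pi * l) → ContinuousAt φ s)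
    {L : Fin n → ℂ} (hL : ∀ α, Tendsto φ (𝓝[<] lam α) (𝓝 (L α))) :
    ∫ s in (0 : ℝ)..(2 * Real.pi), derivWithin φ (Ici s) s = - ∑ α, (φ (lam α) - L α) := by
  have hp := Real.two_pi_pos
  -- The sawtooth `τ α` has slope one and drops by `2π` at the translates of `lam α`, so adding `τ α
  -- * c α` removes the jump of `φ` there. The corrected function is continuous and periodic, hence
  -- its derivative has integral zero, and the slopes `c α` account for the sum of the jumps.
  set τ : Fin n → ℝ → ℝ := fun α => toIcoMod hp (lam α) with hτ
  set c : Fin n → ℂ := fun α => (φ (lam α) - L α) / (2 * Real.pi) with hcdef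
  have hτP : ∀ α, IsPiecewiseSmooth P (τ α) := fun α =>
    (isPiecewiseSmooth_toIcoMod (lam α)).mono (hPl α)
  have hτ' : ∀ α, IsPiecewiseSmooth P fun s => (τ α s : ℂ) * c α := fun α =>
    (hτP α).comp (F := fun x : ℝ => (x : ℂ) * c α)
      (Complex.ofRealCLM.contDiff.mul contDiff_const)
  have hPS : IsPiecewiseSmooth P fun s => φ s + ∑ α, (τ α s : ℂ) * c α :=
    hφ.add (IsPiecewiseSmooth.sum _ fun α _ => hτ' α)
  have hleft : ∀ α s, Tendsto (τ α) (𝓝[<] s) (𝓝 (toIocMod hp (lam α) s)) := fun α s =>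
    periodize_tendsto_left (y := lam α) (φ := fun x => x) continuousOn_id s
  have hcont : Continuous fun s => φ s + ∑ α, (τ α s : ℂ) * c α := by
    rw [continuous_iff_continuousAt]
    intro s
    rw [← continuousWithinAt_univ, ← Iio_union_Ici (a := s), continuousWithinAt_union]
    refine ⟨?_, hPS.continuousWithinAt hP s⟩
    have key : ∃ ℓ, Tendsto φ (𝓝[<] s) (𝓝 ℓ) ∧
        ℓ + ∑ α, ((toIocMod hp (lam α) s : ℝ) : ℂ) * c α = φ s + ∑ α, (τ α s : ℂ) * c α := by
      by_cases hs : ∃ α, ∃ l : ℤ, s = lam α + 2 * Real.pi * l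
      · obtain ⟨α, l, rfl⟩ := hs
        refine ⟨L α, ?_, ?_⟩
        · have h1 : Tendsto (fun x : ℝ => x - 2 * Real.pi * l)
              (𝓝[<] (lam α + 2 * Real.pi * l)) (𝓝[<] (lam α)) := by
            refine tendsto_nhdsWithin_iff.2 ⟨?_, ?_⟩
            · have : ContinuousAt (fun x : ℝ => x - 2 * Real.pi * l)
                (lam α + 2 * Real.pi * l) := by fun_prop
              have h3 := this.tendsto
              simp only [add_sub_cancel_right] at h3
              exact h3.mono_left nhdsWithin_le_nhds
            · filter_upwards [self_mem_nhdsWithin] with x hx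
              simp only [mem_Iio] at *
              linarith
          refine ((hL α).comp h1).congr fun x => ?_
          have := hφ.1.sub_zsmul_eq (x := x) l
          simpa [mul_comm] using this
        · have hper : φ (lam α + 2 * Real.pi * l) = φ (lam α) := by
            have := hφ.1.int_mul l (lam α)
            simpa [mul_comm] using this
          -- Marked points in `[0, 2π)` are incongruent modulo `2π`, so at a translate of `lam α`
          -- only the sawtooth with index `α` jumps.
          have h3 : ∀ β, ((toIocMod hp (lam β) (lam α + 2 * Real.pi * l) : ℝ) : ℂ)
              = τ β (lam α + 2 * Real.pi * l) + if β = α then 2 * (Real.pi : ℂ) else 0 := by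
            intro β
            have e1 : lam α + 2 * Real.pi * l = lam α + l • (2 * Real.pi) := by
              rw [zsmul_eq_mul, mul_comm]
            split_ifs with hβ
            · subst hβ
              rw [hτ]
              simp only [e1, toIocMod_add_zsmul, toIcoMod_add_zsmul, toIocMod_apply_left,
                toIcoMod_apply_left]
              push_cast; ring
            · rw [toIocMod_eq_toIcoMod, add_zero]
              rintro ⟨m, hm⟩
              have h4 : lam α - lam β = 2 * Real.pi * ((m - l : ℤ) : ℝ) := by
                push_cast; linarith
              have h5 : |lam α - lam β| < 2 * Real.pi := by
                rw [abs_lt]; constructor <;> linarith [h0 α, h0 β, h2 α, h2 β]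
              rw [h4, abs_mul, abs_of_pos hp] at h5
              have h6 : |((m - l : ℤ) : ℝ)| < 1 := by nlinarith
              have h7 : |m - l| < 1 := by exact_mod_cast h6
              rw [Int.abs_lt_one_iff] at h7
              rw [h7] at h4
              simp only [Int.cast_zero, mul_zero] at h4
              exact hβ (hinj (by linarith))
          rw [hper]
          simp only [h3, add_mul, Finset.sum_add_distrib, ite_mul, zero_mul]
          rw [Finset.sum_ite_eq' Finset.univ α]
          simp only [Finset.mem_univ, if_true, hcdef]
          have : (Real.pi : ℂ) ≠ 0 := by exact_mod_cast Real.pi_ne_zero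
          field_simp
          ring
      · refine ⟨φ s, (hc s hs).tendsto.mono_left nhdsWithin_le_nhds, ?_⟩
        congr 1
        refine Finset.sum_congr rfl fun α _ => ?_
        rw [toIocMod_eq_toIcoMod fun ⟨l, hl⟩ => hs ⟨α, l, hl⟩]
    obtain ⟨ℓ, hℓ, hsum⟩ := key
    change Tendsto _ _ (𝓝 (φ s + ∑ α, (τ α s : ℂ) * c α))
    rw [← hsum]
    refine hℓ.add (tendsto_finsetSum _ fun α _ => ?_)
    exact ((Complex.continuous_ofReal.tendsto _).comp (hleft α s)).mul_const _
  have hint := IsContPiecewiseSmooth.integral_derivWithin hP ⟨hPS, hcont⟩ 0 (2 * Real.pi)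
  have hper : (φ (2 * Real.pi) + ∑ α, (τ α (2 * Real.pi) : ℂ) * c α)
      = φ 0 + ∑ α, (τ α 0 : ℂ) * c α := by
    have := hPS.1 0
    rwa [zero_add] at this
  rw [hper, sub_self] at hint
  have hτd : ∀ α s, HasDerivWithinAt (fun x => (τ α x : ℂ) * c α) (c α) (Ici s) s := by
    intro α s
    have h1 : HasDerivWithinAt (τ α) 1 (Ici s) s :=
      periodize_hasDerivWithinAt (y := lam α) (φ := fun x => x) (φ' := fun _ => 1)
        (fun x _ => hasDerivWithinAt_id x _) s
    simpa using (h1.ofReal_comp).mul_const (c α)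
  have hd : ∀ s, derivWithin (fun s => φ s + ∑ α, (τ α s : ℂ) * c α) (Ici s) s
      = derivWithin φ (Ici s) s + ∑ α, c α := fun s =>
    ((hφ.exists_hasDerivWithinAt hP s).add
      (HasDerivWithinAt.fun_sum fun α _ => hτd α s)).derivWithin (uniqueDiffWithinAt_Ici s)
  simp only [hd] at hint
  rw [intervalIntegral.integral_add (hφ.derivRight.intervalIntegrable hP _ _)
    intervalIntegrable_const, intervalIntegral.integral_const] at hint
  rw [eq_neg_of_add_eq_zero_left hint, sub_zero, Finset.smul_sum]
  congr 1
  refine Finset.sum_congr rfl fun α _ => ?_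
  have : (Real.pi : ℂ) ≠ 0 := by exact_mod_cast Real.pi_ne_zero
  simp only [hcdef, Complex.real_smul]
  push_cast
  field_simp

/-! ### Volterra operators depending affinely on parameters -/

theorem contDiff_ringInverse_affine {G : Type*} [NormedAddCommGroup G] [NormedSpace ℝ G]
    [CompleteSpace G] {ι : Type*} [Fintype ι] {K₀ : G →L[ℝ] G} {K : ι → G →L[ℝ] G}
    (h : ∀ t : ι → ℝ, IsUnit (1 - (K₀ + ∑ i, t i • K i))) :
    ContDiff ℝ ∞ fun t : ι → ℝ => Ring.inverse (1 - (K₀ + ∑ i, t i • K i)) := by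
  rw [contDiff_iff_contDiffAt]
  intro t
  obtain ⟨u, hu⟩ := h t
  have h1 : ContDiffAt ℝ ∞ Ring.inverse (1 - (K₀ + ∑ i, t i • K i)) := by
    rw [← hu]
    exact contDiffAt_ringInverse ℝ u
  refine h1.comp t (f := fun t : ι → ℝ => 1 - (K₀ + ∑ i, t i • K i)) ?_
  fun_prop

/-- The unit `1 - K ^ n` is the product of `1 - K` and a geometric sum. The two factors commute, so
each of them is a unit. -/
theorem isUnit_one_sub_of_norm_pow_lt_one {G : Type*} [NormedAddCommGroup G] [NormedSpace ℝ G]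
    [CompleteSpace G] {K : G →L[ℝ] G} {n : ℕ} (h : ‖K ^ n‖ < 1) : IsUnit (1 - K) := by
  have hu : IsUnit (1 - K ^ n) := isUnit_one_sub_of_norm_lt_one h
  have hcomm : Commute (1 - K) (∑ i ∈ Finset.range n, K ^ i) :=
    Commute.sum_right _ _ _ fun i _ =>
      (Commute.one_left _).sub_left ((Commute.refl K).pow_right i)
  rw [← mul_neg_geom_sum K n] at hu
  exact (hcomm.isUnit_mul_iff.1 hu).1

section Volterra

variable {𝔸 : Type*} [NormedRing 𝔸] {a b : ℝ}

/-- A bounded measurable function on the line. -/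
def IsBoundedMeasurable (A : ℝ → 𝔸) : Prop :=
  AEStronglyMeasurable A volume ∧ ∃ C, ∀ s, ‖A s‖ ≤ C

theorem isBoundedMeasurable_const (c : 𝔸) : IsBoundedMeasurable fun _ => c :=
  ⟨aestronglyMeasurable_const, ‖c‖, fun _ => le_rfl⟩

theorem IsBoundedMeasurable.intervalIntegrable_mul {A : ℝ → 𝔸} (hA : IsBoundedMeasurable A)
    (hab : a ≤ b) (φ : C(Icc a b, 𝔸)) (c d : ℝ) :
    IntervalIntegrable (fun z => A z * IccExtend hab φ z) volume c d := by
  obtain ⟨h1, C, hC⟩ := hA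
  refine (intervalIntegrable_const (c := C * ‖φ‖)).mono_fun
    (h1.mul (φ.continuous.Icc_extend').aestronglyMeasurable).restrict
    (Eventually.of_forall fun x => ?_)
  refine (norm_mul_le _ _).trans ((mul_le_mul (hC x) (φ.norm_coe_le_norm _) (norm_nonneg _)
    ((norm_nonneg _).trans (hC x))).trans (le_abs_self _))

variable [NormedAlgebra ℝ 𝔸]

/-- The Volterra operator `φ ↦ ∫ₐ A φ` on the continuous functions on `[a, b]`. -/
def volterra (hab : a ≤ b) (A : ℝ → 𝔸) (hA : IsBoundedMeasurable A) :
    C(Icc a b, 𝔸) →L[ℝ] C(Icc a b, 𝔸) :=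
  LinearMap.mkContinuousOfExistsBound
    { toFun := fun φ => ⟨fun s => ∫ z in a..s, A z * IccExtend hab φ z,
        (intervalIntegral.continuous_primitive
          (fun c d => hA.intervalIntegrable_mul hab φ c d) a).comp continuous_subtype_val⟩
      map_add' := fun φ ψ => by
        ext s
        simp only [ContinuousMap.coe_mk, ContinuousMap.add_apply]
        rw [← intervalIntegral.integral_add (hA.intervalIntegrable_mul hab φ _ _)
          (hA.intervalIntegrable_mul hab ψ _ _)]
        simp [IccExtend, mul_add]
      map_smul' := fun c φ => by
        ext s
        simp only [ContinuousMap.coe_mk, ContinuousMap.smul_apply, RingHom.id_apply]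
        rw [← intervalIntegral.integral_smul]
        simp [IccExtend] }
    (by
      obtain ⟨C, hC⟩ := hA.2
      have hC0 : 0 ≤ C := (norm_nonneg _).trans (hC 0)
      refine ⟨C * (b - a), fun φ => ?_⟩
      rw [ContinuousMap.norm_le _ (by have := sub_nonneg.2 hab; positivity)]
      intro s
      refine (intervalIntegral.norm_integral_le_of_norm_le_const (C := C * ‖φ‖)
        fun z _ => (norm_mul_le _ _).trans (mul_le_mul (hC z) (φ.norm_coe_le_norm _)
          (norm_nonneg _) hC0)).trans ?_
      rw [abs_of_nonneg (sub_nonneg.2 s.2.1)]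
      have : (s : ℝ) - a ≤ b - a := sub_le_sub_right s.2.2 a
      calc C * ‖φ‖ * (s - a) ≤ C * ‖φ‖ * (b - a) := by gcongr
        _ = C * (b - a) * ‖φ‖ := by ring)

theorem volterra_apply (hab : a ≤ b) {A : ℝ → 𝔸} (hA : IsBoundedMeasurable A)
    (φ : C(Icc a b, 𝔸)) (s : Icc a b) :
    volterra hab A hA φ s = ∫ z in a..s, A z * IccExtend hab φ z := rfl

/-- The `n`-fold iterated integral runs over a simplex, whence the factorial. It beats every power
of the bound `C`, so no smallness of the coefficient or of the interval is needed. -/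
theorem norm_volterra_pow_apply_le (hab : a ≤ b) {A : ℝ → 𝔸} (hA : IsBoundedMeasurable A)
    {C : ℝ} (hC : ∀ s, ‖A s‖ ≤ C) (φ : C(Icc a b, 𝔸)) (n : ℕ) (s : Icc a b) :
    ‖((volterra hab A hA) ^ n) φ s‖ ≤ C ^ n * ‖φ‖ * ((s - a) ^ n / n.factorial) := by
  have hC0 : 0 ≤ C := (norm_nonneg _).trans (hC 0)
  induction n generalizing s with
  | zero => simpa using φ.norm_coe_le_norm s
  | succ n ih =>
    rw [pow_succ', mul_apply_eq_comp, volterra_apply]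
    set ψ := ((volterra hab A hA) ^ n) φ
    have h1 : ∀ z ∈ Ioc a (s : ℝ), ‖A z * IccExtend hab ψ z‖
        ≤ C ^ (n + 1) * ‖φ‖ * ((z - a) ^ n / n.factorial) := by
      intro z hz
      have hz' : z ∈ Icc a b := ⟨hz.1.le, hz.2.trans s.2.2⟩
      rw [IccExtend_of_mem _ _ hz']
      refine (norm_mul_le _ _).trans ((mul_le_mul (hC z) (ih ⟨z, hz'⟩) (norm_nonneg _)
        hC0).trans (le_of_eq (by ring)))
    refine (intervalIntegral.norm_integral_le_of_norm_le s.2.1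
      (Eventually.of_forall fun z hz => h1 z hz)
      (Continuous.intervalIntegrable (by fun_prop) _ _)).trans (le_of_eq ?_)
    rw [intervalIntegral.integral_const_mul, intervalIntegral.integral_div,
      intervalIntegral.integral_comp_sub_right (fun z => z ^ n), integral_pow]
    rw [Nat.factorial_succ]
    push_cast
    have : (n.factorial : ℝ) ≠ 0 := by positivity
    field_simp
    simp

theorem isUnit_one_sub_volterra [CompleteSpace 𝔸] (hab : a ≤ b) {A : ℝ → 𝔸}
    (hA : IsBoundedMeasurable A) : IsUnit (1 - volterra hab A hA) := by
  obtain ⟨C, hC⟩ := hA.2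
  have hC0 : 0 ≤ C := (norm_nonneg _).trans (hC 0)
  set K := volterra hab A hA with hK
  have hlim := FloorSemiring.tendsto_pow_div_factorial_atTop (C * (b - a))
  obtain ⟨n, hn⟩ := (hlim.eventually (gt_mem_nhds one_pos)).exists
  have hab' := sub_nonneg.2 hab
  have hnorm : ‖K ^ n‖ < 1 := by
    refine lt_of_le_of_lt (ContinuousLinearMap.opNorm_le_bound _ (by positivity) fun φ => ?_) hn
    rw [ContinuousMap.norm_le _ (by positivity)]
    intro s
    refine (norm_volterra_pow_apply_le hab hA hC φ n s).trans ?_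
    have h1 : (s : ℝ) - a ≤ b - a := sub_le_sub_right s.2.2 a
    have h2 : 0 ≤ (s : ℝ) - a := sub_nonneg.2 s.2.1
    calc C ^ n * ‖φ‖ * ((s - a) ^ n / n.factorial)
        ≤ C ^ n * ‖φ‖ * ((b - a) ^ n / n.factorial) := by gcongr
      _ = (C * (b - a)) ^ n / n.factorial * ‖φ‖ := by rw [mul_pow]; ring
  exact isUnit_one_sub_of_norm_pow_lt_one hnorm

/-- The generator of the linear equation `φ' = (A₀ + ∑ t_μ B_μ) φ`. -/
def volterraParam (hab : a ≤ b) {A₀ : ℝ → 𝔸} (hA : IsBoundedMeasurable A₀) (B : Fin 4 → 𝔸)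
    (t : Fin 4 → ℝ) : C(Icc a b, 𝔸) →L[ℝ] C(Icc a b, 𝔸) :=
  volterra hab A₀ hA + ∑ μ, t μ • volterra hab (fun _ => B μ) (isBoundedMeasurable_const _)

/-- The solution operator `φ ↦ ψ` of `ψ(s) = φ(s) + ∫ₐˢ (A₀ + ∑ t_μ B_μ) ψ`. -/
def solve (hab : a ≤ b) {A₀ : ℝ → 𝔸} (hA : IsBoundedMeasurable A₀) (B : Fin 4 → 𝔸)
    (t : Fin 4 → ℝ) : C(Icc a b, 𝔸) →L[ℝ] C(Icc a b, 𝔸) :=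
  Ring.inverse (1 - volterraParam hab hA B t)

theorem isBoundedMeasurable_param {A₀ : ℝ → 𝔸} (hA : IsBoundedMeasurable A₀) (B : Fin 4 → 𝔸)
    (t : Fin 4 → ℝ) : IsBoundedMeasurable fun s => A₀ s + ∑ μ, t μ • B μ := by
  obtain ⟨h, C, hC⟩ := hA
  exact ⟨h.add aestronglyMeasurable_const, C + ‖∑ μ, t μ • B μ‖, fun s =>
    (norm_add_le _ _).trans (add_le_add_left (hC s) _)⟩

/-- The operator is affine in `t`, which gives smoothness of its resolvent, and for each fixed `t`
it is a single Volterra operator, which gives invertibility of `1` minus it. -/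
theorem volterraParam_eq (hab : a ≤ b) {A₀ : ℝ → 𝔸} (hA : IsBoundedMeasurable A₀)
    (B : Fin 4 → 𝔸) (t : Fin 4 → ℝ) :
    volterraParam hab hA B t = volterra hab _ (isBoundedMeasurable_param hA B t) := by
  ext φ s
  simp only [volterraParam, add_apply, sum_apply,
    smul_apply, ContinuousMap.add_apply, ContinuousMap.sum_apply,
    ContinuousMap.smul_apply, volterra_apply]
  simp only [add_mul, Finset.sum_mul, smul_mul_assoc]
  have hi : ∀ μ, IntervalIntegrable (fun z => t μ • (B μ * IccExtend hab φ z)) volume a s :=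
    fun μ => ((isBoundedMeasurable_const (B μ)).intervalIntegrable_mul hab φ _ _).smul (t μ)
  rw [intervalIntegral.integral_add (hA.intervalIntegrable_mul hab φ _ _)
    (by
      have := IntervalIntegrable.sum Finset.univ (f := fun μ z => t μ • (B μ * IccExtend hab φ z))
        (fun μ _ => hi μ)
      simpa [Finset.sum_fn] using this),
    intervalIntegral.integral_finsetSum fun μ _ => hi μ]
  simp [intervalIntegral.integral_smul]

variable [CompleteSpace 𝔸]

theorem isUnit_one_sub_volterraParam (hab : a ≤ b) {A₀ : ℝ → 𝔸} (hA : IsBoundedMeasurable A₀)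
    (B : Fin 4 → 𝔸) (t : Fin 4 → ℝ) : IsUnit (1 - volterraParam hab hA B t) := by
  rw [volterraParam_eq]
  exact isUnit_one_sub_volterra hab _

theorem contDiff_solve (hab : a ≤ b) {A₀ : ℝ → 𝔸} (hA : IsBoundedMeasurable A₀)
    (B : Fin 4 → 𝔸) : ContDiff ℝ ∞ (solve hab hA B) :=
  contDiff_ringInverse_affine (isUnit_one_sub_volterraParam hab hA B)

theorem solve_apply (hab : a ≤ b) {A₀ : ℝ → 𝔸} (hA : IsBoundedMeasurable A₀)
    (B : Fin 4 → 𝔸) (t : Fin 4 → ℝ) (φ : C(Icc a b, 𝔸)) (s : Icc a b) :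
    solve hab hA B t φ s = φ s +
      ∫ z in a..s, (A₀ z + ∑ μ, t μ • B μ) * IccExtend hab (solve hab hA B t φ) z := by
  have h : (1 - volterraParam hab hA B t) * solve hab hA B t = 1 :=
    Ring.mul_inverse_cancel _ (isUnit_one_sub_volterraParam hab hA B t)
  have h2 := congrArg (fun L => L φ s) h
  rw [volterraParam_eq] at h2
  simp only [mul_apply_eq_comp, sub_apply,
    one_apply_eq_self, ContinuousMap.sub_apply, volterra_apply] at h2
  rw [← h2]
  abel

theorem eq_solve (hab : a ≤ b) {A₀ : ℝ → 𝔸} (hA : IsBoundedMeasurable A₀)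
    (B : Fin 4 → 𝔸) (t : Fin 4 → ℝ) {φ ψ : C(Icc a b, 𝔸)}
    (hψ : ∀ s : Icc a b, ψ s = φ s +
      ∫ z in a..s, (A₀ z + ∑ μ, t μ • B μ) * IccExtend hab ψ z) :
    ψ = solve hab hA B t φ := by
  have h : solve hab hA B t * (1 - volterraParam hab hA B t) = 1 :=
    Ring.inverse_mul_cancel _ (isUnit_one_sub_volterraParam hab hA B t)
  have h2 := congrArg (fun L => L ψ) h
  have h3 : (1 - volterraParam hab hA B t) ψ = φ := by
    ext s
    rw [volterraParam_eq]
    simp only [sub_apply, one_apply_eq_self,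
      ContinuousMap.sub_apply, volterra_apply]
    rw [hψ s]
    abel
  simpa [h3] using h2.symm

end Volterra

/-! ### Joint smoothness of families with values in continuous functions -/

section Joint

variable {V : Type*} [NormedAddCommGroup V] [NormedSpace ℝ V] {a b : ℝ}

theorem hasDerivWithinAt_Icc_iff_integral [CompleteSpace V] (hab : a < b) (φ φ' : C(Icc a b, V)) :
    (∀ s ∈ Icc a b, HasDerivWithinAt (IccExtend hab.le φ) (IccExtend hab.le φ' s) (Icc a b) s) ↔
    ∀ s ∈ Icc a b, IccExtend hab.le φ s = IccExtend hab.le φ a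
      + ∫ z in a..s, IccExtend hab.le φ' z := by
  have hc : Continuous (IccExtend hab.le φ') := φ'.continuous.Icc_extend'
  constructor
  · intro h s hs
    have hd : ∀ x ∈ Ioo a s, HasDerivWithinAt (IccExtend hab.le φ) (IccExtend hab.le φ' x)
        (Ioi x) x := fun x hx =>
      (h x ⟨hx.1.le, hx.2.le.trans hs.2⟩).mono_of_mem_nhdsWithin
        (mem_of_superset (Ioc_mem_nhdsGT (hx.2.trans_le hs.2))
          fun z hz => ⟨hx.1.le.trans hz.1.le, hz.2⟩)
    rw [intervalIntegral.integral_eq_sub_of_hasDeriv_right_of_le hs.1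
      (φ.continuous.Icc_extend').continuousOn hd (hc.intervalIntegrable _ _)]
    exact (add_sub_cancel _ _).symm
  · intro h s hs
    have h1 : HasDerivAt (fun u => ∫ z in a..u, IccExtend hab.le φ' z) (IccExtend hab.le φ' s) s :=
      intervalIntegral.integral_hasDerivAt_right (hc.intervalIntegrable _ _)
        (hc.stronglyMeasurableAtFilter _ _) hc.continuousAt
    exact (h1.hasDerivWithinAt.const_add (IccExtend hab.le φ a)).congr h (h s hs)

variable {T : Type*} [NormedAddCommGroup T] [NormedSpace ℝ T]

/-- The derivatives in `s` and in the parameter commute: the former is equivalent to an integral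
equation between evaluations and an integral, which are continuous linear in the functions, and
differentiating that equation in the parameter preserves its form. -/
theorem hasDerivWithinAt_fderiv [CompleteSpace V] (hab : a < b) {Θ Θ' : T → C(Icc a b, V)} (hΘ : ContDiff ℝ ∞ Θ)
    (hΘ' : ContDiff ℝ ∞ Θ')
    (h : ∀ t, ∀ s ∈ Icc a b, HasDerivWithinAt (IccExtend hab.le (Θ t))
      (IccExtend hab.le (Θ' t) s) (Icc a b) s) (v t : T) :
    ∀ s ∈ Icc a b, HasDerivWithinAt (IccExtend hab.le (fderiv ℝ Θ t v))
      (IccExtend hab.le (fderiv ℝ Θ' t v) s) (Icc a b) s := by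
  rw [hasDerivWithinAt_Icc_iff_integral hab]
  intro s hs
  have ha : a ∈ Icc a b := ⟨le_rfl, hab.le⟩
  let I : C(Icc a b, V) →L[ℝ] V := LinearMap.mkContinuous
    { toFun := fun φ => ∫ z in a..s, IccExtend hab.le φ z
      map_add' := fun φ ψ => by
        rw [← intervalIntegral.integral_add
          ((φ.continuous.Icc_extend').intervalIntegrable _ _)
          ((ψ.continuous.Icc_extend').intervalIntegrable _ _)]
        simp [IccExtend]
      map_smul' := fun c φ => by
        simp only [RingHom.id_apply]
        rw [← intervalIntegral.integral_smul]
        simp [IccExtend] } (s - a) (fun φ => by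
      refine (intervalIntegral.norm_integral_le_of_norm_le_const (C := ‖φ‖)
        fun z _ => φ.norm_coe_le_norm _).trans ?_
      rw [abs_of_nonneg (sub_nonneg.2 hs.1), mul_comm])
  have key : ∀ t, ContinuousMap.evalCLM ℝ (⟨s, hs⟩ : Icc a b) (Θ t)
      = ContinuousMap.evalCLM ℝ (⟨a, ha⟩ : Icc a b) (Θ t) + I (Θ' t) := by
    intro t
    have := (hasDerivWithinAt_Icc_iff_integral hab (Θ t) (Θ' t)).1 (h t) s hs
    rw [IccExtend_of_mem _ _ hs, IccExtend_of_mem _ _ ha] at this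
    exact this
  have hd : HasFDerivAt Θ (fderiv ℝ Θ t) t := (hΘ.differentiable (by simp) t).hasFDerivAt
  have hd' : HasFDerivAt Θ' (fderiv ℝ Θ' t) t := (hΘ'.differentiable (by simp) t).hasFDerivAt
  have h1 := (ContinuousMap.evalCLM ℝ (⟨s, hs⟩ : Icc a b)).hasFDerivAt.comp t hd
  have h2 := ((ContinuousMap.evalCLM ℝ (⟨a, ha⟩ : Icc a b)).hasFDerivAt.comp t hd).add
    (I.hasFDerivAt.comp t hd')
  have h3 := h1.unique (h2.congr_of_eventuallyEq (Eventually.of_forall key))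
  have h4 := congrArg (fun L => L v) h3
  rw [IccExtend_of_mem _ _ hs, IccExtend_of_mem _ _ ha]
  exact h4

/-- Near `(t, s)` the value of `Θ t'` at `s'` is the sum of `Θ t s'`, of the linear term `fderiv ℝ Θ
t (t' - t)` at `s'`, and of a remainder. The first is differentiable in `s'`; the second needs only
continuity of the linear term in `s'`; the third is small uniformly in `s'`, because `Θ` is
differentiable for the sup norm. -/
theorem hasFDerivWithinAt_uncurry [FiniteDimensional ℝ T] (hab : a < b) {Θ Θ' : T → C(Icc a b, V)}
    (hΘ : ContDiff ℝ ∞ Θ)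
    (h : ∀ t, ∀ s ∈ Icc a b, HasDerivWithinAt (IccExtend hab.le (Θ t))
      (IccExtend hab.le (Θ' t) s) (Icc a b) s) (p : T × ℝ) (hp : p ∈ (univ : Set T) ×ˢ Icc a b) :
    HasFDerivWithinAt (fun p : T × ℝ => IccExtend hab.le (Θ p.1) p.2)
      ((ContinuousMap.evalCLM ℝ (projIcc a b hab.le p.2) ∘L fderiv ℝ Θ p.1).comp
          (ContinuousLinearMap.fst ℝ T ℝ)
        + (ContinuousLinearMap.toSpanSingleton ℝ (IccExtend hab.le (Θ' p.1) p.2)).comp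
          (ContinuousLinearMap.snd ℝ T ℝ)) ((univ : Set T) ×ˢ Icc a b) p := by
  obtain ⟨t, s⟩ := p
  simp only
  have hd : HasFDerivAt Θ (fderiv ℝ Θ t) t := (hΘ.differentiable (by simp) t).hasFDerivAt
  set G : ℝ → T →L[ℝ] V := fun s' =>
    ContinuousMap.evalCLM ℝ (projIcc a b hab.le s') ∘L fderiv ℝ Θ t with hG
  have hGc : Continuous G := by
    rw [continuous_clm_apply]
    intro v
    exact (fderiv ℝ Θ t v).continuous.Icc_extend'
  have h1 : HasFDerivWithinAt (fun p : T × ℝ => IccExtend hab.le (Θ t) p.2)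
      ((ContinuousLinearMap.toSpanSingleton ℝ (IccExtend hab.le (Θ' t) s)).comp
        (ContinuousLinearMap.snd ℝ T ℝ)) ((univ : Set T) ×ˢ Icc a b) (t, s) :=
    (h t s hp.2).hasFDerivWithinAt.comp (t, s) (f := Prod.snd) hasFDerivWithinAt_snd
      fun p hp => hp.2
  have h2 : HasFDerivWithinAt (fun p : T × ℝ => G p.2 (p.1 - t))
      ((G s).comp (ContinuousLinearMap.fst ℝ T ℝ)) ((univ : Set T) ×ˢ Icc a b) (t, s) := by
    refine .of_isLittleO ?_
    have e : ∀ p : T × ℝ, G p.2 (p.1 - t) - G (t, s).2 ((t, s).1 - t)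
        - ((G s).comp (ContinuousLinearMap.fst ℝ T ℝ)) (p - (t, s))
        = (G p.2 - G s) (p.1 - t) := fun p => by simp
    simp only [e]
    have ho : (fun p : T × ℝ => ‖G p.2 - G s‖) =o[𝓝[univ ×ˢ Icc a b] (t, s)]
        fun _ => (1 : ℝ) := by
      rw [Asymptotics.isLittleO_one_iff]
      have : Tendsto (fun p : T × ℝ => ‖G p.2 - G s‖) (𝓝 (t, s)) (𝓝 ‖G s - G s‖) :=
        (((hGc.comp continuous_snd).sub continuous_const).norm).tendsto (t, s)
      rw [sub_self, norm_zero] at this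
      exact this.mono_left nhdsWithin_le_nhds
    have hO : (fun p : T × ℝ => p.1 - t) =O[𝓝[univ ×ˢ Icc a b] (t, s)]
        fun p => p - (t, s) :=
      Asymptotics.isBigO_of_le _ fun p => norm_fst_le (p - (t, s))
    refine (Asymptotics.IsBigO.of_bound 1 (Eventually.of_forall fun p => ?_)).trans_isLittleO
      (by simpa using ho.mul_isBigO hO.norm_norm)
    simpa using (G p.2 - G s).le_opNorm (p.1 - t)
  have h3 : HasFDerivWithinAt (fun p : T × ℝ => (Θ p.1 - Θ t - fderiv ℝ Θ t (p.1 - t))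
      (projIcc a b hab.le p.2)) (0 : T × ℝ →L[ℝ] V) ((univ : Set T) ×ˢ Icc a b) (t, s) := by
    refine .of_isLittleO ?_
    simp only [sub_self, map_zero, ContinuousMap.zero_apply, sub_zero, zero_apply]
    have ho := hd.isLittleO.comp_tendsto (continuous_fst.tendsto (t, s))
    have hO : (fun p : T × ℝ => p.1 - t) =O[𝓝 (t, s)] fun p => p - (t, s) :=
      Asymptotics.isBigO_of_le _ fun p => norm_fst_le (p - (t, s))
    refine ((Asymptotics.isBigO_of_le _ fun p => ?_).trans_isLittleO
      (ho.trans_isBigO hO)).mono nhdsWithin_le_nhds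
    exact ContinuousMap.norm_coe_le_norm _ _
  refine ((h2.add h1).add h3).congr_fderiv (by simp [hG]) |>.congr (fun p _ => ?_) ?_
  · simp only [hG, IccExtend, Function.comp_apply, Pi.add_apply, ContinuousMap.sub_apply,
      ContinuousLinearMap.comp_apply, ContinuousMap.evalCLM_apply]
    abel
  · simp [hG, IccExtend]

/-- A sequence of families `T → C([a, b], V)`, each the `s`-derivative of the previous one,
consists of functions that are smooth in `(t, s)`. -/
theorem contDiffOn_uncurry_of_seq [CompleteSpace V] [FiniteDimensional ℝ T] (hab : a < b) (k : ℕ) : ∀ {Θ : ℕ → T → C(Icc a b, V)},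
    (∀ j, ContDiff ℝ ∞ (Θ j)) →
    (∀ j t, ∀ s ∈ Icc a b, HasDerivWithinAt (IccExtend hab.le (Θ j t))
      (IccExtend hab.le (Θ (j + 1) t) s) (Icc a b) s) →
    ∀ j, ContDiffOn ℝ k (fun p : T × ℝ => IccExtend hab.le (Θ j p.1) p.2)
      ((univ : Set T) ×ˢ Icc a b) := by
  have hu : UniqueDiffOn ℝ ((univ : Set T) ×ˢ Icc a b) :=
    uniqueDiffOn_univ.prod (uniqueDiffOn_Icc hab)
  induction k with
  | zero =>
    intro Θ hΘ _ j
    refine contDiffOn_zero.2 (Continuous.continuousOn ?_)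
    have h1 : Continuous fun p : T × ℝ => (Θ j p.1, projIcc a b hab.le p.2) :=
      ((hΘ j).continuous.comp continuous_fst).prodMk (continuous_projIcc.comp continuous_snd)
    exact continuous_eval.comp h1
  | succ k ih =>
    intro Θ hΘ hd j
    have hF := fun p hp => hasFDerivWithinAt_uncurry hab (hΘ j) (hd j) p hp
    push_cast
    rw [contDiffOn_succ_iff_fderivWithin hu]
    refine ⟨fun p hp => (hF p hp).differentiableWithinAt, by simp, ?_⟩
    rw [contDiffOn_clm_apply]
    rintro ⟨v, r⟩
    have h1 := ih (Θ := fun j t => fderiv ℝ (Θ j) t v)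
      (fun j => ((hΘ j).fderiv_right (m := ∞) (by simp)).clm_apply contDiff_const)
      (fun j t => hasDerivWithinAt_fderiv hab (hΘ j) (hΘ (j + 1)) (hd j) v t) j
    have h2 := (ih hΘ hd (j + 1)).const_smul r
    refine (h1.add h2).congr fun p hp => ?_
    rw [(hF p hp).fderivWithin (hu p hp)]
    simp [IccExtend]

end Joint

/-! ### Smoothness of the propagator in the parameters and the variable -/

section Propagator

variable {𝔸 : Type*} [NormedRing 𝔸] [NormedAlgebra ℝ 𝔸] {a b : ℝ}

/-- The algebra of families of functions on `[a, b]` generated by smooth functions, the parameters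
and a given family. -/
inductive ParamAlgebra (hab : a ≤ b) (Ξ : (Fin 4 → ℝ) → C(Icc a b, 𝔸)) :
    ((Fin 4 → ℝ) → C(Icc a b, 𝔸)) → Prop
  | coeff (φ : C(Icc a b, 𝔸)) (h : ContDiffOn ℝ ∞ (IccExtend hab φ) (Icc a b)) :
      ParamAlgebra hab Ξ fun _ => φ
  | param (μ : Fin 4) : ParamAlgebra hab Ξ fun t => t μ • 1
  | gen : ParamAlgebra hab Ξ Ξ
  | add {Θ Θ'} : ParamAlgebra hab Ξ Θ → ParamAlgebra hab Ξ Θ' → ParamAlgebra hab Ξ fun t =>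
      Θ t + Θ' t
  | mul {Θ Θ'} : ParamAlgebra hab Ξ Θ → ParamAlgebra hab Ξ Θ' → ParamAlgebra hab Ξ fun t =>
      Θ t * Θ' t

theorem ParamAlgebra.const {hab : a ≤ b} {Ξ : (Fin 4 → ℝ) → C(Icc a b, 𝔸)} (c : 𝔸) :
    ParamAlgebra hab Ξ fun _ => ContinuousMap.const _ c :=
  .coeff _ contDiffOn_const

theorem ParamAlgebra.sum {hab : a ≤ b} {Ξ : (Fin 4 → ℝ) → C(Icc a b, 𝔸)} {ι : Type*}
    (u : Finset ι) {Θ : ι → (Fin 4 → ℝ) → C(Icc a b, 𝔸)} (h : ∀ i, ParamAlgebra hab Ξ (Θ i)) :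
    ParamAlgebra hab Ξ fun t => ∑ i ∈ u, Θ i t := by
  classical
  induction u using Finset.induction_on with
  | empty => simpa using ParamAlgebra.const (hab := hab) (Ξ := Ξ) 0
  | insert i u hi ih =>
    simp only [Finset.sum_insert hi]
    exact (h i).add ih

theorem ParamAlgebra.contDiff {hab : a ≤ b} {Ξ Θ : (Fin 4 → ℝ) → C(Icc a b, 𝔸)}
    (hΞ : ContDiff ℝ ∞ Ξ) (h : ParamAlgebra hab Ξ Θ) : ContDiff ℝ ∞ Θ := by
  induction h with
  | coeff φ h => exact contDiff_const
  | param μ => exact (contDiff_apply ℝ ℝ μ).smul contDiff_const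
  | gen => exact hΞ
  | add _ _ h h' => exact h.add h'
  | mul _ _ h h' => exact h.mul h'

/-- Stability of the algebra under `d/ds` follows from the product rule once the generator has its
derivative in the algebra. It supplies the infinite sequence of derivatives that
`contDiffOn_uncurry_of_seq` asks for. -/
theorem ParamAlgebra.exists_deriv (hab : a < b) {Ξ Θ : (Fin 4 → ℝ) → C(Icc a b, 𝔸)}
    (hΞ : ∃ Ξ', ParamAlgebra hab.le Ξ Ξ' ∧ ∀ t, ∀ s ∈ Icc a b,
      HasDerivWithinAt (IccExtend hab.le (Ξ t)) (IccExtend hab.le (Ξ' t) s) (Icc a b) s)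
    (h : ParamAlgebra hab.le Ξ Θ) :
    ∃ Θ', ParamAlgebra hab.le Ξ Θ' ∧ ∀ t, ∀ s ∈ Icc a b,
      HasDerivWithinAt (IccExtend hab.le (Θ t)) (IccExtend hab.le (Θ' t) s) (Icc a b) s := by
  have hu := uniqueDiffOn_Icc hab
  induction h with
  | coeff φ h =>
    have hd : ContDiffOn ℝ ∞ (derivWithin (IccExtend hab.le φ) (Icc a b)) (Icc a b) :=
      h.derivWithin hu (by simp)
    let φ' : C(Icc a b, 𝔸) := ⟨fun s => derivWithin (IccExtend hab.le φ) (Icc a b) s,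
      hd.continuousOn.comp_continuous continuous_subtype_val fun s => s.2⟩
    have e : ∀ s ∈ Icc a b, IccExtend hab.le φ' s = derivWithin (IccExtend hab.le φ) (Icc a b) s :=
      fun s hs => by rw [IccExtend_of_mem _ _ hs]; rfl
    refine ⟨fun _ => φ', .coeff φ' (hd.congr e), fun t s hs => ?_⟩
    rw [e s hs]
    exact (h.differentiableOn (by simp) s hs).hasDerivWithinAt
  | param μ =>
    refine ⟨fun _ => ContinuousMap.const _ 0, .const 0, fun t s hs => ?_⟩
    exact hasDerivWithinAt_const s _ (t μ • (1 : 𝔸))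
  | gen => exact hΞ
  | add _ _ h h' =>
    obtain ⟨Θ, hΘ, hd⟩ := h
    obtain ⟨Θ', hΘ', hd'⟩ := h'
    exact ⟨_, hΘ.add hΘ', fun t s hs => (hd t s hs).add (hd' t s hs)⟩
  | mul h₁ h₂ h h' =>
    obtain ⟨Θ, hΘ, hd⟩ := h
    obtain ⟨Θ', hΘ', hd'⟩ := h'
    exact ⟨_, (hΘ.mul h₂).add (h₁.mul hΘ'), fun t s hs => (hd t s hs).mul (hd' t s hs)⟩

variable [CompleteSpace 𝔸]

/-- The propagator satisfies `Ξ' = (A' + ∑ t_μ B_μ) Ξ`, and the right side is an element of the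
algebra. The integral equation does not see the value of the coefficient at `b`, so `A₀` may be
replaced by its smooth representative `A'`. -/
theorem solve_one_deriv (hab : a < b) {A₀ A' : ℝ → 𝔸} (hA : IsBoundedMeasurable A₀)
    (B : Fin 4 → 𝔸) (hA' : ContDiffOn ℝ ∞ A' (Icc a b)) (hE : EqOn A₀ A' (Ico a b)) :
    ∃ Ξ', ParamAlgebra hab.le (fun t => solve hab.le hA B t 1) Ξ' ∧ ∀ t, ∀ s ∈ Icc a b,
      HasDerivWithinAt (IccExtend hab.le (solve hab.le hA B t 1)) (IccExtend hab.le (Ξ' t) s)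
        (Icc a b) s := by
  let φ : C(Icc a b, 𝔸) := ⟨fun s => A' s,
    hA'.continuousOn.comp_continuous continuous_subtype_val fun s => s.2⟩
  have e : ∀ s ∈ Icc a b, IccExtend hab.le φ s = A' s := fun s hs => by
    rw [IccExtend_of_mem _ _ hs]; rfl
  refine ⟨_, ((ParamAlgebra.coeff φ (hA'.congr e)).add (.sum Finset.univ fun μ =>
    (ParamAlgebra.param μ).mul (.const (B μ)))).mul .gen, fun t => ?_⟩
  rw [hasDerivWithinAt_Icc_iff_integral hab]
  intro s hs
  have ha : a ∈ Icc a b := ⟨le_rfl, hab.le⟩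
  rw [IccExtend_of_mem _ _ hs, IccExtend_of_mem _ _ ha, solve_apply, solve_apply]
  simp only [intervalIntegral.integral_same, add_zero]
  congr 1
  rw [intervalIntegral.integral_of_le hs.1, intervalIntegral.integral_of_le hs.1,
    integral_Ioc_eq_integral_Ioo, integral_Ioc_eq_integral_Ioo]
  refine setIntegral_congr_fun measurableSet_Ioo fun z hz => ?_
  have hz' : z ∈ Ico a b := ⟨hz.1.le, hz.2.trans_le hs.2⟩
  rw [hE hz', ← e z (Ico_subset_Icc_self hz')]
  simp [IccExtend]

/-- The propagator of a linear equation with smooth coefficients that depend affinely on the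
parameters is smooth in the parameters and the variable. -/
theorem contDiffOn_solve_one (hab : a < b) {A₀ A' : ℝ → 𝔸} (hA : IsBoundedMeasurable A₀)
    (B : Fin 4 → 𝔸) (hA' : ContDiffOn ℝ ∞ A' (Icc a b)) (hE : EqOn A₀ A' (Ico a b)) :
    ContDiffOn ℝ ∞ (fun p : (Fin 4 → ℝ) × ℝ =>
      IccExtend hab.le (solve hab.le hA B p.1 1) p.2) (univ ×ˢ Icc a b) := by
  have hgen := solve_one_deriv hab hA B hA' hE
  set Ξ : (Fin 4 → ℝ) → C(Icc a b, 𝔸) := fun t => solve hab.le hA B t 1 with hΞ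
  have hΞc : ContDiff ℝ ∞ Ξ := (contDiff_solve hab.le hA B).clm_apply contDiff_const
  -- Iterated choice of the derivative inside the algebra, starting from the propagator.
  let next : {Θ // ParamAlgebra hab.le Ξ Θ} → {Θ // ParamAlgebra hab.le Ξ Θ} := fun Θ =>
    ⟨(Θ.2.exists_deriv hab hgen).choose, (Θ.2.exists_deriv hab hgen).choose_spec.1⟩
  let seq : ℕ → {Θ // ParamAlgebra hab.le Ξ Θ} := fun j => next^[j] ⟨Ξ, .gen⟩
  rw [contDiffOn_infty]
  intro k
  refine contDiffOn_uncurry_of_seq hab k (Θ := fun j => (seq j).1)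
    (fun j => (seq j).2.contDiff hΞc) (fun j t s hs => ?_) 0
  have h := ((seq j).2.exists_deriv hab hgen).choose_spec.2 t s hs
  have e : seq (j + 1) = next (seq j) := Function.iterate_succ_apply' _ _ _
  rw [e]
  exact h

end Propagator

theorem isUnit_of_injective {X : Type*} [NormedAddCommGroup X] [NormedSpace ℂ X]
    [FiniteDimensional ℂ X] {A : X →L[ℂ] X} (h : ∀ x, A x = 0 → x = 0) : IsUnit A := by
  have h1 : LinearMap.ker A.toLinearMap = ⊥ := by
    rw [LinearMap.ker_eq_bot']
    exact h
  have h2 := (LinearMap.isUnit_iff_ker_eq_bot _).2 h1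
  obtain ⟨u, hu⟩ := h2
  refine ⟨⟨A, LinearMap.toContinuousLinearMap (u⁻¹).val, ?_, ?_⟩, rfl⟩
  · ext x
    have := congrArg (fun L => L x) u.mul_inv
    rw [hu] at this
    simpa using this
  · ext x
    have := congrArg (fun L => L x) u.inv_mul
    rw [hu] at this
    simpa using this

/-! ### Continuous functions on a fundamental interval and their periodic extensions -/

theorem lt_add_two_pi (y : ℝ) : y < y + 2 * Real.pi := lt_add_of_pos_right y Real.two_pi_pos

section PeriodInterval

variable {V : Type*} [NormedAddCommGroup V]

/-- The periodic extension of a function on the fundamental interval `[y, y + 2π]`. -/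
def extend (y : ℝ) (φ : C(Icc y (y + 2 * Real.pi), V)) : ℝ → V :=
  periodize y (IccExtend (lt_add_two_pi y).le φ)

theorem extend_periodic (y : ℝ) (φ : C(Icc y (y + 2 * Real.pi), V)) :
    Function.Periodic (extend y φ) (2 * Real.pi) := periodize_periodic _ _

theorem left_mem (y : ℝ) : y ∈ Icc y (y + 2 * Real.pi) := ⟨le_rfl, (lt_add_two_pi y).le⟩

theorem right_mem (y : ℝ) : y + 2 * Real.pi ∈ Icc y (y + 2 * Real.pi) :=
  ⟨(lt_add_two_pi y).le, le_rfl⟩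

theorem extend_of_mem {y s : ℝ} (φ : C(Icc y (y + 2 * Real.pi), V))
    (hs : s ∈ Ico y (y + 2 * Real.pi)) : extend y φ s = φ ⟨s, Ico_subset_Icc_self hs⟩ := by
  rw [extend, periodize_of_mem _ hs, IccExtend_of_mem _ _ (Ico_subset_Icc_self hs)]

theorem extend_self (y : ℝ) (φ : C(Icc y (y + 2 * Real.pi), V)) :
    extend y φ y = φ ⟨y, left_mem y⟩ :=
  extend_of_mem φ ⟨le_rfl, lt_add_two_pi y⟩

/-- The point of `[y, y + 2π)` over the same point of the circle as `s`. -/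
def circleRep (y s : ℝ) : Icc y (y + 2 * Real.pi) :=
  ⟨toIcoMod Real.two_pi_pos y s, Ico_subset_Icc_self (toIcoMod_mem_Ico _ _ _)⟩

theorem extend_eq (y : ℝ) (φ : C(Icc y (y + 2 * Real.pi), V)) (s : ℝ) :
    extend y φ s = φ (circleRep y s) := by
  exact IccExtend_of_mem _ _ (circleRep y s).2

theorem extend_tendsto_left (y : ℝ) (φ : C(Icc y (y + 2 * Real.pi), V)) (s : ℝ) :
    Tendsto (extend y φ) (𝓝[<] s)
      (𝓝 (IccExtend (lt_add_two_pi y).le φ (toIocMod Real.two_pi_pos y s))) :=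
  periodize_tendsto_left (φ.continuous.Icc_extend').continuousOn s

/-- Only the left limit is at issue. Away from translates of `y` it is the value of the function,
and at such a translate it is the value of `φ` at the right end of the interval. -/
theorem extend_continuousAt [NormedSpace ℝ V] {y : ℝ} (φ : C(Icc y (y + 2 * Real.pi), V)) {s : ℝ}
    (hr : ContinuousWithinAt (extend y φ) (Ici s) s)
    (h : ¬ (∃ l : ℤ, s = y + 2 * Real.pi * l) ∨
      φ ⟨y, left_mem y⟩ = φ ⟨y + 2 * Real.pi, right_mem y⟩) :
    ContinuousAt (extend y φ) s := by
  rw [← continuousWithinAt_univ, ← Iio_union_Ici (a := s), continuousWithinAt_union]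
  refine ⟨?_, hr⟩
  have h1 := extend_tendsto_left y φ s
  suffices hh : IccExtend (lt_add_two_pi y).le φ (toIocMod Real.two_pi_pos y s) = extend y φ s by
    rw [hh] at h1
    exact h1
  by_cases hs : ∃ l : ℤ, s = y + 2 * Real.pi * l
  · have h2 := h.resolve_left (not_not.2 hs)
    obtain ⟨l, rfl⟩ := hs
    have e1 : y + 2 * Real.pi * l = y + l • (2 * Real.pi) := by rw [zsmul_eq_mul, mul_comm]
    rw [extend, periodize, e1, toIocMod_add_zsmul, toIcoMod_add_zsmul, toIocMod_apply_left,
      toIcoMod_apply_left, IccExtend_of_mem _ _ (left_mem y), IccExtend_of_mem _ _ (right_mem y), h2]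
  · rw [toIocMod_eq_toIcoMod hs]
    rfl

end PeriodInterval

/-! ### Periodic extensions of solutions of integral equations -/

section PeriodicSolution

variable {𝔸 : Type*} [NormedRing 𝔸] [NormedAlgebra ℝ 𝔸] {P : Set ℝ} {y : ℝ}
  {A h : ℝ → 𝔸} {φ : C(Icc y (y + 2 * Real.pi), 𝔸)}

theorem IsPiecewiseSmooth.isBoundedMeasurable (hP : IsSparse P) (hA : IsPiecewiseSmooth P A) :
    IsBoundedMeasurable A :=
  ⟨hA.aestronglyMeasurable hP, hA.exists_bound hP⟩

variable [CompleteSpace 𝔸]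

/-- The integral is differentiated from the right, where the coefficients are continuous even at
break points; so the equation holds at every point and not just almost everywhere. -/
theorem IccExtend_hasDerivWithinAt (hP : IsSparse P) (hA : IsPiecewiseSmooth P A)
    (hh : IsPiecewiseSmooth P h)
    (hφ : ∀ s : Icc y (y + 2 * Real.pi), φ s = φ ⟨y, left_mem y⟩
      + ∫ z in y..s, (A z * IccExtend (lt_add_two_pi y).le φ z + h z))
    {s : ℝ} (hs : s ∈ Ico y (y + 2 * Real.pi)) :
    HasDerivWithinAt (IccExtend (lt_add_two_pi y).le φ)
      (A s * IccExtend (lt_add_two_pi y).le φ s + h s) (Ici s) s := by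
  set ψ := IccExtend (lt_add_two_pi y).le φ with hψ
  have hψc : Continuous ψ := φ.continuous.Icc_extend'
  have hint : ∀ c d, IntervalIntegrable (fun z => A z * ψ z + h z) volume c d := fun c d =>
    ((hA.isBoundedMeasurable hP).intervalIntegrable_mul _ φ c d).add
      (hh.intervalIntegrable hP c d)
  have hmeas : AEStronglyMeasurable (fun z => A z * ψ z + h z) volume :=
    ((hA.aestronglyMeasurable hP).mul hψc.aestronglyMeasurable).add (hh.aestronglyMeasurable hP)
  have h1 : HasDerivWithinAt (fun u => ∫ z in y..u, (A z * ψ z + h z)) (A s * ψ s + h s)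
      (Ici s) s := by
    refine intervalIntegral.integral_hasDerivWithinAt_right (hint _ _)
      ⟨univ, univ_mem, hmeas.restrict⟩ ?_
    exact ((((hA.continuousWithinAt hP s).mul hψc.continuousWithinAt)).add
      (hh.continuousWithinAt hP s)).mono Ioi_subset_Ici_self
  have e : ∀ x ∈ Ico s (y + 2 * Real.pi), ψ x = φ ⟨y, left_mem y⟩ + ∫ z in y..x, (A z * ψ z + h z) := by
    intro x hx
    have hx' : x ∈ Icc y (y + 2 * Real.pi) := ⟨hs.1.trans hx.1, hx.2.le⟩
    rw [hψ, IccExtend_of_mem _ _ hx']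
    exact hφ ⟨x, hx'⟩
  refine (h1.const_add (φ ⟨y, left_mem y⟩)).congr_of_eventuallyEq ?_ (e s ⟨le_rfl, hs.2⟩)
  filter_upwards [Ico_mem_nhdsGE hs.2] with x hx using e x hx

theorem extend_hasDerivWithinAt (hP : IsSparse P) (hA : IsPiecewiseSmooth P A)
    (hh : IsPiecewiseSmooth P h)
    (hφ : ∀ s : Icc y (y + 2 * Real.pi), φ s = φ ⟨y, left_mem y⟩
      + ∫ z in y..s, (A z * IccExtend (lt_add_two_pi y).le φ z + h z)) (s : ℝ) :
    HasDerivWithinAt (extend y φ) (A s * extend y φ s + h s) (Ici s) s := by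
  have h1 := periodize_hasDerivWithinAt (y := y) (φ := IccExtend (lt_add_two_pi y).le φ)
    (φ' := fun s => A s * IccExtend (lt_add_two_pi y).le φ s + h s)
    (fun s hs => IccExtend_hasDerivWithinAt hP hA hh hφ hs) s
  have hmod : ∀ {f : ℝ → 𝔸}, Function.Periodic f (2 * Real.pi) →
      f (toIcoMod Real.two_pi_pos y s) = f s := fun hf => by
    rw [toIcoMod]; exact hf.sub_zsmul_eq _
  simp only [periodize] at h1
  rw [hmod hA.1, hmod hh.1] at h1
  exact h1

theorem extend_isPiecewiseSmooth (hP : IsSparse P) (hA : IsPiecewiseSmooth P A)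
    (hh : IsPiecewiseSmooth P h)
    (hφ : ∀ s : Icc y (y + 2 * Real.pi), φ s = φ ⟨y, left_mem y⟩
      + ∫ z in y..s, (A z * IccExtend (lt_add_two_pi y).le φ z + h z))
    (hy : {x : ℝ | ∃ l : ℤ, x = y + 2 * Real.pi * l} ⊆ P ∨
      φ ⟨y, left_mem y⟩ = φ ⟨y + 2 * Real.pi, right_mem y⟩) :
    IsPiecewiseSmooth P (extend y φ) := by
  have hd := extend_hasDerivWithinAt hP hA hh hφ
  refine isPiecewiseSmooth_of_hasDerivWithinAt (A := fun s => ContinuousLinearMap.mul ℝ 𝔸 (A s))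
    (hA.comp (F := ContinuousLinearMap.mul ℝ 𝔸) (ContinuousLinearMap.contDiff _)) hh
    (extend_periodic _ _) (fun s hs => ?_) (fun s => ⟨_, extend_tendsto_left y φ s⟩) hd
  exact extend_continuousAt φ (hd s).continuousWithinAt (hy.imp_left fun h hs' => hs (h hs'))

theorem extend_continuous (hP : IsSparse P) (hA : IsPiecewiseSmooth P A)
    (hh : IsPiecewiseSmooth P h)
    (hφ : ∀ s : Icc y (y + 2 * Real.pi), φ s = φ ⟨y, left_mem y⟩
      + ∫ z in y..s, (A z * IccExtend (lt_add_two_pi y).le φ z + h z))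
    (hy : φ ⟨y, left_mem y⟩ = φ ⟨y + 2 * Real.pi, right_mem y⟩) : Continuous (extend y φ) :=
  continuous_iff_continuousAt.2 fun s => extend_continuousAt φ
    (extend_hasDerivWithinAt hP hA hh hφ s).continuousWithinAt (.inr hy)

end PeriodicSolution

/-! ### Propagator, monodromy and periodic solutions -/

section PeriodicSolve

variable {𝔸 : Type*} [NormedRing 𝔸] [NormedAlgebra ℝ 𝔸] {y : ℝ}
  {A₀ : ℝ → 𝔸}

/-- The propagator over one period, starting at `y`. -/
def propagator (y : ℝ) (hA : IsBoundedMeasurable A₀) (B : Fin 4 → 𝔸) (t : Fin 4 → ℝ) :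
    C(Icc y (y + 2 * Real.pi), 𝔸) :=
  solve (lt_add_two_pi y).le hA B t 1

/-- The monodromy of the propagator. -/
def monodromy (y : ℝ) (hA : IsBoundedMeasurable A₀) (B : Fin 4 → 𝔸) (t : Fin 4 → ℝ) : 𝔸 :=
  propagator y hA B t ⟨y + 2 * Real.pi, right_mem y⟩

/-- The periodic solution of an inhomogeneous linear equation. -/
def periodicSolve (y : ℝ) (hA : IsBoundedMeasurable A₀) (B : Fin 4 → 𝔸) (t : Fin 4 → ℝ)
    (r : C(Icc y (y + 2 * Real.pi), 𝔸)) : C(Icc y (y + 2 * Real.pi), 𝔸) :=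
  let ρ := solve (lt_add_two_pi y).le hA B t
    (volterra (lt_add_two_pi y).le _ (isBoundedMeasurable_const (1 : 𝔸)) r)
  propagator y hA B t * ContinuousMap.const _
    (Ring.inverse (1 - monodromy y hA B t) * ρ ⟨y + 2 * Real.pi, right_mem y⟩) + ρ

theorem contDiffOn_const_fun {T : Type*} [NormedAddCommGroup T] [NormedSpace ℝ T]
    {U : Set T} {a b : ℝ} {f : T → 𝔸} (hf : ContDiffOn ℝ ∞ f U) :
    ContDiffOn ℝ ∞ (fun t => ContinuousMap.const (Icc a b) (f t)) U := by
  let L : 𝔸 →L[ℝ] C(Icc a b, 𝔸) := LinearMap.mkContinuous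
    { toFun := ContinuousMap.const (Icc a b)
      map_add' := fun _ _ => rfl
      map_smul' := fun _ _ => rfl } 1 fun x => by
        rw [one_mul, ContinuousMap.norm_le _ (norm_nonneg _)]
        exact fun _ => le_rfl
  exact L.contDiff.comp_contDiffOn hf

variable [CompleteSpace 𝔸]

theorem contDiff_propagator (hA : IsBoundedMeasurable A₀) (B : Fin 4 → 𝔸) :
    ContDiff ℝ ∞ (propagator y hA B) :=
  (contDiff_solve _ hA B).clm_apply contDiff_const

theorem contDiff_eval {T V : Type*} [NormedAddCommGroup T] [NormedSpace ℝ T]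
    [NormedAddCommGroup V] [NormedSpace ℝ V] {U : Set T} {a b : ℝ} {f : T → C(Icc a b, V)}
    (hf : ContDiffOn ℝ ∞ f U) (s : Icc a b) : ContDiffOn ℝ ∞ (fun t => f t s) U :=
  (ContinuousMap.evalCLM ℝ s : C(Icc a b, V) →L[ℝ] V).contDiff.comp_contDiffOn hf

theorem contDiffOn_ringInverse {T : Type*} [NormedAddCommGroup T] [NormedSpace ℝ T]
    {U : Set T} {f : T → 𝔸} (hf : ContDiffOn ℝ ∞ f U) (hu : ∀ t ∈ U, IsUnit (f t)) :
    ContDiffOn ℝ ∞ (fun t => Ring.inverse (f t)) U := by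
  intro t ht
  obtain ⟨u, hu⟩ := hu t ht
  have h := contDiffAt_ringInverse (n := ∞) ℝ u
  rw [hu] at h
  exact h.comp_contDiffWithinAt t (hf t ht)

theorem contDiffOn_periodicSolve (hA : IsBoundedMeasurable A₀) (B : Fin 4 → 𝔸)
    {U : Set (Fin 4 → ℝ)} (hu : ∀ t ∈ U, IsUnit (1 - monodromy y hA B t))
    {r : (Fin 4 → ℝ) → C(Icc y (y + 2 * Real.pi), 𝔸)} (hr : ContDiffOn ℝ ∞ r U) :
    ContDiffOn ℝ ∞ (fun t => periodicSolve y hA B t (r t)) U := by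
  have h1 : ContDiffOn ℝ ∞ (fun t => solve (lt_add_two_pi y).le hA B t
      (volterra (lt_add_two_pi y).le _ (isBoundedMeasurable_const (1 : 𝔸)) (r t))) U :=
    (contDiff_solve _ hA B).contDiffOn.clm_apply
      ((ContinuousLinearMap.contDiff _).comp_contDiffOn hr)
  have h2 : ContDiffOn ℝ ∞ (propagator y hA B) U := (contDiff_propagator hA B).contDiffOn
  have h3 : ContDiffOn ℝ ∞ (fun t => Ring.inverse (1 - monodromy y hA B t)) U :=
    contDiffOn_ringInverse (contDiffOn_const.sub (contDiff_eval h2 _)) hu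
  exact (h2.mul (contDiffOn_const_fun (h3.mul (contDiff_eval h1 _)))).add h1

/-- The coefficients multiply from the left, so right multiplication by a constant passes through
the integral equation. -/
theorem solve_one_mul_const_apply {a b : ℝ} (hab : a ≤ b) (hA : IsBoundedMeasurable A₀)
    (B : Fin 4 → 𝔸) (t : Fin 4 → ℝ) (c : 𝔸) (s : Icc a b) :
    (solve hab hA B t 1 * ContinuousMap.const (Icc a b) c) s = c + ∫ z in a..s,
      (A₀ z + ∑ μ, t μ • B μ) *
        IccExtend hab (solve hab hA B t 1 * ContinuousMap.const (Icc a b) c) z := by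
  have e : ∀ z, (A₀ z + ∑ μ, t μ • B μ) *
        IccExtend hab (solve hab hA B t 1 * ContinuousMap.const (Icc a b) c) z
      = ((A₀ z + ∑ μ, t μ • B μ) * IccExtend hab (solve hab hA B t 1) z) * c :=
    fun z => by simp [IccExtend, mul_assoc]
  simp only [e]
  rw [ContinuousMap.mul_apply]
  conv_lhs => rw [solve_apply]
  rw [add_mul]
  congr 1
  · simp
  · have := (ContinuousLinearMap.mul ℝ 𝔸).flip c |>.intervalIntegral_comp_comm
      ((isBoundedMeasurable_param hA B t).intervalIntegrable_mul hab (solve hab hA B t 1) a s)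
    simp only [ContinuousLinearMap.flip_apply, ContinuousLinearMap.mul_apply'] at this
    exact this.symm

theorem propagator_mul_const_apply (hA : IsBoundedMeasurable A₀) (B : Fin 4 → 𝔸)
    (t : Fin 4 → ℝ) (c : 𝔸) (s : Icc y (y + 2 * Real.pi)) :
    (propagator y hA B t * ContinuousMap.const (Icc y (y + 2 * Real.pi)) c) s = c + ∫ z in y..s,
      (A₀ z + ∑ μ, t μ • B μ) * IccExtend (lt_add_two_pi y).le
        (propagator y hA B t * ContinuousMap.const (Icc y (y + 2 * Real.pi)) c) z :=
  solve_one_mul_const_apply _ hA B t c s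

/-- A solution of a linear equation is determined by its initial value. -/
theorem eq_solve_one_mul {a b : ℝ} (hab : a < b) (hA : IsBoundedMeasurable A₀)
    (B : Fin 4 → 𝔸) (t : Fin 4 → ℝ) {g : ℝ → 𝔸} (hg : ContinuousOn g (Icc a b))
    (hd : ∀ s ∈ Ioo a b, HasDerivWithinAt g ((A₀ s + ∑ μ, t μ • B μ) * g s) (Ioi s) s)
    {s : ℝ} (hs : s ∈ Icc a b) : g s = IccExtend hab.le (solve hab.le hA B t 1) s * g a := by
  set ψ : C(Icc a b, 𝔸) := ⟨fun s => g s, hg.domRestrict⟩ with hψ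
  have hE : ∀ z (hz : z ∈ Icc a b), IccExtend hab.le ψ z = g z := fun z hz =>
    IccExtend_of_mem _ _ hz
  have hi := (isBoundedMeasurable_param hA B t).intervalIntegrable_mul hab.le ψ
  have h1 : ψ = solve hab.le hA B t (ContinuousMap.const (Icc a b) (g a)) := by
    refine eq_solve hab.le hA B t fun s => ?_
    have h2 := intervalIntegral.integral_eq_sub_of_hasDeriv_right_of_le s.2.1
      (hg.mono (Icc_subset_Icc_right s.2.2))
      (f' := fun z => (A₀ z + ∑ μ, t μ • B μ) * IccExtend hab.le ψ z) (fun z hz => by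
        have hz' : z ∈ Ioo a b := ⟨hz.1, hz.2.trans_le s.2.2⟩
        rw [hE z (Ioo_subset_Icc_self hz')]
        exact hd z hz') (hi a s)
    rw [h2]
    exact (add_sub_cancel (g a) (g s)).symm
  have h3 : solve hab.le hA B t 1 * ContinuousMap.const (Icc a b) (g a)
      = solve hab.le hA B t (ContinuousMap.const (Icc a b) (g a)) :=
    eq_solve hab.le hA B t fun s => solve_one_mul_const_apply hab.le hA B t (g a) s
  rw [← hE s hs, h1, ← h3]
  rfl

theorem propagator_left (hA : IsBoundedMeasurable A₀) (B : Fin 4 → 𝔸) (t : Fin 4 → ℝ) :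
    propagator y hA B t ⟨y, left_mem y⟩ = 1 := by
  rw [propagator, solve_apply]
  simp

/-- A solution with initial value `c` ends at `monodromy * c + ρ(y + 2π)`, where `ρ` is the solution
that starts at zero. The constant in `periodicSolve` is the solution of the fixed point equation for
`c`. -/
theorem periodicSolve_left_eq_right (hA : IsBoundedMeasurable A₀) (B : Fin 4 → 𝔸)
    {t : Fin 4 → ℝ} (hu : IsUnit (1 - monodromy y hA B t))
    (r : C(Icc y (y + 2 * Real.pi), 𝔸)) :
    periodicSolve y hA B t r ⟨y, left_mem y⟩
      = periodicSolve y hA B t r ⟨y + 2 * Real.pi, right_mem y⟩ := by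
  simp only [periodicSolve, ContinuousMap.add_apply, ContinuousMap.mul_apply,
    ContinuousMap.const_apply, propagator_left, one_mul]
  set ρ := solve (lt_add_two_pi y).le hA B t
    (volterra (lt_add_two_pi y).le _ (isBoundedMeasurable_const (1 : 𝔸)) r) with hρ
  have h0 : ρ ⟨y, left_mem y⟩ = 0 := by
    rw [hρ, solve_apply, volterra_apply]
    simp
  have h1 := Ring.mul_inverse_cancel _ hu
  rw [h0, add_zero]
  change _ = monodromy y hA B t * _ + _
  set ρe := ρ ⟨y + 2 * Real.pi, right_mem y⟩
  have h2 : (1 - monodromy y hA B t) * (Ring.inverse (1 - monodromy y hA B t) * ρe) = ρe := by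
    rw [← mul_assoc, h1, one_mul]
  rw [sub_mul, one_mul] at h2
  exact sub_eq_iff_eq_add'.1 h2

theorem periodicSolve_apply (hA : IsBoundedMeasurable A₀) (B : Fin 4 → 𝔸)
    (t : Fin 4 → ℝ) (r : C(Icc y (y + 2 * Real.pi), 𝔸)) (s : Icc y (y + 2 * Real.pi)) :
    periodicSolve y hA B t r s = periodicSolve y hA B t r ⟨y, left_mem y⟩ + ∫ z in y..s,
      ((A₀ z + ∑ μ, t μ • B μ) * IccExtend (lt_add_two_pi y).le (periodicSolve y hA B t r) z
        + IccExtend (lt_add_two_pi y).le r z) := by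
  set ρ := solve (lt_add_two_pi y).le hA B t
    (volterra (lt_add_two_pi y).le _ (isBoundedMeasurable_const (1 : 𝔸)) r) with hρ
  set c := Ring.inverse (1 - monodromy y hA B t) * ρ ⟨y + 2 * Real.pi, right_mem y⟩ with hc
  have hdef : periodicSolve y hA B t r = propagator y hA B t * ContinuousMap.const (Icc y (y + 2 * Real.pi)) c + ρ := rfl
  have hAt := isBoundedMeasurable_param hA B t
  have hρs : ρ s = (∫ z in y..s, IccExtend (lt_add_two_pi y).le r z) + ∫ z in y..s,
      (A₀ z + ∑ μ, t μ • B μ) * IccExtend (lt_add_two_pi y).le ρ z := by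
    conv_lhs => rw [hρ, solve_apply, volterra_apply, ← hρ]
    simp
  have h0 : ρ ⟨y, left_mem y⟩ = 0 := by
    rw [hρ, solve_apply, volterra_apply]
    simp
  have e : ∀ z, (A₀ z + ∑ μ, t μ • B μ) *
        IccExtend (lt_add_two_pi y).le (periodicSolve y hA B t r) z
      = (A₀ z + ∑ μ, t μ • B μ) * IccExtend (lt_add_two_pi y).le
          (propagator y hA B t * ContinuousMap.const (Icc y (y + 2 * Real.pi)) c) z
        + (A₀ z + ∑ μ, t μ • B μ) * IccExtend (lt_add_two_pi y).le ρ z := fun z => by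
    rw [hdef]; simp [IccExtend, mul_add]
  simp only [e]
  have i1 := hAt.intervalIntegrable_mul (lt_add_two_pi y).le
    (propagator y hA B t * ContinuousMap.const (Icc y (y + 2 * Real.pi)) c) y s
  have i2 := hAt.intervalIntegrable_mul (lt_add_two_pi y).le ρ y s
  have i3 : IntervalIntegrable (IccExtend (lt_add_two_pi y).le r) volume y s :=
    (r.continuous.Icc_extend').intervalIntegrable _ _
  rw [intervalIntegral.integral_add (i1.add i2) i3, intervalIntegral.integral_add i1 i2, hdef,
    ContinuousMap.add_apply, ContinuousMap.add_apply, propagator_mul_const_apply, hρs, h0,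
    ContinuousMap.mul_apply, propagator_left]
  simp only [ContinuousMap.const_apply, one_mul, add_zero]
  abel

end PeriodicSolve

/-! ### Hermitian adjoints of linear maps -/

section Adjoint

variable {V₁ V₂ V₃ : Type*} [NormedAddCommGroup V₁] [InnerProductSpace ℂ V₁]
  [FiniteDimensional ℂ V₁] [NormedAddCommGroup V₂] [InnerProductSpace ℂ V₂]
  [FiniteDimensional ℂ V₂] [NormedAddCommGroup V₃] [InnerProductSpace ℂ V₃]
  [FiniteDimensional ℂ V₃]

theorem adj_inner_left (A : V₁ →L[ℂ] V₂) (x : V₁) (y : V₂) :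
    inner ℂ (adj A y) x = inner ℂ y (A x) := by
  rw [← inner_conj_symm, adj_inner_right, inner_conj_symm]

theorem eq_adj {A : V₁ →L[ℂ] V₂} {B : V₂ →L[ℂ] V₁}
    (h : ∀ x y, inner ℂ (B y) x = inner ℂ y (A x)) : B = adj A := by
  ext y
  exact ext_inner_right ℂ fun x => by rw [h, adj_inner_left]

theorem adj_adj (A : V₁ →L[ℂ] V₂) : adj (adj A) = A :=
  (eq_adj fun x y => (adj_inner_right A y x).symm).symm

theorem adj_add (A B : V₁ →L[ℂ] V₂) : adj (A + B) = adj A + adj B :=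
  (eq_adj fun x y => by simp [adj_inner_left]).symm

theorem adj_smul (c : ℂ) (A : V₁ →L[ℂ] V₂) : adj (c • A) = star c • adj A :=
  (eq_adj fun x y => by simp [adj_inner_left, mul_comm]).symm

theorem adj_comp (A : V₂ →L[ℂ] V₃) (B : V₁ →L[ℂ] V₂) : adj (A ∘L B) = adj B ∘L adj A :=
  (eq_adj fun x y => by simp [adj_inner_left]).symm

theorem adj_mul (A B : V₁ →L[ℂ] V₁) : adj (A * B) = adj B * adj A := adj_comp A B

theorem adj_one : adj (1 : V₁ →L[ℂ] V₁) = 1 := (eq_adj fun x y => by simp).symm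

theorem adj_mapL {S E : Type*} [NormedAddCommGroup S] [InnerProductSpace ℂ S]
    [FiniteDimensional ℂ S] [NormedAddCommGroup E] [InnerProductSpace ℂ E]
    [FiniteDimensional ℂ E] (A : S →L[ℂ] S) (B : E →L[ℂ] E) :
    adj (TensorProduct.mapL A B) = TensorProduct.mapL (adj A) (adj B) := by
  have : CompleteSpace S := FiniteDimensional.complete ℂ S
  have : CompleteSpace E := FiniteDimensional.complete ℂ E
  have : CompleteSpace (S ⊗[ℂ] E) := FiniteDimensional.complete ℂ _
  exact TensorProduct.adjoint_mapL A B

end Adjoint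

instance instCompleteSpaceTensor {S E : Type*} [NormedAddCommGroup S] [InnerProductSpace ℂ S]
    [FiniteDimensional ℂ S] [NormedAddCommGroup E] [InnerProductSpace ℂ E]
    [FiniteDimensional ℂ E] : CompleteSpace (S ⊗[ℂ] E) := FiniteDimensional.complete ℂ _

/-- `B ↦ A ⊗ B`, as a linear map. -/
def mapRight {S E : Type*} [NormedAddCommGroup S] [InnerProductSpace ℂ S]
    [FiniteDimensional ℂ S] [NormedAddCommGroup E] [InnerProductSpace ℂ E]
    [FiniteDimensional ℂ E] (A : S →L[ℂ] S) :
    (E →L[ℂ] E) →L[ℂ] (S ⊗[ℂ] E →L[ℂ] S ⊗[ℂ] E) :=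
  LinearMap.toContinuousLinearMap
    { toFun := fun B => TensorProduct.mapL A B
      map_add' := TensorProduct.mapL_add_right A
      map_smul' := fun c B => TensorProduct.mapL_smul_right c A B }

/-! ### Break points and the zeroth order part of the Dirac operator -/

namespace NahmData

variable {S E : Type*} [NormedAddCommGroup S] [InnerProductSpace ℂ S]
  [FiniteDimensional ℂ S] [NormedAddCommGroup E] [InnerProductSpace ℂ E]
  [FiniteDimensional ℂ E] {n : ℕ} {W : Fin n → Type*} [∀ α, NormedAddCommGroup (W α)]
  [∀ α, InnerProductSpace ℂ (W α)] [∀ α, FiniteDimensional ℂ (W α)]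
  (N : NahmData S E n W)

theorem isSparse_marks : IsSparse N.marks := by
  have h := IsSparse.iUnion fun α => isSparse_translates (N.lam α)
  convert h using 1
  ext x
  simp [marks]

theorem isSparse_marksWith (y : ℝ) : IsSparse (N.marksWith y) :=
  N.isSparse_marks.union (isSparse_translates y)

theorem marks_subset_marksWith (y : ℝ) : N.marks ⊆ N.marksWith y := subset_union_left

/-- Kernels with source at a marked point create no new break point, so combinations of them stay in
the classes for `N.marks`, in which the kernels of the operators are defined. -/
theorem marksWith_lam (α : Fin n) : N.marksWith (N.lam α) = N.marks := by
  refine union_eq_self_of_subset_right ?_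
  rintro x ⟨l, rfl⟩
  exact ⟨α, l, rfl⟩

theorem T_piecewiseSmooth (μ : Fin 4) : IsPiecewiseSmooth N.marks (N.T μ) := N.T_smooth μ

/-- The zeroth order part of `D_t`. -/
def symbol (t : Fin 4 → ℝ) (s : ℝ) : S ⊗[ℂ] E →L[ℂ] S ⊗[ℂ] E :=
  TensorProduct.mapL 1 (N.T 0 s + (t 0 : ℂ) • 1)
    + ∑ j : Fin 3, TensorProduct.mapL (N.e j) (N.T j.succ s + (t j.succ : ℂ) • 1)

theorem dirac_eq (t : Fin 4 → ℝ) (f : ℝ → S ⊗[ℂ] E) (s : ℝ) :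
    N.dirac t f s = Complex.I • derivWithin f (Ici s) s + N.symbol t s (f s) := by
  simp only [dirac, symbol, add_apply, sum_apply]
  rw [add_assoc]

theorem symbol_eq_sum (t : Fin 4 → ℝ) (s : ℝ) : N.symbol t s =
    ∑ μ, TensorProduct.mapL (N.eMu μ) (N.T μ s + (t μ : ℂ) • 1) := by
  rw [Fin.sum_univ_succ]
  rfl

theorem adj_eMu (μ : Fin 4) : adj (N.eMu μ) = N.eBar μ := by
  refine Fin.cases ?_ (fun j => ?_) μ
  · exact adj_one
  · exact N.e_adj j

theorem adj_T_add (t : Fin 4 → ℝ) (μ : Fin 4) (s : ℝ) :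
    adj (N.T μ s + (t μ : ℂ) • 1) = N.T μ s + (t μ : ℂ) • 1 := by
  rw [adj_add, adj_smul, adj_one, N.T_hermitian]
  simp

theorem isPiecewiseSmooth_mapL (A : S →L[ℂ] S) (t : Fin 4 → ℝ) (μ : Fin 4) :
    IsPiecewiseSmooth N.marks fun s => TensorProduct.mapL A (N.T μ s + (t μ : ℂ) • 1) := by
  exact IsPiecewiseSmooth.clm (G := E →L[ℂ] E) (G' := S ⊗[ℂ] E →L[ℂ] S ⊗[ℂ] E) (mapRight A)
    ((N.T_piecewiseSmooth μ).add (isPiecewiseSmooth_const ((t μ : ℂ) • (1 : E →L[ℂ] E))))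

theorem isPiecewiseSmooth_symbol (t : Fin 4 → ℝ) : IsPiecewiseSmooth N.marks (N.symbol t) := by
  rw [funext (N.symbol_eq_sum t)]
  exact IsPiecewiseSmooth.sum Finset.univ fun μ _ => N.isPiecewiseSmooth_mapL _ t μ

/-- The parameters enter through coefficients independent of `s`; this is the shape that
`FirstOrderSystem` demands. -/
theorem symbol_affine (t : Fin 4 → ℝ) (s : ℝ) : N.symbol t s =
    N.symbol 0 s + ∑ μ, t μ • TensorProduct.mapL (N.eMu μ) 1 := by
  rw [symbol_eq_sum, symbol_eq_sum, ← Finset.sum_add_distrib]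
  refine Finset.sum_congr rfl fun μ _ => ?_
  simp only [TensorProduct.mapL_add_right, TensorProduct.mapL_smul_right, Pi.zero_apply,
    Complex.ofReal_zero, zero_smul, add_zero]
  congr 1

theorem isPiecewiseSmooth_dirac {P : Set ℝ} (hP : N.marks ⊆ P) (t : Fin 4 → ℝ)
    {f : ℝ → S ⊗[ℂ] E} (hf : IsPiecewiseSmooth P f) : IsPiecewiseSmooth P (N.dirac t f) := by
  have h : IsPiecewiseSmooth P fun s => Complex.I • derivWithin f (Ici s) s
      + N.symbol t s (f s) :=
    (hf.derivRight.clm (Complex.I • (1 : S ⊗[ℂ] E →L[ℂ] S ⊗[ℂ] E))).add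
      (((N.isPiecewiseSmooth_symbol t).mono hP).clm_apply hf)
  convert h using 1
  exact funext (N.dirac_eq t f)

end NahmData

/-! ### First order operators on the circle: integration by parts and invertible monodromy -/

theorem l2Inner_eq_integral {V : Type*} [NormedAddCommGroup V] [InnerProductSpace ℂ V]
    {f g : ℝ → V} (hf : Function.Periodic f (2 * Real.pi))
    (hg : Function.Periodic g (2 * Real.pi)) (y : ℝ) :
    l2Inner f g = ∫ s in y..(y + 2 * Real.pi), inner ℂ (f s) (g s) := by
  have h : Function.Periodic (fun s => (inner ℂ (f s) (g s) : ℂ)) (2 * Real.pi) := fun s => by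
    simp [hf s, hg s]
  have := h.intervalIntegral_add_eq 0 y
  rw [zero_add] at this
  exact this

/-- A family of first order operators `i d/ds + M_t(s)` on the circle, whose coefficient depends on
the parameters `t` in an affine way. -/
structure FirstOrderSystem (X : Type*) [NormedAddCommGroup X] [InnerProductSpace ℂ X]
    [FiniteDimensional ℂ X] where
  breaks : Set ℝ
  isSparse : IsSparse breaks
  coeff : ℝ → X →L[ℂ] X
  coeff_smooth : IsPiecewiseSmooth breaks coeff
  param : Fin 4 → X →L[ℂ] X

/-- Passing to the adjoint, as a real linear map. -/
def adjCLM (X Y : Type*) [NormedAddCommGroup X] [InnerProductSpace ℂ X]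
    [FiniteDimensional ℂ X] [NormedAddCommGroup Y] [InnerProductSpace ℂ Y]
    [FiniteDimensional ℂ Y] : (X →L[ℂ] Y) →L[ℝ] (Y →L[ℂ] X) :=
  LinearMap.mkContinuous
    { toFun := adj
      map_add' := adj_add
      map_smul' := fun c A => by
        have h := adj_smul (c : ℂ) A
        rw [Complex.coe_smul] at h
        rw [h]
        simp } 1 fun A => by
      have : CompleteSpace X := FiniteDimensional.complete ℂ X
      have : CompleteSpace Y := FiniteDimensional.complete ℂ Y
      rw [one_mul]
      exact (ContinuousLinearMap.adjoint.norm_map A).le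

theorem IsPiecewiseSmooth.adj {X : Type*} [NormedAddCommGroup X] [InnerProductSpace ℂ X]
    [FiniteDimensional ℂ X] {P : Set ℝ} {A : ℝ → X →L[ℂ] X} (hA : IsPiecewiseSmooth P A) :
    IsPiecewiseSmooth P fun s => adj (A s) :=
  hA.comp (F := adjCLM X X) (adjCLM X X).contDiff

/-- An endomorphism `M` is invertible if there is no nonzero endomorphism `C` with `M C = 0`. -/
theorem isUnit_of_mul_eq_zero {X : Type*} [NormedAddCommGroup X] [InnerProductSpace ℂ X]
    [FiniteDimensional ℂ X] {M : X →L[ℂ] X} (h : ∀ C : X →L[ℂ] X, M * C = 0 → C = 0) :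
    IsUnit M := by
  refine isUnit_of_injective fun c hc => ?_
  -- The rank one endomorphism with image spanned by the kernel vector `c`.
  have h1 := h ((innerSL ℂ c).smulRight c) (by ext x; simp [hc])
  have h2 := congrArg (fun L => L c) h1
  simpa using h2

namespace FirstOrderSystem

variable {X : Type*} [NormedAddCommGroup X] [InnerProductSpace ℂ X]
  [FiniteDimensional ℂ X] (D : FirstOrderSystem X)

/-- The coefficient `M_t(s)`. -/
def symbol (t : Fin 4 → ℝ) (s : ℝ) : X →L[ℂ] X := D.coeff s + ∑ μ, t μ • D.param μ

/-- The operator `i d/ds + M_t(s)`. -/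
def op (t : Fin 4 → ℝ) (f : ℝ → X) (s : ℝ) : X :=
  Complex.I • derivWithin f (Ici s) s + D.symbol t s (f s)

/-- The operator and its adjoint have zero kernel. -/
def IsRegular (t : Fin 4 → ℝ) : Prop :=
  (∀ f : ℝ → X, IsContPiecewiseSmooth D.breaks f → D.op t f = 0 → f = 0) ∧
  (∀ f : ℝ → X, IsPiecewiseSmooth D.breaks f →
    (∀ g : ℝ → X, IsContPiecewiseSmooth D.breaks g → l2Inner f (D.op t g) = 0) → f = 0)

theorem isPiecewiseSmooth_symbol (t : Fin 4 → ℝ) : IsPiecewiseSmooth D.breaks (D.symbol t) :=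
  D.coeff_smooth.add (isPiecewiseSmooth_const _)

theorem isPiecewiseSmooth_op {P : Set ℝ} (hP : D.breaks ⊆ P) (t : Fin 4 → ℝ)
    {f : ℝ → X} (hf : IsPiecewiseSmooth P f) : IsPiecewiseSmooth P (D.op t f) :=
  (hf.derivRight.const_smul Complex.I).add (((D.isPiecewiseSmooth_symbol t).mono hP).clm_apply hf)

theorem isPiecewiseSmooth_I_symbol (t : Fin 4 → ℝ) :
    IsPiecewiseSmooth D.breaks fun s => Complex.I • D.symbol t s :=
  (D.isPiecewiseSmooth_symbol t).const_smul Complex.I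

theorem isPiecewiseSmooth_I_adj_symbol (t : Fin 4 → ℝ) :
    IsPiecewiseSmooth D.breaks fun s => Complex.I • adj (D.symbol t s) :=
  (D.isPiecewiseSmooth_symbol t).adj.const_smul Complex.I

theorem isBoundedMeasurable_coeff : IsBoundedMeasurable fun s => Complex.I • D.coeff s :=
  (D.coeff_smooth.const_smul Complex.I).isBoundedMeasurable D.isSparse

theorem isBoundedMeasurable_adj_coeff :
    IsBoundedMeasurable fun s => Complex.I • adj (D.coeff s) :=
  (D.coeff_smooth.adj.const_smul Complex.I).isBoundedMeasurable D.isSparse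

theorem I_smul_symbol (t : Fin 4 → ℝ) (s : ℝ) :
    Complex.I • D.symbol t s = Complex.I • D.coeff s + ∑ μ, t μ • (Complex.I • D.param μ) := by
  rw [symbol, smul_add, Finset.smul_sum]
  congr 1
  exact Finset.sum_congr rfl fun μ _ => smul_comm _ _ _

theorem I_smul_adj_symbol (t : Fin 4 → ℝ) (s : ℝ) : Complex.I • adj (D.symbol t s)
    = Complex.I • adj (D.coeff s) + ∑ μ, t μ • (Complex.I • adj (D.param μ)) := by
  have h : adj (D.symbol t s) = adj (D.coeff s) + ∑ μ, t μ • adj (D.param μ) := by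
    change adjCLM X X (D.coeff s + ∑ μ, t μ • D.param μ) = _
    rw [map_add, map_sum]
    simp only [map_smul]
    rfl
  rw [h, smul_add, Finset.smul_sum]
  congr 1
  exact Finset.sum_congr rfl fun μ _ => smul_comm _ _ _

/-- The monodromy of the equation `D_t f = 0`. -/
def opMonodromy (y : ℝ) (t : Fin 4 → ℝ) : X →L[ℂ] X :=
  monodromy y D.isBoundedMeasurable_coeff (fun μ => Complex.I • D.param μ) t

/-- The monodromy of the equation `D_t† f = 0`. -/
def adjMonodromy (y : ℝ) (t : Fin 4 → ℝ) : X →L[ℂ] X :=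
  monodromy y D.isBoundedMeasurable_adj_coeff (fun μ => Complex.I • adj (D.param μ)) t

/-- The kernel of `(D_t†)⁻¹` on `[y, y + 2π]`. -/
def adjKernelOn (y : ℝ) (t : Fin 4 → ℝ) : C(Icc y (y + 2 * Real.pi), X →L[ℂ] X) :=
  propagator y D.isBoundedMeasurable_adj_coeff (fun μ => Complex.I • adj (D.param μ)) t *
    ContinuousMap.const _ (Ring.inverse (-Complex.I • (D.adjMonodromy y t - 1)))

/-- The kernel of `(D_t† D_t)⁻¹` on `[y, y + 2π]`. -/
def greenKernelOn (y : ℝ) (t : Fin 4 → ℝ) : C(Icc y (y + 2 * Real.pi), X →L[ℂ] X) :=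
  periodicSolve y D.isBoundedMeasurable_coeff (fun μ => Complex.I • D.param μ) t
    (ContinuousMap.const _ (-Complex.I • (1 : X →L[ℂ] X)) * D.adjKernelOn y t)

/-- The kernel of `(D_t†)⁻¹`. -/
def adjKernel (t : Fin 4 → ℝ) (s y : ℝ) : X →L[ℂ] X := extend y (D.adjKernelOn y t) s

/-- The kernel of `(D_t† D_t)⁻¹`. -/
def greenKernel (t : Fin 4 → ℝ) (s y : ℝ) : X →L[ℂ] X := extend y (D.greenKernelOn y t) s

section Solution

variable {D} {t : Fin 4 → ℝ} {y : ℝ}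

/-- The formal adjoint of `i d/ds + M` is `i d/ds + M†`, so its homogeneous solutions obey `f' = i
M† f`. The zero source is written out to fit the lemmas on `extend`. -/
theorem adj_propagator_apply (c : X →L[ℂ] X) (s : Icc y (y + 2 * Real.pi)) :
    let φ := propagator y D.isBoundedMeasurable_adj_coeff (fun μ => Complex.I • adj (D.param μ)) t *
      ContinuousMap.const (Icc y (y + 2 * Real.pi)) c
    φ s = φ ⟨y, left_mem y⟩ + ∫ z in y..s, (Complex.I • adj (D.symbol t z) *
        IccExtend (lt_add_two_pi y).le φ z + (fun _ => 0) z) := by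
  intro φ
  have h := propagator_mul_const_apply (y := y) D.isBoundedMeasurable_adj_coeff
    (fun μ => Complex.I • adj (D.param μ)) t c s
  simp only [← I_smul_adj_symbol] at h
  simp only [add_zero]
  have h0 : φ ⟨y, left_mem y⟩ = c := by simp [φ, propagator_left]
  rw [h0]
  exact h

theorem op_propagator_apply (c : X →L[ℂ] X) (s : Icc y (y + 2 * Real.pi)) :
    let φ := propagator y D.isBoundedMeasurable_coeff (fun μ => Complex.I • D.param μ) t *
      ContinuousMap.const (Icc y (y + 2 * Real.pi)) c
    φ s = φ ⟨y, left_mem y⟩ + ∫ z in y..s, (Complex.I • D.symbol t z *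
        IccExtend (lt_add_two_pi y).le φ z + (fun _ => 0) z) := by
  intro φ
  have h := propagator_mul_const_apply (y := y) D.isBoundedMeasurable_coeff
    (fun μ => Complex.I • D.param μ) t c s
  simp only [← I_smul_symbol] at h
  simp only [add_zero]
  have h0 : φ ⟨y, left_mem y⟩ = c := by simp [φ, propagator_left]
  rw [h0]
  exact h

/-- The integration by parts formula over one period for a solution of the adjoint equation. -/
theorem l2Inner_extend_op {P : Set ℝ} (hP : IsSparse P) (hmP : D.breaks ⊆ P)
    {φ : C(Icc y (y + 2 * Real.pi), X →L[ℂ] X)}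
    (hφ : ∀ s : Icc y (y + 2 * Real.pi), φ s = φ ⟨y, left_mem y⟩ + ∫ z in y..s,
      (Complex.I • adj (D.symbol t z) * IccExtend (lt_add_two_pi y).le φ z + (fun _ => 0) z))
    (u : X) {g : ℝ → X} (hg : IsContPiecewiseSmooth P g) :
    l2Inner (fun s => extend y φ s u) (D.op t g) =
      inner ℂ ((-Complex.I • (φ ⟨y + 2 * Real.pi, right_mem y⟩ - φ ⟨y, left_mem y⟩)) u) (g y) := by
  have hDg := D.isPiecewiseSmooth_op hmP t hg.1
  have hper : Function.Periodic (fun s => extend y φ s u) (2 * Real.pi) := fun s => by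
    simp only [extend_periodic y φ s]
  rw [l2Inner_eq_integral hper hDg.1 y]
  set ψ : ℝ → X := fun s => IccExtend (lt_add_two_pi y).le φ s u with hψ
  have hψc : Continuous ψ :=
    (ContinuousLinearMap.apply ℂ X u).continuous.comp φ.continuous.Icc_extend'
  have hψd : ∀ s ∈ Ico y (y + 2 * Real.pi),
      HasDerivWithinAt ψ (Complex.I • adj (D.symbol t s) (ψ s)) (Ici s) s := by
    intro s hs
    have h1 := IccExtend_hasDerivWithinAt D.isSparse (D.isPiecewiseSmooth_I_adj_symbol t)
      (isPiecewiseSmooth_const 0) hφ hs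
    have h2 := ((ContinuousLinearMap.apply ℂ X u).restrictScalars
      ℝ).hasFDerivAt.comp_hasDerivWithinAt s h1
    exact h2.congr_deriv (by simp [hψ])
  have e1 : ∫ s in y..(y + 2 * Real.pi), (inner ℂ (extend y φ s u) (D.op t g s) : ℂ)
      = ∫ s in y..(y + 2 * Real.pi), (inner ℂ (ψ s) (D.op t g s) : ℂ) := by
    rw [intervalIntegral.integral_of_le (lt_add_two_pi y).le,
      intervalIntegral.integral_of_le (lt_add_two_pi y).le, integral_Ioc_eq_integral_Ioo,
      integral_Ioc_eq_integral_Ioo]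
    refine setIntegral_congr_fun measurableSet_Ioo fun s hs => ?_
    rw [hψ]
    simp only [extend, periodize_of_mem _ (Ioo_subset_Ico_self hs)]
  -- As `ψ` solves the adjoint equation, `I * ⟨ψ, g⟩` is a primitive of `⟨ψ, D_t g⟩`. Only its
  -- values at the two ends of the period survive, and `g` is the same at both.
  have hderiv : ∀ s ∈ Ioo y (y + 2 * Real.pi), HasDerivWithinAt
      (fun s => Complex.I * inner ℂ (ψ s) (g s)) (inner ℂ (ψ s) (D.op t g s)) (Ioi s) s := by
    intro s hs
    have h1 := (hψd s (Ioo_subset_Ico_self hs)).inner ℂ (hg.1.exists_hasDerivWithinAt hP s)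
    have h2 := (h1.const_mul Complex.I).mono Ioi_subset_Ici_self
    refine h2.congr_deriv ?_
    rw [op, inner_add_right, inner_smul_right, inner_smul_left, adj_inner_left, mul_add]
    simp only [Complex.conj_I]
    linear_combination (-inner ℂ (ψ s) ((D.symbol t s) (g s))) * Complex.I_mul_I
  have hint : IntervalIntegrable (fun s => (inner ℂ (ψ s) (D.op t g s) : ℂ)) volume y
      (y + 2 * Real.pi) := by
    obtain ⟨C, hC⟩ := hDg.exists_bound hP
    obtain ⟨C', hC'⟩ : ∃ C', ∀ s, ‖ψ s‖ ≤ C' := ⟨‖φ‖ * ‖u‖, fun s =>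
      ((IccExtend (lt_add_two_pi y).le φ s).le_opNorm u).trans
        (by gcongr; exact φ.norm_coe_le_norm _)⟩
    refine (intervalIntegrable_const (c := C' * C)).mono_fun
      (hψc.aestronglyMeasurable.inner (hDg.aestronglyMeasurable hP)).restrict
      (Eventually.of_forall fun s => ?_)
    refine (norm_inner_le_norm _ _).trans (le_trans ?_ (le_abs_self _))
    exact mul_le_mul (hC' s) (hC s) (norm_nonneg _) ((norm_nonneg _).trans (hC' s))
  rw [e1, intervalIntegral.integral_eq_sub_of_hasDeriv_right_of_le (lt_add_two_pi y).le
    (continuous_const.mul (hψc.inner hg.2)).continuousOn hderiv hint, hg.1.1 y]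
  have e2 : ψ (y + 2 * Real.pi) = φ ⟨y + 2 * Real.pi, right_mem y⟩ u := by
    rw [hψ]; simp only [IccExtend_of_mem _ _ (right_mem y)]
  have e3 : ψ y = φ ⟨y, left_mem y⟩ u := by
    rw [hψ]; simp only [IccExtend_of_mem _ _ (left_mem y)]
  rw [e2, e3, smul_apply, inner_smul_left, sub_apply, inner_sub_left]
  simp only [map_neg, Complex.conj_I, neg_neg]
  ring

/-- A value `C` fixed by the monodromy starts a solution that closes up. Integration by parts then
has no boundary term, so the solution lies in the kernel of the adjoint, which is zero. The factor
`-I` is the one in the boundary term of `l2Inner_extend_op`, so that the inverse of this element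
normalizes the jump of `adjKernel`. -/
theorem isUnit_adjMonodromy (h : D.IsRegular t) (y : ℝ) :
    IsUnit (-Complex.I • (D.adjMonodromy y t - 1)) := by
  refine isUnit_of_mul_eq_zero fun C hC => ?_
  have hC' : D.adjMonodromy y t * C = C := by
    rw [smul_mul_assoc, smul_eq_zero] at hC
    have := hC.resolve_left (by simp)
    rwa [sub_mul, one_mul, sub_eq_zero] at this
  have hs := adj_propagator_apply (D := D) (t := t) (y := y) C
  set φ := propagator y D.isBoundedMeasurable_adj_coeff (fun μ => Complex.I • adj (D.param μ)) t *
    ContinuousMap.const (Icc y (y + 2 * Real.pi)) C with hφ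
  have hl : φ ⟨y, left_mem y⟩ = C := by simp [hφ, propagator_left]
  have hr : φ ⟨y + 2 * Real.pi, right_mem y⟩ = C := hC'
  have hPS := extend_isPiecewiseSmooth D.isSparse (D.isPiecewiseSmooth_I_adj_symbol t)
    (isPiecewiseSmooth_const 0) hs (.inr (hl.trans hr.symm))
  ext u
  have h0 := h.2 (fun s => extend y φ s u) (hPS.clm_apply (isPiecewiseSmooth_const u))
    fun g hg => by
      rw [l2Inner_extend_op D.isSparse subset_rfl hs u hg, hl, hr]
      simp
  have h1 := congrFun h0 y
  simpa [extend_self, hl] using h1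

/-- As for the adjoint: a fixed value of the monodromy gives a periodic solution. Here it must also
be continuous in order to lie in the domain of the operator. -/
theorem isUnit_opMonodromy (h : D.IsRegular t) (y : ℝ) :
    IsUnit (1 - D.opMonodromy y t) := by
  refine isUnit_of_mul_eq_zero fun C hC => ?_
  have hC' : D.opMonodromy y t * C = C := by
    rw [sub_mul, one_mul, sub_eq_zero] at hC
    exact hC.symm
  have hs := op_propagator_apply (D := D) (t := t) (y := y) C
  set φ := propagator y D.isBoundedMeasurable_coeff (fun μ => Complex.I • D.param μ) t *
    ContinuousMap.const (Icc y (y + 2 * Real.pi)) C with hφ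
  have hl : φ ⟨y, left_mem y⟩ = C := by simp [hφ, propagator_left]
  have hr : φ ⟨y + 2 * Real.pi, right_mem y⟩ = C := hC'
  have hA := D.isPiecewiseSmooth_I_symbol t
  have h00 := isPiecewiseSmooth_const (P := D.breaks) (0 : X →L[ℂ] X)
  have hPS := extend_isPiecewiseSmooth D.isSparse hA h00 hs (.inr (hl.trans hr.symm))
  have hc := extend_continuous D.isSparse hA h00 hs (hl.trans hr.symm)
  have hd := extend_hasDerivWithinAt D.isSparse hA h00 hs
  ext u
  have h0 := h.1 (fun s => extend y φ s u) ⟨hPS.clm_apply (isPiecewiseSmooth_const u),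
    (ContinuousLinearMap.apply ℂ X u).continuous.comp hc⟩ (funext fun s => by
      rw [op]
      have h2 := ((ContinuousLinearMap.apply ℂ X u).restrictScalars
        ℝ).hasFDerivAt.comp_hasDerivWithinAt s (hd s)
      have h3 := HasDerivWithinAt.derivWithin h2 (uniqueDiffWithinAt_Ici s)
      simp only [Function.comp_def, ContinuousLinearMap.coe_restrictScalars',
        ContinuousLinearMap.apply_apply] at h3
      rw [h3]
      simp [smul_smul])
  have h1 := congrFun h0 y
  simpa [extend_self, hl] using h1

end Solution

end FirstOrderSystem

/-! ### The `L²` product of piecewise smooth functions -/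

/-- Piecewise smooth functions, for an unspecified sparse set of break points. -/
def IsPW {V : Type*} [NormedAddCommGroup V] [NormedSpace ℝ V] (f : ℝ → V) : Prop :=
  ∃ P : Set ℝ, IsSparse P ∧ IsPiecewiseSmooth P f

section PW

variable {V V' : Type*} [NormedAddCommGroup V] [InnerProductSpace ℂ V]
  [NormedAddCommGroup V'] [InnerProductSpace ℂ V'] {f g k : ℝ → V}

theorem IsPW.add (hf : IsPW f) (hg : IsPW g) : IsPW fun s => f s + g s := by
  obtain ⟨P, hP, hf⟩ := hf
  obtain ⟨P', hP', hg⟩ := hg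
  exact ⟨_, hP.union hP', (hf.mono subset_union_left).add (hg.mono subset_union_right)⟩

theorem IsPW.sub (hf : IsPW f) (hg : IsPW g) : IsPW fun s => f s - g s := by
  obtain ⟨P, hP, hf⟩ := hf
  obtain ⟨P', hP', hg⟩ := hg
  exact ⟨_, hP.union hP', (hf.mono subset_union_left).sub (hg.mono subset_union_right)⟩

theorem isPW_zero : IsPW fun _ : ℝ => (0 : V) :=
  ⟨_, isSparse_translates 0, isPiecewiseSmooth_const 0⟩

theorem IsPW.sum {ι : Type*} {u : Finset ι} {f : ι → ℝ → V} (hf : ∀ i ∈ u, IsPW (f i)) :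
    IsPW fun s => ∑ i ∈ u, f i s := by
  classical
  induction u using Finset.induction_on with
  | empty => simpa using isPW_zero
  | insert i u hi ih =>
    simp only [Finset.sum_insert hi]
    exact (hf i (Finset.mem_insert_self i u)).add
      (ih fun j hj => hf j (Finset.mem_insert_of_mem hj))

theorem IsPW.clm (L : V →L[ℂ] V') (hf : IsPW f) : IsPW fun s => L (f s) := by
  obtain ⟨P, hP, hf⟩ := hf
  exact ⟨P, hP, hf.clm L⟩

theorem IsPW.const_smul (c : ℂ) (hf : IsPW f) : IsPW fun s => c • f s := by
  obtain ⟨P, hP, hf⟩ := hf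
  exact ⟨P, hP, hf.const_smul c⟩

theorem IsPW.intervalIntegrable_inner (hf : IsPW f) (hg : IsPW g) (a b : ℝ) :
    IntervalIntegrable (fun s => (inner ℂ (f s) (g s) : ℂ)) volume a b := by
  obtain ⟨P, hP, hf⟩ := hf
  obtain ⟨P', hP', hg⟩ := hg
  exact ((hf.mono subset_union_left).innerProd
    (hg.mono subset_union_right)).intervalIntegrable (hP.union hP') a b

theorem l2Inner_add_right (hf : IsPW f) (hg : IsPW g) (hk : IsPW k) :
    l2Inner f (fun s => g s + k s) = l2Inner f g + l2Inner f k := by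
  simp only [l2Inner, inner_add_right]
  exact intervalIntegral.integral_add (hf.intervalIntegrable_inner hg _ _)
    (hf.intervalIntegrable_inner hk _ _)

theorem l2Inner_add_left (hf : IsPW f) (hg : IsPW g) (hk : IsPW k) :
    l2Inner (fun s => f s + g s) k = l2Inner f k + l2Inner g k := by
  simp only [l2Inner, inner_add_left]
  exact intervalIntegral.integral_add (hf.intervalIntegrable_inner hk _ _)
    (hg.intervalIntegrable_inner hk _ _)

theorem l2Inner_sub_left (hf : IsPW f) (hg : IsPW g) (hk : IsPW k) :
    l2Inner (fun s => f s - g s) k = l2Inner f k - l2Inner g k := by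
  simp only [l2Inner, inner_sub_left]
  exact intervalIntegral.integral_sub (hf.intervalIntegrable_inner hk _ _)
    (hg.intervalIntegrable_inner hk _ _)

theorem l2Inner_smul_right (c : ℂ) (f g : ℝ → V) :
    l2Inner f (fun s => c • g s) = c * l2Inner f g := by
  simp only [l2Inner, inner_smul_right]
  exact intervalIntegral.integral_const_mul _ _

theorem l2Inner_smul_left (c : ℂ) (f g : ℝ → V) :
    l2Inner (fun s => c • f s) g = star c * l2Inner f g := by
  simp only [l2Inner, inner_smul_left]
  exact intervalIntegral.integral_const_mul _ _

theorem l2Inner_neg_right (f g : ℝ → V) : l2Inner f (fun s => -g s) = -l2Inner f g := by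
  simp only [l2Inner, inner_neg_right, intervalIntegral.integral_neg]

theorem l2Inner_neg_left (f g : ℝ → V) : l2Inner (fun s => -f s) g = -l2Inner f g := by
  simp only [l2Inner, inner_neg_left, intervalIntegral.integral_neg]

theorem l2Inner_zero_right (f : ℝ → V) : l2Inner f (fun _ => 0) = 0 := by simp [l2Inner]

theorem l2Inner_sum_right {ι : Type*} {u : Finset ι} {g : ι → ℝ → V} (hf : IsPW f)
    (hg : ∀ i ∈ u, IsPW (g i)) :
    l2Inner f (fun s => ∑ i ∈ u, g i s) = ∑ i ∈ u, l2Inner f (g i) := by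
  simp only [l2Inner, inner_sum]
  exact intervalIntegral.integral_finsetSum fun i hi => hf.intervalIntegrable_inner (hg i hi) _ _

theorem l2Inner_sum_left {ι : Type*} {u : Finset ι} {g : ι → ℝ → V} (hf : IsPW f)
    (hg : ∀ i ∈ u, IsPW (g i)) :
    l2Inner (fun s => ∑ i ∈ u, g i s) f = ∑ i ∈ u, l2Inner (g i) f := by
  simp only [l2Inner, sum_inner]
  exact intervalIntegral.integral_finsetSum fun i hi => (hg i hi).intervalIntegrable_inner hf _ _

theorem l2Inner_conj (f g : ℝ → V) : star (l2Inner f g) = l2Inner g f := by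
  rw [l2Inner, l2Inner, intervalIntegral.integral_of_le Real.two_pi_pos.le,
    intervalIntegral.integral_of_le Real.two_pi_pos.le]
  refine (integral_conj (f := fun s => (inner ℂ (f s) (g s) : ℂ))).symm.trans ?_
  exact integral_congr_ae (Eventually.of_forall fun s => inner_conj_symm _ _)

theorem l2Inner_clm_left [FiniteDimensional ℂ V] [FiniteDimensional ℂ V'] (A : V →L[ℂ] V')
    (f : ℝ → V) (g : ℝ → V') :
    l2Inner (fun s => A (f s)) g = l2Inner f (fun s => adj A (g s)) := by
  simp only [l2Inner, adj_inner_right]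

theorem l2Inner_self_eq_ofReal (f : ℝ → V) :
    l2Inner f f = ((∫ s in (0 : ℝ)..(2 * Real.pi), ‖f s‖ ^ 2 : ℝ) : ℂ) := by
  rw [l2Inner, ← intervalIntegral.integral_ofReal]
  exact intervalIntegral.integral_congr fun s _ => by simp [inner_self_eq_norm_sq_to_K]

theorem l2Inner_self_re_nonneg (f : ℝ → V) : 0 ≤ (l2Inner f f).re := by
  rw [l2Inner_self_eq_ofReal, Complex.ofReal_re]
  exact intervalIntegral.integral_nonneg Real.two_pi_pos.le fun s _ => by positivity

theorem eq_zero_of_l2Inner_self {P : Set ℝ} (hP : IsSparse P) (hf : IsPiecewiseSmooth P f)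
    (h : l2Inner f f = 0) : f = 0 := by
  rw [l2Inner_self_eq_ofReal, Complex.ofReal_eq_zero] at h
  refine hf.eq_zero_of_ae hP ?_
  have hi : IntervalIntegrable (fun s => ‖f s‖ ^ 2) volume 0 (2 * Real.pi) := by
    have h1 := (hf.innerProd hf).intervalIntegrable hP 0 (2 * Real.pi)
    have h2 := h1.norm
    refine h2.congr fun s _ => ?_
    simp [inner_self_eq_norm_sq_to_K]
  have h3 := (intervalIntegral.integral_eq_zero_iff_of_le_of_nonneg_ae Real.two_pi_pos.le
    (Eventually.of_forall fun s => by simp) hi).1 h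
  filter_upwards [h3] with s hs
  simpa using hs

end PW

/-! ### The kernels of the inverse operators -/

namespace FirstOrderSystem

variable {X : Type*} [NormedAddCommGroup X] [InnerProductSpace ℂ X]
  [FiniteDimensional ℂ X] {D : FirstOrderSystem X} {t : Fin 4 → ℝ}

/-- The break points of the coefficient and the translates of `y`. -/
def breaksWith (D : FirstOrderSystem X) (y : ℝ) : Set ℝ :=
  D.breaks ∪ {x : ℝ | ∃ l : ℤ, x = y + 2 * Real.pi * l}

theorem isSparse_breaksWith (y : ℝ) : IsSparse (D.breaksWith y) :=
  D.isSparse.union (isSparse_translates y)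

theorem breaks_subset (y : ℝ) : D.breaks ⊆ D.breaksWith y := subset_union_left

theorem adjKernelOn_apply (y : ℝ) (s : Icc y (y + 2 * Real.pi)) :
    D.adjKernelOn y t s = D.adjKernelOn y t ⟨y, left_mem y⟩ + ∫ z in y..s,
      (Complex.I • adj (D.symbol t z) * IccExtend (lt_add_two_pi y).le (D.adjKernelOn y t) z
        + (fun _ => 0) z) :=
  adj_propagator_apply _ s

theorem adjKernel_hasDerivWithinAt (y s : ℝ) : HasDerivWithinAt (fun s => D.adjKernel t s y)
    (Complex.I • adj (D.symbol t s) * D.adjKernel t s y) (Ici s) s := by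
  have h := extend_hasDerivWithinAt D.isSparse (D.isPiecewiseSmooth_I_adj_symbol t)
    (isPiecewiseSmooth_const 0) (adjKernelOn_apply (t := t) y) s
  exact h.congr_deriv (add_zero _)

theorem isPiecewiseSmooth_adjKernel (y : ℝ) :
    IsPiecewiseSmooth (D.breaksWith y) fun s => D.adjKernel t s y :=
  extend_isPiecewiseSmooth (isSparse_breaksWith y)
    ((D.isPiecewiseSmooth_I_adj_symbol t).mono (breaks_subset y))
    (isPiecewiseSmooth_const 0) (adjKernelOn_apply (t := t) y) (.inl subset_union_right)

/-- The reproducing property of the kernel of `(D_t†)⁻¹`. -/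
theorem l2Inner_adjKernel (h : D.IsRegular t) {P : Set ℝ} (hP : IsSparse P)
    (hmP : D.breaks ⊆ P) (y : ℝ) (u : X) {g : ℝ → X} (hg : IsContPiecewiseSmooth P g) :
    l2Inner (fun s => D.adjKernel t s y u) (D.op t g) = inner ℂ u (g y) := by
  have h1 := l2Inner_extend_op hP hmP (adjKernelOn_apply (t := t) y) u hg
  -- The initial value of the kernel was chosen so that its increment over one period, times `-I`,
  -- is the identity.
  have h2 : -Complex.I • (D.adjKernelOn y t ⟨y + 2 * Real.pi, right_mem y⟩
      - D.adjKernelOn y t ⟨y, left_mem y⟩) = 1 := by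
    have h3 : D.adjKernelOn y t ⟨y, left_mem y⟩
        = Ring.inverse (-Complex.I • (D.adjMonodromy y t - 1)) := by
      simp [adjKernelOn, propagator_left]
    have h4 : D.adjKernelOn y t ⟨y + 2 * Real.pi, right_mem y⟩ = D.adjMonodromy y t *
        Ring.inverse (-Complex.I • (D.adjMonodromy y t - 1)) := rfl
    rw [h3, h4]
    have h5 := Ring.mul_inverse_cancel _ (isUnit_adjMonodromy h y)
    rw [smul_mul_assoc, sub_mul, one_mul] at h5
    exact h5
  rw [h2] at h1
  exact h1

theorem extend_const_mul (y s : ℝ) (c : X →L[ℂ] X) (φ : C(Icc y (y + 2 * Real.pi), X →L[ℂ] X)) :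
    extend y (ContinuousMap.const _ c * φ) s = c * extend y φ s := by
  simp [extend_eq]

theorem greenKernelOn_apply (y : ℝ) (s : Icc y (y + 2 * Real.pi)) :
    D.greenKernelOn y t s = D.greenKernelOn y t ⟨y, left_mem y⟩ + ∫ z in y..s,
      (Complex.I • D.symbol t z * IccExtend (lt_add_two_pi y).le (D.greenKernelOn y t) z
        + (fun z => (-Complex.I • (1 : X →L[ℂ] X)) * D.adjKernel t z y) z) := by
  have h := periodicSolve_apply D.isBoundedMeasurable_coeff (fun μ => Complex.I • D.param μ) t
    (ContinuousMap.const _ (-Complex.I • (1 : X →L[ℂ] X)) * D.adjKernelOn y t) s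
  simp only [← I_smul_symbol] at h
  refine h.trans ?_
  congr 1
  rw [intervalIntegral.integral_of_le s.2.1, intervalIntegral.integral_of_le s.2.1,
    integral_Ioc_eq_integral_Ioo, integral_Ioc_eq_integral_Ioo]
  refine setIntegral_congr_fun measurableSet_Ioo fun z hz => ?_
  have hz' : z ∈ Ico y (y + 2 * Real.pi) := ⟨hz.1.le, hz.2.trans_le s.2.2⟩
  simp only [adjKernel]
  rw [← extend_const_mul, extend_of_mem _ hz']
  exact congrArg₂ (· + ·) rfl (IccExtend_of_mem _ _ (Ico_subset_Icc_self hz'))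

theorem greenKernelOn_left_eq_right (h : D.IsRegular t) (y : ℝ) :
    D.greenKernelOn y t ⟨y, left_mem y⟩
      = D.greenKernelOn y t ⟨y + 2 * Real.pi, right_mem y⟩ :=
  periodicSolve_left_eq_right _ _ (isUnit_opMonodromy h y) _

theorem isPiecewiseSmooth_const_mul_adjKernel (c : X →L[ℂ] X) (y : ℝ) :
    IsPiecewiseSmooth (D.breaksWith y) fun s => c * D.adjKernel t s y :=
  (isPiecewiseSmooth_adjKernel y).clm
    (ContinuousLinearMap.mul ℂ (X →L[ℂ] X) c)

theorem greenKernel_hasDerivWithinAt (y s : ℝ) : HasDerivWithinAt (fun s => D.greenKernel t s y)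
    (Complex.I • D.symbol t s * D.greenKernel t s y
      + (-Complex.I • (1 : X →L[ℂ] X)) * D.adjKernel t s y) (Ici s) s :=
  extend_hasDerivWithinAt (isSparse_breaksWith y)
    ((D.isPiecewiseSmooth_I_symbol t).mono (breaks_subset y))
    (isPiecewiseSmooth_const_mul_adjKernel _ y) (greenKernelOn_apply y) s

theorem isContPiecewiseSmooth_greenKernel (h : D.IsRegular t) (y : ℝ) :
    IsContPiecewiseSmooth (D.breaksWith y) fun s => D.greenKernel t s y :=
  ⟨extend_isPiecewiseSmooth (isSparse_breaksWith y)
    ((D.isPiecewiseSmooth_I_symbol t).mono (breaks_subset y))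
    (isPiecewiseSmooth_const_mul_adjKernel _ y) (greenKernelOn_apply y) (.inl subset_union_right),
  extend_continuous (isSparse_breaksWith y)
    ((D.isPiecewiseSmooth_I_symbol t).mono (breaks_subset y))
    (isPiecewiseSmooth_const_mul_adjKernel _ y) (greenKernelOn_apply y)
    (greenKernelOn_left_eq_right h y)⟩

/-- The source of `greenKernelOn` is `-I` times the kernel of `(D_t†)⁻¹`, and the factor `I` in `op`
restores that kernel. So the second order problem `D_t† D_t` is solved by two first order ones. -/
theorem op_greenKernel (y : ℝ) (u : X) :
    D.op t (fun s => D.greenKernel t s y u) = fun s => D.adjKernel t s y u := by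
  funext s
  have h2 := ((ContinuousLinearMap.apply ℂ X u).restrictScalars
    ℝ).hasFDerivAt.comp_hasDerivWithinAt s (greenKernel_hasDerivWithinAt (D := D) (t := t) y s)
  have h3 := HasDerivWithinAt.derivWithin h2 (uniqueDiffWithinAt_Ici s)
  simp only [Function.comp_def, ContinuousLinearMap.coe_restrictScalars',
    ContinuousLinearMap.apply_apply] at h3
  rw [op, h3]
  simp [smul_smul]

/-- Regularity speaks only of functions with the break points of the coefficient. A continuous
solution of the homogeneous equation is smooth wherever the coefficient is, so further break points,
such as a source point, disappear. -/
theorem eq_zero_of_op_eq_zero (h : D.IsRegular t) {P : Set ℝ} (hP : IsSparse P)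
    {f : ℝ → X} (hf : IsContPiecewiseSmooth P f) (h0 : D.op t f = 0) : f = 0 := by
  refine h.1 f ⟨?_, hf.2⟩ h0
  refine isPiecewiseSmooth_of_hasDerivWithinAt
    (A := fun s => (Complex.I • D.symbol t s).restrictScalars ℝ) (h := fun _ => 0)
    ((D.isPiecewiseSmooth_I_symbol t).comp
      (F := ContinuousLinearMap.restrictScalarsL ℂ X X ℝ ℝ) (ContinuousLinearMap.contDiff _))
    (isPiecewiseSmooth_const 0) hf.1.1 (fun s _ => hf.2.continuousAt)
    (fun s => ⟨_, hf.2.continuousAt.tendsto.mono_left nhdsWithin_le_nhds⟩) (fun s => ?_)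
  refine (hf.1.exists_hasDerivWithinAt hP s).congr_deriv ?_
  have h1 := congrArg (fun x => -Complex.I • x) (congrFun h0 s)
  simp only [op, smul_add, smul_smul, Pi.zero_apply, smul_zero, neg_mul, Complex.I_mul_I,
    neg_neg, one_smul] at h1
  rw [eq_neg_of_add_eq_zero_left h1]
  simp

section Smooth

variable {U : Set (Fin 4 → ℝ)}

theorem contDiffOn_adjKernelOn (h : ∀ t ∈ U, D.IsRegular t) (y : ℝ) :
    ContDiffOn ℝ ∞ (D.adjKernelOn y) U := by
  have h2 := (contDiff_propagator (y := y) D.isBoundedMeasurable_adj_coeff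
    (fun μ => Complex.I • adj (D.param μ))).contDiffOn (s := U)
  refine h2.mul (contDiffOn_const_fun (contDiffOn_ringInverse ?_
    fun t ht => isUnit_adjMonodromy (h t ht) y))
  exact ((contDiff_eval h2 _).sub contDiffOn_const).const_smul (-Complex.I)

theorem contDiffOn_greenKernelOn (h : ∀ t ∈ U, D.IsRegular t) (y : ℝ) :
    ContDiffOn ℝ ∞ (D.greenKernelOn y) U :=
  contDiffOn_periodicSolve _ _ (fun t ht => isUnit_opMonodromy (h t ht) y)
    (contDiffOn_const.mul (contDiffOn_adjKernelOn h y))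

theorem contDiffOn_adjKernel (h : ∀ t ∈ U, D.IsRegular t) (y s : ℝ) :
    ContDiffOn ℝ ∞ (fun t => D.adjKernel t s y) U := by
  simp only [adjKernel, extend_eq]
  exact contDiff_eval (contDiffOn_adjKernelOn h y) _

theorem contDiffOn_greenKernel (h : ∀ t ∈ U, D.IsRegular t) (y s : ℝ) :
    ContDiffOn ℝ ∞ (fun t => D.greenKernel t s y) U := by
  simp only [greenKernel, extend_eq]
  exact contDiff_eval (contDiffOn_greenKernelOn h y) _

end Smooth

end FirstOrderSystem

/-! ### The Weitzenböck formula -/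

/-- The pointwise Weitzenböck identity. -/
theorem inner_dirac_expand {X : Type*} [NormedAddCommGroup X] [InnerProductSpace ℂ X]
    [FiniteDimensional ℂ X] {e B : Fin 3 → X →L[ℂ] X} {A : Fin 4 → X →L[ℂ] X}
    (he : ∀ j, adj (e j) = -e j) (hsq : ∀ j x, e j (e j x) = -x)
    (hmul : ∀ j x, e j (e (j + 1) x) = e (j + 2) x)
    (hmul' : ∀ j x, e (j + 1) (e j x) = -e (j + 2) x)
    (hA : ∀ μ, adj (A μ) = A μ) (hc : ∀ j μ x, e j (A μ x) = A μ (e j x))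
    (hB : ∀ j x, Complex.I • B j x + (A 0 (A j.succ x) - A j.succ (A 0 x))
      - (A (j + 1).succ (A (j + 2).succ x) - A (j + 2).succ (A (j + 1).succ x)) = 0)
    (f f' g g' : X) :
    inner ℂ (Complex.I • f' + A 0 f + ∑ j : Fin 3, e j (A j.succ f))
        (Complex.I • g' + A 0 g + ∑ j : Fin 3, e j (A j.succ g))
      = inner ℂ (Complex.I • f' + A 0 f) (Complex.I • g' + A 0 g)
        + ∑ j : Fin 3, inner ℂ (A j.succ f) (A j.succ g)
        + ∑ j : Fin 3, -Complex.I * (inner ℂ f' (e j (A j.succ g)) + (inner ℂ f (e j (B j g))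
          + inner ℂ f (e j (A j.succ g')))) := by
  have h1 : ∀ j x y, inner ℂ (e j x) y = -inner ℂ x (e j y) := fun j x y => by
    rw [← adj_inner_right, he, neg_apply, inner_neg_right]
  have h1' : ∀ μ x y, inner ℂ (A μ x) y = inner ℂ x (A μ y) := fun μ x y => by
    rw [← adj_inner_right, hA]
  have d : ∀ j a b, inner ℂ (e j a) (e j b) = inner ℂ a b := fun j a b => by
    rw [h1, hsq, inner_neg_right, neg_neg]
  -- Products of two different imaginary units, here and in `o2`, come with opposite signs and add
  -- up to the commutator of `A (j + 1).succ` and `A (j + 2).succ`. The hypothesis `hB` exchanges it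
  -- for the derivative term `B j` and the commutator with `A 0`.
  have o1 : ∀ j : Fin 3, inner ℂ (e (j + 1) (A (j + 1).succ f)) (e (j + 2) (A (j + 2).succ g))
      = -inner ℂ f (e j (A (j + 1).succ (A (j + 2).succ g))) := fun j => by
    have := hmul (j + 1) (A (j + 2).succ g)
    rw [show j + 1 + 1 = j + 2 by omega, show j + 1 + 2 = j by omega] at this
    rw [h1, this, h1', ← hc]
  have o2 : ∀ j : Fin 3, inner ℂ (e (j + 2) (A (j + 2).succ f)) (e (j + 1) (A (j + 1).succ g))
      = inner ℂ f (e j (A (j + 2).succ (A (j + 1).succ g))) := fun j => by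
    have := hmul' (j + 1) (A (j + 1).succ g)
    rw [show j + 1 + 1 = j + 2 by omega, show j + 1 + 2 = j by omega] at this
    rw [h1, this, inner_neg_right, neg_neg, h1', ← hc]
  have c1 : ∀ j : Fin 3, inner ℂ (Complex.I • f' + A 0 f) (e j (A j.succ g))
      = -Complex.I * inner ℂ f' (e j (A j.succ g)) + inner ℂ f (e j (A 0 (A j.succ g))) :=
    fun j => by
      rw [inner_add_left, inner_smul_left, h1', ← hc, Complex.conj_I]
  have c2 : ∀ j : Fin 3, inner ℂ (e j (A j.succ f)) (Complex.I • g' + A 0 g)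
      = -Complex.I * inner ℂ f (e j (A j.succ g')) - inner ℂ f (e j (A j.succ (A 0 g))) :=
    fun j => by
      rw [h1, h1', ← hc, map_add, map_add, map_smul, map_smul, inner_add_right, inner_smul_right]
      ring
  have hB' : ∀ j, Complex.I * inner ℂ f (e j (B j g))
      + (inner ℂ f (e j (A 0 (A j.succ g))) - inner ℂ f (e j (A j.succ (A 0 g))))
      - (inner ℂ f (e j (A (j + 1).succ (A (j + 2).succ g)))
        - inner ℂ f (e j (A (j + 2).succ (A (j + 1).succ g)))) = 0 := fun j => by
    have := congrArg (fun x => inner ℂ f (e j x)) (hB j g)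
    simpa only [map_add, map_sub, map_smul, inner_add_right, inner_sub_right, inner_smul_right,
      map_zero, inner_zero_right] using this
  -- The zeroth components are made opaque, so that expanding the inner products leaves their mutual
  -- product intact.
  generalize hx : Complex.I • f' + A 0 f = x at *
  generalize hy : Complex.I • g' + A 0 g = y at *
  have e0 := hB' 0
  have e1 := hB' 1
  have e2 := hB' 2
  have p0 := o1 0
  have p1 := o1 1
  have p2 := o1 2
  have q0 := o2 0
  have q1 := o2 1
  have q2 := o2 2
  simp only [Fin.sum_univ_three, inner_add_left, inner_add_right, d, c1, c2]
  simp only [Fin.isValue, zero_add, show (1 : Fin 3) + 1 = 2 from rfl,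
    show (1 : Fin 3) + 2 = 0 from rfl, show (2 : Fin 3) + 1 = 0 from rfl,
    show (2 : Fin 3) + 2 = 1 from rfl] at *
  rw [p0, p1, p2, q0, q1, q2]
  linear_combination e0 + e1 + e2

/-- `A ↦ A ⊗ B`, as a linear map. -/
def mapLeft {S E : Type*} [NormedAddCommGroup S] [InnerProductSpace ℂ S]
    [FiniteDimensional ℂ S] [NormedAddCommGroup E] [InnerProductSpace ℂ E]
    [FiniteDimensional ℂ E] (B : E →L[ℂ] E) :
    (S →L[ℂ] S) →L[ℂ] (S ⊗[ℂ] E →L[ℂ] S ⊗[ℂ] E) :=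
  LinearMap.toContinuousLinearMap
    { toFun := fun A => TensorProduct.mapL A B
      map_add' := fun A A' => TensorProduct.mapL_add_left A A' B
      map_smul' := fun c A => TensorProduct.mapL_smul_left c A B }

namespace NahmData

variable {S E : Type*} [NormedAddCommGroup S] [InnerProductSpace ℂ S]
  [FiniteDimensional ℂ S] [NormedAddCommGroup E] [InnerProductSpace ℂ E]
  [FiniteDimensional ℂ E] {n : ℕ} {W : Fin n → Type*} [∀ α, NormedAddCommGroup (W α)]
  [∀ α, InnerProductSpace ℂ (W α)] [∀ α, FiniteDimensional ℂ (W α)]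
  (N : NahmData S E n W)

/-- The family `D_t` as a family of first order operators. -/
def system : FirstOrderSystem (S ⊗[ℂ] E) where
  breaks := N.marks
  isSparse := N.isSparse_marks
  coeff := N.symbol 0
  coeff_smooth := N.isPiecewiseSmooth_symbol 0
  param μ := TensorProduct.mapL (N.eMu μ) 1

theorem system_symbol (t : Fin 4 → ℝ) (s : ℝ) : N.system.symbol t s = N.symbol t s :=
  (N.symbol_affine t s).symm

theorem system_op (t : Fin 4 → ℝ) (f : ℝ → S ⊗[ℂ] E) : N.system.op t f = N.dirac t f := by
  funext s
  rw [dirac_eq, FirstOrderSystem.op, system_symbol]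
  rfl

theorem isRegular_system {t : Fin 4 → ℝ} (h : N.IsRegular t) : N.system.IsRegular t := by
  refine ⟨fun f hf h0 => h.1 f hf ?_, fun f hf h0 => h.2 f hf fun g hg => ?_⟩
  · rwa [← system_op]
  · rw [diracAdj, ← system_op]
    exact h0 g hg

theorem system_breaksWith (y : ℝ) : N.system.breaksWith y = N.marksWith y := rfl

/-- The covariant components `X_0 = i∇ + t_0`, `X_j = T_j + t_j` of `D_t = ∑ e_μ ⊗ X_μ`. -/
def cov (t : Fin 4 → ℝ) (μ : Fin 4) (f : ℝ → S ⊗[ℂ] E) (s : ℝ) : S ⊗[ℂ] E :=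
  (if μ = 0 then Complex.I • derivWithin f (Ici s) s else 0)
    + TensorProduct.mapL 1 (N.T μ s + (t μ : ℂ) • 1) (f s)

/-- `a ⊗ id`. -/
def spin (_ : NahmData S E n W) (a : S →L[ℂ] S) : S ⊗[ℂ] E →L[ℂ] S ⊗[ℂ] E :=
  TensorProduct.mapL a 1

theorem spin_mapL_apply (a b : S →L[ℂ] S) (A : E →L[ℂ] E) (x : S ⊗[ℂ] E) :
    N.spin a (TensorProduct.mapL b A x) = TensorProduct.mapL (a * b) A x := by
  have h := TensorProduct.mapL_mul a b (1 : E →L[ℂ] E) A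
  rw [one_mul] at h
  rw [h]
  rfl

theorem mapL_spin_apply (a b : S →L[ℂ] S) (A : E →L[ℂ] E) (x : S ⊗[ℂ] E) :
    TensorProduct.mapL b A (N.spin a x) = TensorProduct.mapL (b * a) A x := by
  have h := TensorProduct.mapL_mul b a A (1 : E →L[ℂ] E)
  rw [mul_one] at h
  rw [h]
  rfl

theorem spin_mul_apply (a b : S →L[ℂ] S) (x : S ⊗[ℂ] E) :
    N.spin a (N.spin b x) = N.spin (a * b) x := N.spin_mapL_apply a b 1 x

theorem spin_one_apply (x : S ⊗[ℂ] E) : N.spin 1 x = x := by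
  have h : TensorProduct.mapL (1 : S →L[ℂ] S) (1 : E →L[ℂ] E) = 1 := TensorProduct.mapL_id_id
  rw [spin, h]
  rfl

theorem spin_neg_apply (a : S →L[ℂ] S) (x : S ⊗[ℂ] E) : N.spin (-a) x = -N.spin a x := by
  exact congrArg (fun L => L x) (map_neg (mapLeft (1 : E →L[ℂ] E)) a)

theorem adj_spin (a : S →L[ℂ] S) : adj (N.spin a) = N.spin (adj a) := by
  rw [spin, spin, adj_mapL, adj_one]

theorem dirac_eq_sum_cov (t : Fin 4 → ℝ) (f : ℝ → S ⊗[ℂ] E) (s : ℝ) :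
    N.dirac t f s = ∑ μ, N.spin (N.eMu μ) (N.cov t μ f s) := by
  simp only [cov, map_add, Finset.sum_add_distrib, spin_mapL_apply, mul_one]
  rw [dirac_eq, symbol_eq_sum, sum_apply]
  congr 1
  rw [Finset.sum_eq_single 0 (fun μ _ hμ => by simp [hμ]) (by simp)]
  exact (N.spin_one_apply _).symm

end NahmData

theorem HasDerivWithinAt.complexClm_apply {X Y : Type*} [NormedAddCommGroup X] [NormedSpace ℂ X]
    [NormedAddCommGroup Y] [NormedSpace ℂ Y] {A : ℝ → X →L[ℂ] Y} {f : ℝ → X} {A' : X →L[ℂ] Y}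
    {f' : X} {s : Set ℝ} {x : ℝ} (hA : HasDerivWithinAt A A' s x)
    (hf : HasDerivWithinAt f f' s x) :
    HasDerivWithinAt (fun z => A z (f z)) (A' (f x) + A x f') s x :=
  ((ContinuousLinearMap.restrictScalarsL ℂ X Y ℝ ℝ).hasFDerivAt.comp_hasDerivWithinAt x
    hA).clm_apply hf

theorem HasDerivWithinAt.complexClm {X Y : Type*} [NormedAddCommGroup X] [NormedSpace ℂ X]
    [NormedAddCommGroup Y] [NormedSpace ℂ Y] (L : X →L[ℂ] Y) {f : ℝ → X}
    {f' : X} {s : Set ℝ} {x : ℝ} (hf : HasDerivWithinAt f f' s x) :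
    HasDerivWithinAt (fun z => L (f z)) (L f') s x :=
  (L.restrictScalars ℝ).hasFDerivAt.comp_hasDerivWithinAt x hf

theorem commutator_add_smul_one {R : Type*} [Ring R] [Algebra ℂ R] (a b : R) (x y : ℂ) :
    (a + x • 1) * (b + y • 1) - (b + y • 1) * (a + x • 1) = a * b - b * a := by
  simp only [add_mul, mul_add, smul_mul_assoc, mul_smul_comm, one_mul, mul_one, smul_add]
  rw [smul_comm x y]
  abel

theorem mul_inner_sub_inner {X : Type*} [NormedAddCommGroup X] [InnerProductSpace ℂ X] (c : ℂ)
    (x y z : X) : c * (inner ℂ x y - inner ℂ x z) = inner ℂ x (c • (y - z)) := by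
  rw [inner_smul_right, inner_sub_right]

theorem inner_adj_comp_sum {ι X Y : Type*} [NormedAddCommGroup X] [InnerProductSpace ℂ X]
    [FiniteDimensional ℂ X] [NormedAddCommGroup Y] [InnerProductSpace ℂ Y]
    [FiniteDimensional ℂ Y] {u : Finset ι} {Q : X →L[ℂ] Y} {A : ι → X →L[ℂ] X}
    (h : adj Q ∘L Q = ∑ i ∈ u, A i) (x y : X) :
    inner ℂ (Q x) (Q y) = ∑ i ∈ u, inner ℂ x (A i y) := by
  rw [← inner_sum, ← sum_apply, ← h]
  exact (adj_inner_right Q _ _).symm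

theorem tendsto_inner_clm_apply {X : Type*} [NormedAddCommGroup X] [InnerProductSpace ℂ X]
    {l : Filter ℝ} {f g : ℝ → X} {A : ℝ → X →L[ℂ] X} {x y : X} {B : X →L[ℂ] X}
    (hf : Tendsto f l (𝓝 x)) (hA : Tendsto A l (𝓝 B)) (hg : Tendsto g l (𝓝 y)) :
    Tendsto (fun s => (inner ℂ (f s) (A s (g s)) : ℂ)) l (𝓝 (inner ℂ x (B y))) :=
  hf.inner ((isBoundedBilinearMap_apply (𝕜 := ℂ).continuous.tendsto (B, y)).comp
    (hA.prodMk_nhds hg))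

namespace NahmData

variable {S E : Type*} [NormedAddCommGroup S] [InnerProductSpace ℂ S]
  [FiniteDimensional ℂ S] [NormedAddCommGroup E] [InnerProductSpace ℂ E]
  [FiniteDimensional ℂ E] {n : ℕ} {W : Fin n → Type*} [∀ α, NormedAddCommGroup (W α)]
  [∀ α, InnerProductSpace ℂ (W α)] [∀ α, FiniteDimensional ℂ (W α)]
  (N : NahmData S E n W)

/-- The densities whose derivatives are the cross terms of the Weitzenböck identity. -/
def crossTerm (t : Fin 4 → ℝ) (f g : ℝ → S ⊗[ℂ] E) (j : Fin 3) (s : ℝ) : ℂ :=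
  inner ℂ (f s) (TensorProduct.mapL (N.e j) (N.T j.succ s + (t j.succ : ℂ) • 1) (g s))

variable {N} {P : Set ℝ} {t : Fin 4 → ℝ} {f g : ℝ → S ⊗[ℂ] E}

theorem derivWithin_crossTerm (hP : IsSparse P) (hmP : N.marks ⊆ P) (hf : IsPiecewiseSmooth P f)
    (hg : IsPiecewiseSmooth P g) (j : Fin 3) (s : ℝ) :
    derivWithin (N.crossTerm t f g j) (Ici s) s
      = inner ℂ (derivWithin f (Ici s) s)
          (TensorProduct.mapL (N.e j) (N.T j.succ s + (t j.succ : ℂ) • 1) (g s))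
        + (inner ℂ (f s) (TensorProduct.mapL (N.e j) (derivWithin (N.T j.succ) (Ici s) s) (g s))
        + inner ℂ (f s) (TensorProduct.mapL (N.e j) (N.T j.succ s + (t j.succ : ℂ) • 1)
          (derivWithin g (Ici s) s))) := by
  have hT := ((N.T_piecewiseSmooth j.succ).mono hmP).exists_hasDerivWithinAt hP s
  have hT' : HasDerivWithinAt
      (fun s => TensorProduct.mapL (N.e j) (N.T j.succ s + (t j.succ : ℂ) • 1))
      (TensorProduct.mapL (N.e j) (derivWithin (N.T j.succ) (Ici s) s)) (Ici s) s :=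
    (HasDerivWithinAt.complexClm (X := E →L[ℂ] E) (Y := S ⊗[ℂ] E →L[ℂ] S ⊗[ℂ] E)
      (mapRight (N.e j)) (hT.add_const ((t j.succ : ℂ) • 1)))
  have h1 := HasDerivWithinAt.complexClm_apply hT' (hg.exists_hasDerivWithinAt hP s)
  have h2 := (hf.exists_hasDerivWithinAt hP s).inner ℂ h1
  rw [inner_add_right] at h2
  rw [add_comm]
  exact HasDerivWithinAt.derivWithin h2 (uniqueDiffWithinAt_Ici s)

/-- Off the break points the Nahm equations provide the commutator hypothesis of
`inner_dirac_expand`: the shifts by `t` are scalar and drop out of commutators. The remaining cross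
terms are total derivatives by the product rule. -/
theorem inner_dirac_dirac (hN : N.NahmEquations) (hP : IsSparse P) (hmP : N.marks ⊆ P)
    (hf : IsPiecewiseSmooth P f) (hg : IsPiecewiseSmooth P g) {s : ℝ} (hs : s ∉ P) :
    inner ℂ (N.dirac t f s) (N.dirac t g s) = ∑ μ, inner ℂ (N.cov t μ f s) (N.cov t μ g s)
      + ∑ j, -Complex.I * derivWithin (N.crossTerm t f g j) (Ici s) s := by
  have hsm : s ∉ N.marks := fun h => hs (hmP h)
  set A : Fin 4 → (S ⊗[ℂ] E →L[ℂ] S ⊗[ℂ] E) :=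
    fun μ => TensorProduct.mapL 1 (N.T μ s + (t μ : ℂ) • 1) with hAdef
  have hAA : ∀ μ ν x, A μ (A ν x) = TensorProduct.mapL 1
      ((N.T μ s + (t μ : ℂ) • 1) * (N.T ν s + (t ν : ℂ) • 1)) x := fun μ ν x => by
    rw [hAdef, ← mul_one (1 : S →L[ℂ] S), TensorProduct.mapL_mul, mul_one]
    rfl
  have key := inner_dirac_expand (e := fun j => N.spin (N.e j)) (A := A)
    (B := fun j => TensorProduct.mapL 1 (derivWithin (N.T j.succ) (Ici s) s))
    (fun j => by rw [adj_spin, N.e_adj]; ext x; exact N.spin_neg_apply _ x)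
    (fun j x => by rw [spin_mul_apply, N.e_sq, spin_neg_apply, spin_one_apply])
    (fun j x => by rw [spin_mul_apply, N.e_mul])
    (fun j x => by rw [spin_mul_apply, N.e_mul', spin_neg_apply])
    (fun μ => by rw [hAdef, adj_mapL, adj_one, N.adj_T_add])
    (fun j μ x => by rw [hAdef, spin_mapL_apply, mapL_spin_apply, one_mul, mul_one])
    (fun j x => by
      have h := hN.regular s hsm j
      have hd : derivWithin (N.T j.succ) (Ici s) s = deriv (N.T j.succ) s :=
        derivWithin_Ici_eq_deriv (((N.T_piecewiseSmooth j.succ).contDiffAt N.isSparse_marks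
          hsm).differentiableAt (by simp))
      rw [← hd] at h
      have h2 : Complex.I • derivWithin (N.T j.succ) (Ici s) s
        + ((N.T 0 s + (t 0 : ℂ) • 1) * (N.T j.succ s + (t j.succ : ℂ) • 1)
          - (N.T j.succ s + (t j.succ : ℂ) • 1) * (N.T 0 s + (t 0 : ℂ) • 1))
        - ((N.T (j + 1).succ s + (t (j + 1).succ : ℂ) • 1)
            * (N.T (j + 2).succ s + (t (j + 2).succ : ℂ) • 1)
          - (N.T (j + 2).succ s + (t (j + 2).succ : ℂ) • 1)
            * (N.T (j + 1).succ s + (t (j + 1).succ : ℂ) • 1)) = 0 := by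
        rw [← h]
        rw [commutator_add_smul_one, commutator_add_smul_one]
      simp only [hAA]
      have h3 := congrArg (fun B => mapRight (S := S) (1 : S →L[ℂ] S) B) h2
      simp only [map_add, map_sub, map_smul, map_zero] at h3
      exact congrArg (fun L => L x) h3)
    (f s) (derivWithin f (Ici s) s) (g s) (derivWithin g (Ici s) s)
  have e1 : ∀ h : ℝ → S ⊗[ℂ] E, N.dirac t h s = Complex.I • derivWithin h (Ici s) s + A 0 (h s)
      + ∑ j : Fin 3, N.spin (N.e j) (A j.succ (h s)) := fun h => by
    simp only [hAdef, spin_mapL_apply, mul_one]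
    rfl
  have c0 : ∀ h : ℝ → S ⊗[ℂ] E, N.cov t 0 h s
      = Complex.I • derivWithin h (Ici s) s + A 0 (h s) := fun h => by
    rw [cov, if_pos rfl]
  have cj : ∀ (h : ℝ → S ⊗[ℂ] E) (j : Fin 3), N.cov t j.succ h s = A j.succ (h s) := fun h j => by
    rw [cov, if_neg (Fin.succ_ne_zero j), zero_add]
  rw [e1, e1, key, Fin.sum_univ_succ (n := 3)]
  simp only [c0, cj, derivWithin_crossTerm hP hmP hf hg]
  simp only [hAdef, spin_mapL_apply, mul_one]

theorem isPiecewiseSmooth_cov (hmP : N.marks ⊆ P) (t : Fin 4 → ℝ) (μ : Fin 4)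
    (hf : IsPiecewiseSmooth P f) : IsPiecewiseSmooth P (N.cov t μ f) := by
  have h1 : IsPiecewiseSmooth P fun s => (if μ = 0 then Complex.I else 0) •
      derivWithin f (Ici s) s
      + TensorProduct.mapL 1 (N.T μ s + (t μ : ℂ) • 1) (f s) :=
    (hf.derivRight.const_smul _).add (((N.isPiecewiseSmooth_mapL 1 t μ).mono hmP).clm_apply hf)
  convert h1 using 1
  funext s
  by_cases h : μ = 0 <;> simp [cov, h]

theorem isPiecewiseSmooth_crossTerm (hmP : N.marks ⊆ P) (hf : IsPiecewiseSmooth P f)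
    (hg : IsPiecewiseSmooth P g) (j : Fin 3) : IsPiecewiseSmooth P (N.crossTerm t f g j) :=
  hf.innerProd (((N.isPiecewiseSmooth_mapL (N.e j) t j.succ).mono hmP).clm_apply hg)

/-- The form `⟨𝒟_t f, 𝒟_t g⟩`. -/
def weylForm (N : NahmData S E n W) (t : Fin 4 → ℝ) (f g : ℝ → S ⊗[ℂ] E) : ℂ :=
  l2Inner (N.dirac t f) (N.dirac t g) + inner ℂ (N.bdry f) (N.bdry g)

/-- The Weitzenböck formula. -/
theorem exists_weitzenboeck (hN : N.NahmEquations) : ∃ R : Fin n → E →L[ℂ] E,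
    ∀ (P : Set ℝ) (t : Fin 4 → ℝ) (f g : ℝ → S ⊗[ℂ] E), IsSparse P → N.marks ⊆ P →
      IsContPiecewiseSmooth P f → IsContPiecewiseSmooth P g →
      N.weylForm t f g = ∑ μ, l2Inner (N.cov t μ f) (N.cov t μ g)
        + ∑ α, inner ℂ (f (N.lam α)) (TensorProduct.mapL 1 (R α) (g (N.lam α))) := by
  choose R hR hR' using hN.singular
  choose L hL hJ using hR'
  refine ⟨fun α => R α 0, fun P t f g hP hmP hf hg => ?_⟩
  have hae : ∀ᵐ s ∂volume, s ∉ P := hP.countable.ae_notMem _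
  have hcr := fun j => isPiecewiseSmooth_crossTerm (t := t) hmP hf.1 hg.1 j
  have e1 : l2Inner (N.dirac t f) (N.dirac t g) = ∑ μ, l2Inner (N.cov t μ f) (N.cov t μ g)
      + ∑ j, -Complex.I * ∫ s in (0 : ℝ)..(2 * Real.pi),
        derivWithin (N.crossTerm t f g j) (Ici s) s := by
    have h1 : l2Inner (N.dirac t f) (N.dirac t g) = ∫ s in (0 : ℝ)..(2 * Real.pi),
        (∑ μ, inner ℂ (N.cov t μ f s) (N.cov t μ g s)
          + ∑ j, -Complex.I * derivWithin (N.crossTerm t f g j) (Ici s) s) := by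
      refine intervalIntegral.integral_congr_ae ?_
      filter_upwards [hae] with s hs _
      exact inner_dirac_dirac hN hP hmP hf.1 hg.1 hs
    have i1 : ∀ μ ∈ (Finset.univ : Finset (Fin 4)), IntervalIntegrable
        (fun s => (inner ℂ (N.cov t μ f s) (N.cov t μ g s) : ℂ)) volume 0 (2 * Real.pi) :=
      fun μ _ => ((isPiecewiseSmooth_cov hmP t μ hf.1).innerProd
        (isPiecewiseSmooth_cov hmP t μ hg.1)).intervalIntegrable hP _ _
    have i2 : ∀ j ∈ (Finset.univ : Finset (Fin 3)), IntervalIntegrable (fun s =>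
        -Complex.I * derivWithin (N.crossTerm t f g j) (Ici s) s) volume 0 (2 * Real.pi) :=
      fun j _ => ((hcr j).derivRight.intervalIntegrable hP _ _).const_mul _
    have i3 := IntervalIntegrable.sum _ i1
    have i4 := IntervalIntegrable.sum _ i2
    simp only [Finset.sum_fn] at i3 i4
    rw [h1, intervalIntegral.integral_add i3 i4, intervalIntegral.integral_finsetSum i1,
      intervalIntegral.integral_finsetSum i2]
    simp only [intervalIntegral.integral_const_mul]
    rfl
  -- Since `f` and `g` are continuous, the jump of the density at `λ_α` comes from the jump of `T_j`
  -- alone, and the boundary conditions express that jump by the component `R α j.succ` of `Q_α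
  -- Q_α†`.
  have e2 : ∀ j, -Complex.I * ∫ s in (0 : ℝ)..(2 * Real.pi),
      derivWithin (N.crossTerm t f g j) (Ici s) s
      = -∑ α, inner ℂ (f (N.lam α)) (TensorProduct.mapL (N.e j) (R α j.succ) (g (N.lam α))) := by
    intro j
    rw [integral_derivRight_eq_neg_sum_jumps N.lam_nonneg N.lam_lt N.lam_strictMono.injective hP
      (fun α => ?_) (hcr j) (fun s hs => ?_) (L := fun α => inner ℂ (f (N.lam α))
        (TensorProduct.mapL (N.e j) (L α j + (t j.succ : ℂ) • 1) (g (N.lam α)))) (fun α => ?_)]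
    · rw [mul_neg, Finset.mul_sum]
      congr 1
      refine Finset.sum_congr rfl fun α _ => ?_
      rw [crossTerm]
      refine (mul_inner_sub_inner (X := S ⊗[ℂ] E) _ _ _ _).trans ?_
      congr 1
      have h1 : R α j.succ = -Complex.I • ((N.T j.succ (N.lam α) + (t j.succ : ℂ) • 1)
          - (L α j + (t j.succ : ℂ) • 1)) := by
        rw [add_sub_add_right_eq_sub, neg_smul]
        exact (neg_eq_of_add_eq_zero_right (hJ α j)).symm
      rw [h1]
      have h2 := map_smul (mapRight (S := S) (N.e j)) (-Complex.I)
        ((N.T j.succ (N.lam α) + (t j.succ : ℂ) • 1) - (L α j + (t j.succ : ℂ) • 1))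
      rw [map_sub] at h2
      exact (congrArg (fun L => L (g (N.lam α))) h2).symm
    · exact fun x ⟨l, hl⟩ => hmP ⟨α, l, hl⟩
    · have h1 : ContinuousAt (N.T j.succ) s :=
        ((N.T_piecewiseSmooth j.succ).contDiffAt N.isSparse_marks hs).continuousAt
      have h2 : ContinuousAt
          (fun s => mapRight (S := S) (N.e j) (N.T j.succ s + (t j.succ : ℂ) • 1)) s :=
        (mapRight (S := S) (N.e j)).continuous.continuousAt.comp (h1.add continuousAt_const)
      exact tendsto_inner_clm_apply hf.2.continuousAt h2 hg.2.continuousAt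
    · have h2 : Tendsto (fun s => mapRight (S := S) (N.e j) (N.T j.succ s + (t j.succ : ℂ) • 1))
          (𝓝[<] N.lam α) (𝓝 (mapRight (S := S) (N.e j) (L α j + (t j.succ : ℂ) • 1))) :=
        ((mapRight (S := S) (N.e j)).continuous.tendsto _).comp ((hL α j).add_const _)
      exact tendsto_inner_clm_apply (hf.2.continuousAt.mono_left nhdsWithin_le_nhds) h2
        (hg.2.continuousAt.mono_left nhdsWithin_le_nhds)
  -- The components along the imaginary units cancel the jump terms `e2`, and the component along
  -- the identity is what remains.
  have e3 : (inner ℂ (N.bdry f) (N.bdry g) : ℂ) = ∑ α, ∑ μ,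
      inner ℂ (f (N.lam α)) (TensorProduct.mapL (N.eMu μ) (R α μ) (g (N.lam α))) := by
    rw [PiLp.inner_apply]
    refine Finset.sum_congr rfl fun α _ => ?_
    exact inner_adj_comp_sum (hR α) _ _
  rw [weylForm, e1, e3, add_assoc]
  congr 1
  simp only [e2, Fin.sum_univ_succ (n := 3), Finset.sum_add_distrib, Finset.sum_neg_distrib]
  rw [Finset.sum_comm (s := (Finset.univ : Finset (Fin n)))]
  change _ + (_ + ∑ j, ∑ α, inner ℂ _ (TensorProduct.mapL (N.e j) _ _)) = _
  rw [add_comm (∑ α, _), neg_add_cancel_left]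
  rfl

end NahmData

/-! ### Continuous piecewise smooth functions with unspecified break points -/

theorem IsPW.hasDerivWithinAt {V : Type*} [NormedAddCommGroup V] [NormedSpace ℝ V] {f : ℝ → V}
    (hf : IsPW f) (s : ℝ) : HasDerivWithinAt f (derivWithin f (Ici s) s) (Ici s) s := by
  obtain ⟨P, hP, hf⟩ := hf
  exact hf.exists_hasDerivWithinAt hP s

/-- Continuous piecewise smooth functions, for an unspecified sparse set of break points. -/
def IsCPW {V : Type*} [NormedAddCommGroup V] [NormedSpace ℝ V] (f : ℝ → V) : Prop :=
  IsPW f ∧ Continuous f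

theorem IsContPiecewiseSmooth.isCPW {V : Type*} [NormedAddCommGroup V] [NormedSpace ℝ V]
    {P : Set ℝ} {f : ℝ → V} (hP : IsSparse P) (hf : IsContPiecewiseSmooth P f) : IsCPW f :=
  ⟨⟨P, hP, hf.1⟩, hf.2⟩

section CPW

variable {V V' : Type*} [NormedAddCommGroup V] [InnerProductSpace ℂ V]
  [NormedAddCommGroup V'] [InnerProductSpace ℂ V'] {f g : ℝ → V}

theorem IsCPW.exists_sup (hf : IsCPW f) (hg : IsCPW g) {P₀ : Set ℝ} (hP₀ : IsSparse P₀) :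
    ∃ P, IsSparse P ∧ P₀ ⊆ P ∧ IsContPiecewiseSmooth P f ∧ IsContPiecewiseSmooth P g := by
  obtain ⟨⟨P, hP, hf⟩, hfc⟩ := hf
  obtain ⟨⟨P', hP', hg⟩, hgc⟩ := hg
  exact ⟨P₀ ∪ (P ∪ P'), hP₀.union (hP.union hP'), subset_union_left,
    ⟨hf.mono (subset_union_left.trans subset_union_right), hfc⟩,
    ⟨hg.mono (subset_union_right.trans subset_union_right), hgc⟩⟩

theorem IsCPW.sub (hf : IsCPW f) (hg : IsCPW g) : IsCPW fun s => f s - g s :=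
  ⟨hf.1.sub hg.1, hf.2.sub hg.2⟩

theorem IsCPW.sum {ι : Type*} {u : Finset ι} {f : ι → ℝ → V} (hf : ∀ i ∈ u, IsCPW (f i)) :
    IsCPW fun s => ∑ i ∈ u, f i s :=
  ⟨IsPW.sum fun i hi => (hf i hi).1, continuous_finsetSum u fun i hi => (hf i hi).2⟩

theorem IsCPW.clm (L : V →L[ℂ] V') (hf : IsCPW f) : IsCPW fun s => L (f s) :=
  ⟨hf.1.clm L, L.continuous.comp hf.2⟩

end CPW

namespace FirstOrderSystem

variable {X : Type*} [NormedAddCommGroup X] [InnerProductSpace ℂ X]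
  [FiniteDimensional ℂ X] {D : FirstOrderSystem X} {t : Fin 4 → ℝ} {f g : ℝ → X}

theorem isPW_op (t : Fin 4 → ℝ) (hf : IsPW f) : IsPW (D.op t f) := by
  obtain ⟨P, hP, hf⟩ := hf
  exact ⟨D.breaks ∪ P, D.isSparse.union hP,
    D.isPiecewiseSmooth_op subset_union_left t (hf.mono subset_union_right)⟩

theorem op_add (hf : IsPW f) (hg : IsPW g) :
    D.op t (fun s => f s + g s) = fun s => D.op t f s + D.op t g s := by
  funext s
  have h : derivWithin (fun s => f s + g s) (Ici s) s = _ :=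
    ((hf.hasDerivWithinAt s).add (hg.hasDerivWithinAt s)).derivWithin (uniqueDiffWithinAt_Ici s)
  simp only [op, h, smul_add, map_add]
  abel

theorem op_sub (hf : IsPW f) (hg : IsPW g) :
    D.op t (fun s => f s - g s) = fun s => D.op t f s - D.op t g s := by
  funext s
  have h : derivWithin (fun s => f s - g s) (Ici s) s = _ :=
    ((hf.hasDerivWithinAt s).sub (hg.hasDerivWithinAt s)).derivWithin (uniqueDiffWithinAt_Ici s)
  simp only [op, h, smul_sub, map_sub]
  abel

theorem op_zero : D.op t (fun _ => 0) = fun _ => 0 := by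
  funext s
  simp [op]

theorem op_sum {ι : Type*} {u : Finset ι} {f : ι → ℝ → X} (hf : ∀ i ∈ u, IsPW (f i)) :
    D.op t (fun s => ∑ i ∈ u, f i s) = fun s => ∑ i ∈ u, D.op t (f i) s := by
  classical
  induction u using Finset.induction_on with
  | empty => simpa using op_zero
  | insert i u hi ih =>
    have h1 : ∀ j ∈ u, IsPW (f j) := fun j hj => hf j (Finset.mem_insert_of_mem hj)
    simp only [Finset.sum_insert hi]
    rw [op_add (hf i (Finset.mem_insert_self i u)) (IsPW.sum h1), ih h1]

theorem l2Inner_adjKernel_op (h : D.IsRegular t) (y : ℝ) (u : X) (hg : IsCPW g) :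
    l2Inner (fun s => D.adjKernel t s y u) (D.op t g) = inner ℂ u (g y) := by
  obtain ⟨P, hP, hm, -, hg'⟩ := hg.exists_sup hg D.isSparse
  exact l2Inner_adjKernel h hP hm y u hg'

theorem isCPW_greenKernel (h : D.IsRegular t) (y : ℝ) (u : X) :
    IsCPW fun s => D.greenKernel t s y u := by
  have h1 := isContPiecewiseSmooth_greenKernel h y
  exact IsContPiecewiseSmooth.isCPW (isSparse_breaksWith y)
    ⟨h1.1.clm_apply (isPiecewiseSmooth_const u), h1.2.clm_apply continuous_const⟩

theorem isPW_adjKernel (y : ℝ) (u : X) : IsPW fun s => D.adjKernel t s y u :=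
  ⟨_, isSparse_breaksWith y,
    (isPiecewiseSmooth_adjKernel y).clm_apply (isPiecewiseSmooth_const u)⟩

theorem eq_zero_of_op_eq_zero' (h : D.IsRegular t) (hf : IsCPW f) (h0 : D.op t f = 0) :
    f = 0 := by
  obtain ⟨P, hP, -, hf', -⟩ := hf.exists_sup hf D.isSparse
  exact eq_zero_of_op_eq_zero h hP hf' h0

end FirstOrderSystem

/-! ### Smooth families of complex linear maps -/

section ComplexSmooth

variable {V₁ V₂ V₃ T : Type*} [NormedAddCommGroup V₁] [NormedSpace ℂ V₁]
  [NormedAddCommGroup V₂] [NormedSpace ℂ V₂] [NormedAddCommGroup V₃] [NormedSpace ℂ V₃]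
  [NormedAddCommGroup T] [NormedSpace ℝ T] {U : Set T}

theorem ContDiffOn.complexClm_comp {f : T → V₂ →L[ℂ] V₃} {g : T → V₁ →L[ℂ] V₂}
    (hf : ContDiffOn ℝ ∞ f U) (hg : ContDiffOn ℝ ∞ g U) :
    ContDiffOn ℝ ∞ (fun t => f t ∘L g t) U :=
  ((isBoundedBilinearMap_comp (𝕜 := ℂ) (E := V₁) (F := V₂) (G := V₃)).contDiff.restrict_scalars
    ℝ).comp_contDiffOn (hf.prodMk hg)

theorem ContDiffOn.complexClm_apply {f : T → V₂ →L[ℂ] V₃} {g : T → V₂}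
    (hf : ContDiffOn ℝ ∞ f U) (hg : ContDiffOn ℝ ∞ g U) :
    ContDiffOn ℝ ∞ (fun t => f t (g t)) U :=
  ((isBoundedBilinearMap_apply (𝕜 := ℂ) (E := V₂) (F := V₃)).contDiff.restrict_scalars
    ℝ).comp_contDiffOn (hf.prodMk hg)

end ComplexSmooth

section ToPiLp

variable {n : ℕ} {W : Fin n → Type*} [∀ α, NormedAddCommGroup (W α)]
  [∀ α, InnerProductSpace ℂ (W α)] {V : Type*} [NormedAddCommGroup V] [NormedSpace ℂ V]

/-- The inclusion of a summand of an orthogonal direct sum. -/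
def inclPiLp (W : Fin n → Type*) [∀ α, NormedAddCommGroup (W α)]
    [∀ α, InnerProductSpace ℂ (W α)] (α : Fin n) : W α →L[ℂ] PiLp 2 W :=
  (PiLp.continuousLinearEquiv 2 ℂ W).symm.toContinuousLinearMap ∘L
    ContinuousLinearMap.single ℂ W α

/-- A linear map into an orthogonal direct sum, from its components. -/
def toPiLp (A : ∀ α, V →L[ℂ] W α) : V →L[ℂ] PiLp 2 W := ∑ α, inclPiLp W α ∘L A α

theorem toPiLp_apply (A : ∀ α, V →L[ℂ] W α) (v : V) (β : Fin n) : toPiLp A v β = A β v := by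
  simp [toPiLp, inclPiLp]

theorem contDiffOn_toPiLp {T : Type*} [NormedAddCommGroup T] [NormedSpace ℝ T]
    {U : Set T} {A : ∀ α, T → V →L[ℂ] W α}
    (hA : ∀ α, ContDiffOn ℝ ∞ (A α) U) : ContDiffOn ℝ ∞ (fun t => toPiLp fun α => A α t) U :=
  ContDiffOn.sum fun α _ => ContDiffOn.complexClm_comp contDiffOn_const (hA α)

end ToPiLp

/-! ### The Weyl form: definiteness and spinor symmetry -/

namespace NahmData

variable {S E : Type*} [NormedAddCommGroup S] [InnerProductSpace ℂ S]
  [FiniteDimensional ℂ S] [NormedAddCommGroup E] [InnerProductSpace ℂ E]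
  [FiniteDimensional ℂ E] {n : ℕ} {W : Fin n → Type*} [∀ α, NormedAddCommGroup (W α)]
  [∀ α, InnerProductSpace ℂ (W α)] [∀ α, FiniteDimensional ℂ (W α)]
  {N : NahmData S E n W} {t : Fin 4 → ℝ} {f g k : ℝ → S ⊗[ℂ] E}

theorem isPW_dirac (t : Fin 4 → ℝ) (hf : IsPW f) : IsPW (N.dirac t f) := by
  rw [← system_op]
  exact FirstOrderSystem.isPW_op t hf

theorem dirac_sub (hf : IsPW f) (hg : IsPW g) :
    N.dirac t (fun s => f s - g s) = fun s => N.dirac t f s - N.dirac t g s := by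
  simp only [← system_op]
  exact FirstOrderSystem.op_sub hf hg

theorem dirac_sum {ι : Type*} {u : Finset ι} {f : ι → ℝ → S ⊗[ℂ] E}
    (hf : ∀ i ∈ u, IsPW (f i)) :
    N.dirac t (fun s => ∑ i ∈ u, f i s) = fun s => ∑ i ∈ u, N.dirac t (f i) s := by
  simp only [← system_op]
  exact FirstOrderSystem.op_sum hf

theorem bdry_sub (f g : ℝ → S ⊗[ℂ] E) :
    N.bdry (fun s => f s - g s) = N.bdry f - N.bdry g := by
  ext α
  simp [bdry]

theorem weylForm_sub_left (hf : IsPW f) (hg : IsPW g) (hk : IsPW k) :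
    N.weylForm t (fun s => f s - g s) k = N.weylForm t f k - N.weylForm t g k := by
  rw [weylForm, dirac_sub hf hg, bdry_sub, l2Inner_sub_left (isPW_dirac t hf) (isPW_dirac t hg)
    (isPW_dirac t hk), inner_sub_left, weylForm, weylForm]
  ring

theorem weylForm_conj (f g : ℝ → S ⊗[ℂ] E) :
    star (N.weylForm t f g) = N.weylForm t g f := by
  rw [weylForm, star_add, l2Inner_conj, weylForm]
  congr 1
  exact inner_conj_symm _ _

/-- The form `⟨𝒟_t f, 𝒟_t g⟩` is definite. -/
theorem eq_zero_of_weylForm_self (h : N.IsRegular t) (hf : IsCPW f) (h0 : N.weylForm t f f = 0) :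
    f = 0 := by
  have h1 := l2Inner_self_re_nonneg (N.dirac t f)
  have h2 : 0 ≤ (inner ℂ (N.bdry f) (N.bdry f) : ℂ).re := inner_self_nonneg (𝕜 := ℂ)
  have h3 := congrArg Complex.re h0
  rw [weylForm, Complex.add_re, Complex.zero_re] at h3
  -- Both terms of the form are nonnegative, so the first vanishes by itself, and the zero kernel of
  -- `D_t` is all that is needed.
  have h4 : (l2Inner (N.dirac t f) (N.dirac t f)).re = 0 := by linarith
  have h5 : l2Inner (N.dirac t f) (N.dirac t f) = 0 := by
    rw [l2Inner_self_eq_ofReal] at h4 ⊢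
    rw [Complex.ofReal_re] at h4
    rw [h4, Complex.ofReal_zero]
  obtain ⟨P, hP, hPf⟩ := isPW_dirac (N := N) t hf.1
  have h6 := eq_zero_of_l2Inner_self hP hPf h5
  rw [← system_op] at h6
  exact FirstOrderSystem.eq_zero_of_op_eq_zero' (isRegular_system N h) hf h6

theorem eq_of_weylForm_eq (h : N.IsRegular t) (hf : IsCPW f) (hg : IsCPW g)
    (hfg : N.weylForm t f (fun s => f s - g s) = N.weylForm t g (fun s => f s - g s)) :
    f = g := by
  have h1 := eq_zero_of_weylForm_self h (hf.sub hg) (by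
    rw [weylForm_sub_left hf.1 hg.1 (hf.sub hg).1, hfg, sub_self])
  funext s
  exact sub_eq_zero.1 (congrFun h1 s)

theorem cov_spin (hf : IsPW f) (a : S →L[ℂ] S) (μ : Fin 4) :
    N.cov t μ (fun s => N.spin a (f s)) = fun s => N.spin a (N.cov t μ f s) := by
  funext s
  have h : derivWithin (fun s => N.spin a (f s)) (Ici s) s = _ :=
    (HasDerivWithinAt.complexClm (N.spin a) (hf.hasDerivWithinAt s)).derivWithin
      (uniqueDiffWithinAt_Ici s)
  simp only [cov, h, map_add, spin_mapL_apply, mapL_spin_apply, one_mul, mul_one]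
  congr 1
  split_ifs
  · rw [map_smul]
    rfl
  · rw [map_zero]

theorem isPW_cov (t : Fin 4 → ℝ) (μ : Fin 4) (hf : IsPW f) : IsPW (N.cov t μ f) := by
  obtain ⟨P, hP, hf⟩ := hf
  exact ⟨N.marks ∪ P, N.isSparse_marks.union hP,
    isPiecewiseSmooth_cov subset_union_left t μ (hf.mono subset_union_right)⟩

/-- The endomorphisms of the spinor space act on the form `⟨𝒟_t f, 𝒟_t g⟩` by adjoints. -/
theorem weylForm_spin (hN : N.NahmEquations) (hf : IsCPW f) (hg : IsCPW g) (a : S →L[ℂ] S) :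
    N.weylForm t (fun s => N.spin a (f s)) g = N.weylForm t f fun s => N.spin (adj a) (g s) := by
  obtain ⟨R, hR⟩ := exists_weitzenboeck hN
  obtain ⟨P, hP, hm, hf', hg'⟩ := hf.exists_sup hg N.isSparse_marks
  have c : ∀ {h : ℝ → S ⊗[ℂ] E} (b : S →L[ℂ] S), IsContPiecewiseSmooth P h →
      IsContPiecewiseSmooth P fun s => N.spin b (h s) := fun b hh =>
    ⟨hh.1.clm _, (N.spin b).continuous.comp hh.2⟩
  -- In the Weitzenböck form all operators act on the factor `E` only, hence commute with `a`; this
  -- fails for `D_t` itself.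
  rw [hR P t _ _ hP hm (c a hf') hg', hR P t _ _ hP hm hf' (c (adj a) hg')]
  simp only [cov_spin hf.1, cov_spin hg.1, l2Inner_clm_left, adj_spin]
  congr 1
  refine Finset.sum_congr rfl fun α _ => ?_
  rw [← adj_inner_right, adj_spin, spin_mapL_apply, mapL_spin_apply, one_mul, mul_one]

/-! ### Construction of the Green's function -/

/-- The Green's functions of `D_t† D_t` with sources `𝐐 v`. -/
def sourceKernel (N : NahmData S E n W) (t : Fin 4 → ℝ) (s : ℝ) : PiLp 2 W →L[ℂ] S ⊗[ℂ] E :=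
  ∑ β, N.system.greenKernel t s (N.lam β) ∘L N.Q β ∘L PiLp.proj 2 W β

/-- `𝐐†` of a family of linear maps. -/
def bdryMap (N : NahmData S E n W) {V : Type*} [NormedAddCommGroup V] [NormedSpace ℂ V]
    (A : ℝ → V →L[ℂ] S ⊗[ℂ] E) : V →L[ℂ] PiLp 2 W :=
  toPiLp fun α => N.Qdag α ∘L A (N.lam α)

theorem bdryMap_apply {V : Type*} [NormedAddCommGroup V] [NormedSpace ℂ V]
    (A : ℝ → V →L[ℂ] S ⊗[ℂ] E) (v : V) : N.bdryMap A v = N.bdry fun s => A s v := by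
  ext α
  rw [bdryMap, toPiLp_apply]
  rfl

theorem sourceKernel_apply (t : Fin 4 → ℝ) (s : ℝ) (v : PiLp 2 W) : N.sourceKernel t s v
    = ∑ β, N.system.greenKernel t s (N.lam β) (N.Q β (v β)) := by
  simp [sourceKernel]

/-- The kernel of `(𝒟_t† 𝒟_t)⁻¹`. -/
def weylGreen (N : NahmData S E n W) (t : Fin 4 → ℝ) (s y : ℝ) : S ⊗[ℂ] E →L[ℂ] S ⊗[ℂ] E :=
  N.system.greenKernel t s y - N.sourceKernel t s ∘L
    Ring.inverse (1 + N.bdryMap (N.sourceKernel t)) ∘L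
      N.bdryMap fun s => N.system.greenKernel t s y

theorem isCPW_sourceKernel (h : N.IsRegular t) (v : PiLp 2 W) :
    IsCPW fun s => N.sourceKernel t s v := by
  simp only [sourceKernel_apply]
  exact IsCPW.sum fun β _ => FirstOrderSystem.isCPW_greenKernel (isRegular_system N h) _ _

theorem l2Inner_dirac_greenKernel (h : N.IsRegular t) (y : ℝ) (u : S ⊗[ℂ] E) (hg : IsCPW g) :
    l2Inner (N.dirac t fun s => N.system.greenKernel t s y u) (N.dirac t g)
      = inner ℂ u (g y) := by
  rw [← system_op, ← system_op, FirstOrderSystem.op_greenKernel]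
  exact FirstOrderSystem.l2Inner_adjKernel_op (isRegular_system N h) y u hg

theorem sum_inner_Q (v : PiLp 2 W) (g : ℝ → S ⊗[ℂ] E) :
    ∑ β, inner ℂ (N.Q β (v β)) (g (N.lam β)) = inner ℂ v (N.bdry g) := by
  rw [PiLp.inner_apply]
  exact Finset.sum_congr rfl fun β _ => adj_inner_left (N.Qdag β) (g (N.lam β)) (v β)

theorem l2Inner_dirac_sourceKernel (h : N.IsRegular t) (v : PiLp 2 W) (hg : IsCPW g) :
    l2Inner (N.dirac t fun s => N.sourceKernel t s v) (N.dirac t g) = inner ℂ v (N.bdry g) := by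
  simp only [sourceKernel_apply]
  have h1 := fun β => (FirstOrderSystem.isCPW_greenKernel (isRegular_system N h) (N.lam β)
    (N.Q β (v β))).1
  rw [dirac_sum fun β _ => h1 β, l2Inner_sum_left (isPW_dirac t hg.1)
    fun β _ => isPW_dirac t (h1 β), ← sum_inner_Q]
  exact Finset.sum_congr rfl fun β _ => l2Inner_dirac_greenKernel h _ _ hg

/-- The operator `𝐐† (D_t† D_t)⁻¹ 𝐐` is nonnegative: its quadratic form at `v` is the squared norm
of `D_t` applied to the section with source `𝐐 v`. Adding the identity makes it injective. -/
theorem isUnit_one_add_bdryMap (h : N.IsRegular t) :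
    IsUnit (1 + N.bdryMap (N.sourceKernel t)) := by
  refine isUnit_of_injective fun v hv => ?_
  have h1 : inner ℂ v (v + N.bdryMap (N.sourceKernel t) v) = (0 : ℂ) :=
    (congrArg (inner ℂ v) hv).trans (inner_zero_right v)
  rw [inner_add_right, bdryMap_apply,
    ← l2Inner_dirac_sourceKernel h v (isCPW_sourceKernel h v)] at h1
  have h2 := l2Inner_self_re_nonneg (N.dirac t fun s => N.sourceKernel t s v)
  have h3 := congrArg Complex.re h1
  rw [Complex.add_re, Complex.zero_re] at h3
  have h4 : 0 ≤ (inner ℂ v v : ℂ).re := inner_self_nonneg (𝕜 := ℂ)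
  have h5 : (inner ℂ v v : ℂ).re = 0 := by linarith
  exact (re_inner_self_nonpos (𝕜 := ℂ)).1 h5.le

theorem isContPiecewiseSmooth_weylGreen (h : N.IsRegular t) (y : ℝ) (u : S ⊗[ℂ] E) :
    IsContPiecewiseSmooth (N.marksWith y) fun s => N.weylGreen t s y u := by
  have h1 : ∀ y u, IsContPiecewiseSmooth (N.marksWith y)
      fun s => N.system.greenKernel t s y u := fun y u => by
    have h1 := FirstOrderSystem.isContPiecewiseSmooth_greenKernel (isRegular_system N h) y
    exact ⟨h1.1.clm_apply (isPiecewiseSmooth_const u), h1.2.clm_apply continuous_const⟩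
  have h2 : ∀ v, IsContPiecewiseSmooth (N.marksWith y) fun s => N.sourceKernel t s v := fun v => by
    simp only [sourceKernel_apply]
    have h3 : ∀ β, IsContPiecewiseSmooth (N.marksWith y)
        fun s => N.system.greenKernel t s (N.lam β) (N.Q β (v β)) := fun β => by
      have h4 := h1 (N.lam β) (N.Q β (v β))
      rw [marksWith_lam] at h4
      exact h4.mono (N.marks_subset_marksWith y)
    exact ⟨IsPiecewiseSmooth.sum _ fun β _ => (h3 β).1, continuous_finsetSum _ fun β _ => (h3 β).2⟩
  exact ⟨(h1 y u).1.sub (h2 _).1, (h1 y u).2.sub (h2 _).2⟩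

theorem isCPW_weylGreen (h : N.IsRegular t) (y : ℝ) (u : S ⊗[ℂ] E) :
    IsCPW fun s => N.weylGreen t s y u :=
  (isContPiecewiseSmooth_weylGreen h y u).isCPW (N.isSparse_marksWith y)

/-- Woodbury's formula for the finite rank perturbation `D_t† D_t + 𝐐 𝐐†`. The vector `v` is the one
for which the boundary term `⟨𝐐† f, 𝐐† g⟩` of the form equals `⟨v, 𝐐† g⟩`, the contribution of the
subtracted `sourceKernel`, so that only the point source at `y` remains. -/
theorem weylForm_weylGreen (h : N.IsRegular t) (y : ℝ) (u : S ⊗[ℂ] E) (hg : IsCPW g) :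
    N.weylForm t (fun s => N.weylGreen t s y u) g = inner ℂ u (g y) := by
  have h1 := FirstOrderSystem.isCPW_greenKernel (isRegular_system N h) y u
  set b := N.bdry (fun s => N.system.greenKernel t s y u) with hb
  set v := Ring.inverse (1 + N.bdryMap (N.sourceKernel t)) b with hv
  have h2 := isCPW_sourceKernel h v
  have h3 : v + N.bdry (fun s => N.sourceKernel t s v) = b := by
    have h4 := Ring.mul_inverse_cancel _ (isUnit_one_add_bdryMap h)
    have h5 := congrArg (fun L => L b) h4
    simpa [bdryMap_apply, ← hv] using h5
  have h6 : (fun s => N.weylGreen t s y u)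
      = fun s => N.system.greenKernel t s y u - N.sourceKernel t s v := by
    funext s
    rw [hv, hb, ← bdryMap_apply]
    rfl
  rw [h6, weylForm_sub_left h1.1 h2.1 hg.1, weylForm, weylForm, l2Inner_dirac_greenKernel h y u hg,
    l2Inner_dirac_sourceKernel h v hg, ← hb, ← h3, inner_add_left]
  ring

section Smooth

variable {U : Set (Fin 4 → ℝ)}

theorem contDiffOn_sourceKernel (h : ∀ t ∈ U, N.IsRegular t) (s : ℝ) :
    ContDiffOn ℝ ∞ (fun t => N.sourceKernel t s) U :=
  ContDiffOn.sum fun _ _ => ContDiffOn.complexClm_comp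
    (FirstOrderSystem.contDiffOn_greenKernel (fun t ht => isRegular_system N (h t ht)) _ _)
    contDiffOn_const

theorem contDiffOn_weylGreen (h : ∀ t ∈ U, N.IsRegular t) (s y : ℝ) :
    ContDiffOn ℝ ∞ (fun t => N.weylGreen t s y) U := by
  have h1 := fun s => FirstOrderSystem.contDiffOn_greenKernel
    (fun t ht => isRegular_system N (h t ht)) y s
  have h2 : ContDiffOn ℝ ∞ (fun t => N.bdryMap (N.sourceKernel t)) U :=
    contDiffOn_toPiLp fun α => ContDiffOn.complexClm_comp contDiffOn_const
      (contDiffOn_sourceKernel h _)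
  have h3 : ContDiffOn ℝ ∞ (fun t => N.bdryMap fun s => N.system.greenKernel t s y) U :=
    contDiffOn_toPiLp fun α => ContDiffOn.complexClm_comp contDiffOn_const (h1 _)
  exact (h1 s).sub (ContDiffOn.complexClm_comp (contDiffOn_sourceKernel h s)
    (ContDiffOn.complexClm_comp (contDiffOn_ringInverse (contDiffOn_const.add h2)
      fun t ht => isUnit_one_add_bdryMap (h t ht)) h3))

end Smooth

end NahmData

/-! ### The commutant of the endomorphisms of the spinor space -/

theorem clm_tensor_ext {S E V : Type*} [NormedAddCommGroup S] [InnerProductSpace ℂ S]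
    [NormedAddCommGroup E] [InnerProductSpace ℂ E] [NormedAddCommGroup V] [NormedSpace ℂ V]
    {A B : S ⊗[ℂ] E →L[ℂ] V} (h : ∀ x v, A (x ⊗ₜ v) = B (x ⊗ₜ v)) : A = B :=
  ContinuousLinearMap.coe_injective (TensorProduct.ext' h)

section Commutant

variable {S E : Type*} [NormedAddCommGroup S] [InnerProductSpace ℂ S]
  [FiniteDimensional ℂ S] [NormedAddCommGroup E] [InnerProductSpace ℂ E]
  [FiniteDimensional ℂ E]

/-- Contraction of the first tensor factor with the vector `x`. -/
def contract (x : S) : S ⊗[ℂ] E →L[ℂ] E :=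
  LinearMap.toContinuousLinearMap
    (TensorProduct.lift ((LinearMap.lsmul ℂ E).comp (innerSL ℂ x).toLinearMap))

theorem contract_tmul (x y : S) (v : E) : contract x (y ⊗ₜ v) = inner ℂ x y • v := rfl

/-- `v ↦ x ⊗ v`. -/
def tmulLeft (x : S) : E →L[ℂ] S ⊗[ℂ] E :=
  LinearMap.toContinuousLinearMap (TensorProduct.mk ℂ S E x)

/-- The component `B` of an endomorphism `1 ⊗ B`. -/
def reduce (x : S) (M : S ⊗[ℂ] E →L[ℂ] S ⊗[ℂ] E) : E →L[ℂ] E :=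
  contract x ∘L M ∘L tmulLeft x

theorem reduce_mapL {x : S} (hx : ‖x‖ = 1) (B : E →L[ℂ] E) :
    reduce x (TensorProduct.mapL 1 B) = B := by
  ext v
  have h : TensorProduct.mapL (1 : S →L[ℂ] S) B (x ⊗ₜ v) = x ⊗ₜ B v := rfl
  change contract x (TensorProduct.mapL 1 B (x ⊗ₜ v)) = _
  rw [h, contract_tmul, inner_self_eq_norm_sq_to_K, hx]
  simp

theorem mapL_smulRight_apply (x y : S) (z : S ⊗[ℂ] E) :
    TensorProduct.mapL ((innerSL ℂ x).smulRight y) (1 : E →L[ℂ] E) z = y ⊗ₜ contract x z := by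
  have h : TensorProduct.mapL ((innerSL ℂ x).smulRight y) (1 : E →L[ℂ] E)
      = tmulLeft y ∘L contract x := by
    refine clm_tensor_ext fun a v => ?_
    change (inner ℂ x a • y) ⊗ₜ[ℂ] v = y ⊗ₜ[ℂ] (inner ℂ x a • v)
    rw [TensorProduct.smul_tmul]
  rw [h]
  rfl

/-- An endomorphism which commutes with all `a ⊗ 1` is of the form `1 ⊗ B`. -/
theorem mapL_reduce {x : S} (hx : ‖x‖ = 1) {M : S ⊗[ℂ] E →L[ℂ] S ⊗[ℂ] E}
    (hM : ∀ (a : S →L[ℂ] S) z,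
      M (TensorProduct.mapL a (1 : E →L[ℂ] E) z) = TensorProduct.mapL a 1 (M z)) :
    TensorProduct.mapL 1 (reduce x M) = M := by
  refine clm_tensor_ext fun y v => ?_
  -- The rank one endomorphism with image `y` carries the unit vector `x` to `y`, so commutation
  -- determines `M (y ⊗ v)` from the `x`-component of `M (x ⊗ v)`.
  have h1 : TensorProduct.mapL ((innerSL ℂ x).smulRight y) (1 : E →L[ℂ] E) (x ⊗ₜ v)
      = y ⊗ₜ v := by
    rw [mapL_smulRight_apply, contract_tmul, inner_self_eq_norm_sq_to_K, hx]
    simp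
  have h2 := hM ((innerSL ℂ x).smulRight y) (x ⊗ₜ v)
  rw [h1, mapL_smulRight_apply] at h2
  exact h2.symm

end Commutant

/-! ### Existence, uniqueness and smoothness of the scalar Green's function -/

namespace NahmData

variable {S E : Type*} [NormedAddCommGroup S] [InnerProductSpace ℂ S]
  [FiniteDimensional ℂ S] [NormedAddCommGroup E] [InnerProductSpace ℂ E]
  [FiniteDimensional ℂ E] {n : ℕ} {W : Fin n → Type*} [∀ α, NormedAddCommGroup (W α)]
  [∀ α, InnerProductSpace ℂ (W α)] [∀ α, FiniteDimensional ℂ (W α)]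
  {N : NahmData S E n W} {t : Fin 4 → ℝ}

theorem exists_unit_spinor (N : NahmData S E n W) : ∃ x : S, ‖x‖ = 1 := by
  have : Nontrivial S := Module.nontrivial_of_finrank_pos (R := ℂ) (by
    rw [N.finrank_spinor]; norm_num)
  exact exists_norm_eq S zero_le_one

/-- A unit spinor. -/
def unitSpinor (N : NahmData S E n W) : S := N.exists_unit_spinor.choose

theorem norm_unitSpinor (N : NahmData S E n W) : ‖N.unitSpinor‖ = 1 := N.exists_unit_spinor.choose_spec

/-- The Green's function of `𝒟_t† 𝒟_t`, without the spinor factor. -/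
def green (N : NahmData S E n W) (t : Fin 4 → ℝ) (s y : ℝ) : E →L[ℂ] E :=
  reduce N.unitSpinor (N.weylGreen t s y)

/-- Both sides have the same form against test sections, because `weylForm_spin` moves `a` to the
other argument; definiteness of the form makes them equal. By `mapL_reduce` the Green's function
then has no spinor part. -/
theorem weylGreen_spin (hN : N.NahmEquations) (h : N.IsRegular t) (s y : ℝ) (a : S →L[ℂ] S)
    (u : S ⊗[ℂ] E) : N.weylGreen t s y (N.spin a u) = N.spin a (N.weylGreen t s y u) := by
  have h1 := isCPW_weylGreen h y (N.spin a u)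
  have h2 := isCPW_weylGreen h y u
  have h3 : (fun s => N.weylGreen t s y (N.spin a u))
      = fun s => N.spin a (N.weylGreen t s y u) := by
    have h4 := h1.sub (h2.clm (N.spin a))
    refine eq_of_weylForm_eq h h1 (h2.clm (N.spin a)) ?_
    rw [weylForm_weylGreen h y _ h4, weylForm_spin hN h2 h4,
      weylForm_weylGreen h y u (h4.clm _), ← adj_spin, adj_inner_right]
  exact congrFun h3 s

theorem mapL_green (hN : N.NahmEquations) (h : N.IsRegular t) (s y : ℝ) :
    TensorProduct.mapL 1 (N.green t s y) = N.weylGreen t s y :=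
  mapL_reduce N.norm_unitSpinor fun a z => weylGreen_spin hN h s y a z

theorem isGreen_green (hN : N.NahmEquations) (h : N.IsRegular t) : N.IsGreen t (N.green t) := by
  intro y u
  simp only [mapL_green hN h]
  exact ⟨isContPiecewiseSmooth_weylGreen h y u,
    fun g hg => weylForm_weylGreen h y u (hg.isCPW (N.isSparse_marksWith y))⟩

/-- The difference of two Green's functions with the same source is itself an admissible test
section, and the form is definite. Contraction with a unit spinor recovers `F` from `id ⊗ F`. -/
theorem IsGreen.eq_green (hN : N.NahmEquations) (h : N.IsRegular t)
    {F : ℝ → ℝ → E →L[ℂ] E} (hF : N.IsGreen t F) : F = N.green t := by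
  funext s y
  have h0 : ∀ u, (fun s => TensorProduct.mapL (1 : S →L[ℂ] S) (F s y) u)
      = fun s => TensorProduct.mapL (1 : S →L[ℂ] S) (N.green t s y) u := fun u => by
    obtain ⟨h1, h2⟩ := hF y u
    obtain ⟨h3, h4⟩ := isGreen_green (N := N) hN h y u
    have h5 : IsContPiecewiseSmooth (N.marksWith y) fun s =>
        TensorProduct.mapL (1 : S →L[ℂ] S) (F s y) u
          - TensorProduct.mapL (1 : S →L[ℂ] S) (N.green t s y) u :=
      ⟨h1.1.sub h3.1, h1.2.sub h3.2⟩
    exact eq_of_weylForm_eq h (h1.isCPW (N.isSparse_marksWith y))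
      (h3.isCPW (N.isSparse_marksWith y)) ((h2 _ h5).trans (h4 _ h5).symm)
  rw [← reduce_mapL N.norm_unitSpinor (F s y), ← reduce_mapL N.norm_unitSpinor (N.green t s y)]
  congr 1
  ext u
  exact congrFun (h0 u) s

theorem contDiffOn_green {U : Set (Fin 4 → ℝ)} (h : ∀ t ∈ U, N.IsRegular t) (s y : ℝ) :
    ContDiffOn ℝ ∞ (fun t => N.green t s y) U :=
  ContDiffOn.complexClm_comp contDiffOn_const
    (ContDiffOn.complexClm_comp (contDiffOn_weylGreen h s y) contDiffOn_const)

end NahmData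

namespace NahmData

variable {S E : Type*} [NormedAddCommGroup S] [InnerProductSpace ℂ S]
  [FiniteDimensional ℂ S] [NormedAddCommGroup E] [InnerProductSpace ℂ E]
  [FiniteDimensional ℂ E] {n : ℕ} {W : Fin n → Type*} [∀ α, NormedAddCommGroup (W α)]
  [∀ α, InnerProductSpace ℂ (W α)] [∀ α, FiniteDimensional ℂ (W α)]
  {N : NahmData S E n W} {t : Fin 4 → ℝ} {g : ℝ → S ⊗[ℂ] E}

/-! ### The kernel of `𝒟_t†` -/

/-- The solutions of `𝒟_t† 𝒟_t f = 𝐐 v`. -/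
def weylSource (N : NahmData S E n W) (t : Fin 4 → ℝ) (s : ℝ) : PiLp 2 W →L[ℂ] S ⊗[ℂ] E :=
  ∑ α, N.weylGreen t s (N.lam α) ∘L N.Q α ∘L PiLp.proj 2 W α

/-- `id - 𝐐† 𝐅 𝐐`. -/
def gram (N : NahmData S E n W) (t : Fin 4 → ℝ) : PiLp 2 W →L[ℂ] PiLp 2 W :=
  1 - N.bdryMap (N.weylSource t)

/-- The solutions of `D_t† f = -𝐐 x`. -/
def kerFst (N : NahmData S E n W) (t : Fin 4 → ℝ) (s : ℝ) : PiLp 2 W →L[ℂ] S ⊗[ℂ] E :=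
  -∑ α, N.system.adjKernel t s (N.lam α) ∘L N.Q α ∘L PiLp.proj 2 W α

/-- The elements of `ker 𝒟_t†`, in terms of their second components. -/
def kerPair (N : NahmData S E n W) (t : Fin 4 → ℝ) (x : PiLp 2 W) :
    (ℝ → S ⊗[ℂ] E) × PiLp 2 W :=
  (fun s => N.kerFst t s x, x)

theorem weylSource_apply (t : Fin 4 → ℝ) (s : ℝ) (v : PiLp 2 W) : N.weylSource t s v
    = ∑ α, N.weylGreen t s (N.lam α) (N.Q α (v α)) := by
  simp [weylSource]

theorem kerFst_apply (t : Fin 4 → ℝ) (s : ℝ) (x : PiLp 2 W) : N.kerFst t s x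
    = -∑ α, N.system.adjKernel t s (N.lam α) (N.Q α (x α)) := by
  simp [kerFst]

theorem gram_apply (v : PiLp 2 W) :
    N.gram t v = v - N.bdry fun s => N.weylSource t s v := by
  rw [← bdryMap_apply]
  rfl

theorem isContPiecewiseSmooth_weylSource (h : N.IsRegular t) (v : PiLp 2 W) :
    IsContPiecewiseSmooth N.marks fun s => N.weylSource t s v := by
  simp only [weylSource_apply]
  have h3 : ∀ α, IsContPiecewiseSmooth N.marks
      fun s => N.weylGreen t s (N.lam α) (N.Q α (v α)) := fun α => by
    have h4 := isContPiecewiseSmooth_weylGreen h (N.lam α) (N.Q α (v α))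
    rwa [marksWith_lam] at h4
  exact ⟨IsPiecewiseSmooth.sum _ fun α _ => (h3 α).1, continuous_finsetSum _ fun α _ => (h3 α).2⟩

theorem isCPW_weylSource (h : N.IsRegular t) (v : PiLp 2 W) :
    IsCPW fun s => N.weylSource t s v :=
  (isContPiecewiseSmooth_weylSource h v).isCPW N.isSparse_marks

theorem isPiecewiseSmooth_kerFst (x : PiLp 2 W) :
    IsPiecewiseSmooth N.marks fun s => N.kerFst t s x := by
  simp only [kerFst_apply]
  refine (IsPiecewiseSmooth.sum _ fun α _ => ?_).neg
  have h1 := FirstOrderSystem.isPiecewiseSmooth_adjKernel (D := N.system) (t := t) (N.lam α)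
  rw [system_breaksWith, marksWith_lam] at h1
  exact h1.clm_apply (isPiecewiseSmooth_const _)

theorem isPW_kerFst (x : PiLp 2 W) : IsPW fun s => N.kerFst t s x :=
  ⟨_, N.isSparse_marks, isPiecewiseSmooth_kerFst x⟩

theorem bdry_sum {ι : Type*} (u : Finset ι) (f : ι → ℝ → S ⊗[ℂ] E) :
    N.bdry (fun s => ∑ i ∈ u, f i s) = ∑ i ∈ u, N.bdry (f i) := by
  ext α
  simp [bdry]

theorem weylForm_weylSource (h : N.IsRegular t) (v : PiLp 2 W) (hg : IsCPW g) :
    N.weylForm t (fun s => N.weylSource t s v) g = inner ℂ v (N.bdry g) := by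
  simp only [weylSource_apply]
  have h1 := fun α => isCPW_weylGreen h (N.lam α) (N.Q α (v α))
  rw [weylForm, dirac_sum fun α _ => (h1 α).1, bdry_sum, sum_inner,
    l2Inner_sum_left (isPW_dirac t hg.1) fun α _ => isPW_dirac t (h1 α).1,
    ← Finset.sum_add_distrib, ← sum_inner_Q]
  exact Finset.sum_congr rfl fun α _ => weylForm_weylGreen h _ _ hg

theorem l2Inner_kerFst_dirac (h : N.IsRegular t) (x : PiLp 2 W) (hg : IsCPW g) :
    l2Inner (fun s => N.kerFst t s x) (N.dirac t g) = -inner ℂ x (N.bdry g) := by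
  simp only [kerFst_apply]
  rw [l2Inner_neg_left, l2Inner_sum_left (isPW_dirac t hg.1)
    fun α _ => FirstOrderSystem.isPW_adjKernel _ _, ← sum_inner_Q, ← system_op]
  congr 1
  exact Finset.sum_congr rfl fun α _ =>
    FirstOrderSystem.l2Inner_adjKernel_op (isRegular_system N h) _ _ hg

theorem kerPair_mem_weylKer (h : N.IsRegular t) (x : PiLp 2 W) : N.kerPair t x ∈ N.weylKer t := by
  refine ⟨isPiecewiseSmooth_kerFst x, fun g hg => ?_⟩
  rw [weylAdj, diracAdj, kerPair, l2Inner_kerFst_dirac h x (hg.isCPW N.isSparse_marks)]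
  exact neg_add_cancel _

/-- Elements with the same second component differ by a section in the kernel of `D_t†`, which is
zero. So the kernel is parametrized by `W_Λ`, and questions about it become questions about vectors
there. -/
theorem eq_kerPair (h : N.IsRegular t) {p : (ℝ → S ⊗[ℂ] E) × PiLp 2 W}
    (hp : p ∈ N.weylKer t) : p = N.kerPair t p.2 := by
  refine Prod.ext ?_ rfl
  have h1 := h.2 (fun s => p.1 s - N.kerFst t s p.2)
    (hp.1.sub (isPiecewiseSmooth_kerFst p.2)) fun g hg => by
      have hg' := hg.isCPW N.isSparse_marks
      have h2 := hp.2 g hg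
      rw [weylAdj, diracAdj] at h2
      rw [diracAdj, l2Inner_sub_left ⟨_, N.isSparse_marks, hp.1⟩ (isPW_kerFst _)
        (isPW_dirac t hg'.1), l2Inner_kerFst_dirac h _ hg', sub_neg_eq_add, h2]
  funext s
  exact sub_eq_zero.1 (congrFun h1 s)

/-- With `f = (𝒟_t† 𝒟_t)⁻¹ 𝐐 v` one has `𝒟_t† (𝒟_t f) = 𝐐 v = 𝒟_t† (0, v)`, so the kernel contains
`(0, v) - 𝒟_t f`. -/
theorem neg_dirac_weylSource_mem (h : N.IsRegular t) (v : PiLp 2 W) :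
    ((fun s => -N.dirac t (fun s => N.weylSource t s v) s, N.gram t v) :
      (ℝ → S ⊗[ℂ] E) × PiLp 2 W) ∈ N.weylKer t := by
  have hv := isContPiecewiseSmooth_weylSource h v
  refine ⟨(isPiecewiseSmooth_dirac N subset_rfl t hv.1).neg, fun g hg => ?_⟩
  have h1 := weylForm_weylSource h v (hg.isCPW N.isSparse_marks)
  rw [weylForm] at h1
  rw [weylAdj, diracAdj, l2Inner_neg_left, gram_apply, inner_sub_left, ← h1]
  ring

theorem kerFst_gram (h : N.IsRegular t) (v : PiLp 2 W) (s : ℝ) :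
    N.kerFst t s (N.gram t v) = -N.dirac t (fun s => N.weylSource t s v) s :=
  (congrFun (congrArg Prod.fst (eq_kerPair h (neg_dirac_weylSource_mem h v))) s).symm

/-- The element over `gram v` is `(0, v) - 𝒟_t f`, and `𝒟_t f` is orthogonal to the kernel. Hence
the metric of the kernel, carried over to `W_Λ`, is the inverse of `gram`; positivity, the isometry
criterion and the orthogonal projection all rest on this. -/
theorem pairInner_kerPair_gram (h : N.IsRegular t) (x v : PiLp 2 W) :
    pairInner (N.kerPair t x) (N.kerPair t (N.gram t v)) = inner ℂ x v := by
  rw [pairInner, kerPair, kerPair]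
  simp only [kerFst_gram h]
  rw [l2Inner_neg_right, l2Inner_kerFst_dirac h x (isCPW_weylSource h v), gram_apply,
    inner_sub_right]
  ring

theorem pairInner_conj (p q : (ℝ → S ⊗[ℂ] E) × PiLp 2 W) :
    star (pairInner p q) = pairInner q p := by
  rw [pairInner, star_add, l2Inner_conj, pairInner]
  congr 1
  exact inner_conj_symm _ _

theorem pairInner_self_re_nonneg (p : (ℝ → S ⊗[ℂ] E) × PiLp 2 W) : 0 ≤ (pairInner p p).re := by
  rw [pairInner, Complex.add_re]
  exact add_nonneg (l2Inner_self_re_nonneg _) (inner_self_nonneg (𝕜 := ℂ))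

theorem gram_isPositive (h : N.IsRegular t) : (N.gram t).toLinearMap.IsPositive := by
  refine ⟨fun v w => ?_, fun v => ?_⟩
  · change inner ℂ (N.gram t v) w = inner ℂ v (N.gram t w)
    rw [← pairInner_kerPair_gram h, ← pairInner_conj, pairInner_kerPair_gram h]
    exact inner_conj_symm _ _
  · change 0 ≤ (inner ℂ (N.gram t v) v : ℂ).re
    rw [← pairInner_kerPair_gram h]
    exact pairInner_self_re_nonneg _

theorem isUnit_gram (h : N.IsRegular t) : IsUnit (N.gram t) := by
  refine isUnit_of_injective fun v hv => ?_
  have h1 := pairInner_kerPair_gram h v v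
  rw [hv, pairInner, kerPair, kerPair, inner_zero_right] at h1
  simp only [map_zero, l2Inner_zero_right, add_zero] at h1
  exact inner_self_eq_zero.1 h1.symm

theorem chiGram_green (hN : N.NahmEquations) (h : N.IsRegular t) :
    N.chiGram (N.green t) = N.gram t := by
  ext v β
  rw [gram_apply, chiGram, sub_apply, PiLp.sub_apply, PiLp.sub_apply, sandwich_apply]
  simp only [mapL_green hN h]
  rw [one_apply_eq_self, bdry]
  simp [weylSource_apply]

/-! ### Isometric trivializations -/

variable {V : Type*} [NormedAddCommGroup V] [InnerProductSpace ℂ V] [FiniteDimensional ℂ V]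
  {U : Set (Fin 4 → ℝ)} {ψ ψ' : (Fin 4 → ℝ) → V →ₗ[ℂ] (ℝ → S ⊗[ℂ] E)}
  {χ : (Fin 4 → ℝ) → V →L[ℂ] PiLp 2 W}

theorem IsFrame.eq_kerPair (hF : N.IsFrame U ψ χ) (ht : t ∈ U) (h : N.IsRegular t) (w : V) :
    (ψ t w, χ t w) = N.kerPair t (χ t w) :=
  NahmData.eq_kerPair h (hF.mem_ker t ht w)

theorem IsFrame.fst_eq (hF : N.IsFrame U ψ χ) (ht : t ∈ U) (h : N.IsRegular t) (w : V) :
    ψ t w = fun s => N.kerFst t s (χ t w) :=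
  congrArg Prod.fst (hF.eq_kerPair ht h w)

theorem IsFrame.eqOn (hreg : ∀ t ∈ U, N.IsRegular t) (hF : N.IsFrame U ψ χ)
    (hF' : N.IsFrame U ψ' χ) : EqOn ψ ψ' U := fun t ht =>
  LinearMap.ext fun w => (hF.fst_eq ht (hreg t ht) w).trans (hF'.fst_eq ht (hreg t ht) w).symm

theorem IsFrame.bijective (hF : N.IsFrame U ψ χ) (ht : t ∈ U) (h : N.IsRegular t) :
    Function.Bijective (χ t) := by
  refine ⟨(injective_iff_map_eq_zero _).2 fun w hw => ?_, fun x => ?_⟩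
  · have h1 := hF.isometry t ht w w
    rw [hF.eq_kerPair ht h, hw, pairInner, kerPair] at h1
    simp only [map_zero, l2Inner_zero_right, inner_zero_right, add_zero] at h1
    exact inner_self_eq_zero.1 h1.symm
  · obtain ⟨w, hw⟩ := hF.surj t ht _ (kerPair_mem_weylKer h x)
    exact ⟨w, congrArg Prod.snd hw⟩

theorem isInvertible_of_bijective {V₁ V₂ : Type*} [NormedAddCommGroup V₁] [NormedSpace ℂ V₁]
    [FiniteDimensional ℂ V₁] [NormedAddCommGroup V₂] [NormedSpace ℂ V₂]
    {A : V₁ →L[ℂ] V₂} (h : Function.Bijective A) : A.IsInvertible :=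
  ⟨(LinearEquiv.ofBijective A.toLinearMap h).toContinuousLinearEquiv, rfl⟩

/-- Choose `w` with `χ w = gram v`. Then `⟨w', χ† v⟩ = ⟨χ w', v⟩` is the product of the kernel
elements over `χ w'` and `gram v`, which by isometry equals `⟨w', w⟩`. Hence `χ† v = w`. -/
theorem IsFrame.comp_adj (hF : N.IsFrame U ψ χ) (ht : t ∈ U) (h : N.IsRegular t) :
    χ t ∘L adj (χ t) = N.gram t := by
  ext1 v
  obtain ⟨w, hw⟩ := (hF.bijective ht h).2 (N.gram t v)
  have h1 : adj (χ t) v = w := by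
    refine ext_inner_left ℂ fun w' => ?_
    rw [adj_inner_right, ← pairInner_kerPair_gram h, ← hF.isometry t ht, hF.eq_kerPair ht h,
      hF.eq_kerPair ht h, hw]
  rw [ContinuousLinearMap.comp_apply, h1, hw]

end NahmData

/-! ### Joint smoothness of the kernel and construction of trivializations -/

/-- The kernel of `(D_t†)⁻¹` is smooth in `(t, s)`, up to the boundary between break points. -/
theorem FirstOrderSystem.exists_contDiffOn_adjKernel {X : Type*} [NormedAddCommGroup X]
    [InnerProductSpace ℂ X] [FiniteDimensional ℂ X] {D : FirstOrderSystem X}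
    {U : Set (Fin 4 → ℝ)} (h : ∀ t ∈ U, D.IsRegular t) (y : ℝ) {a b : ℝ} (hab : a < b)
    (hd : Disjoint (Ioo a b) (D.breaksWith y)) :
    ∃ g : (Fin 4 → ℝ) × ℝ → X →L[ℂ] X, ContDiffOn ℝ ∞ g (U ×ˢ Icc a b) ∧
      ∀ t ∈ U, ∀ s ∈ Ico a b, D.adjKernel t s y = g (t, s) := by
  obtain ⟨A', hA', hE⟩ := (D.coeff_smooth.adj.const_smul Complex.I).2 a b hab
    (hd.mono_right (FirstOrderSystem.breaks_subset y))
  -- On an interval without break points the kernel is its value at `a`, smooth in `t`, transported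
  -- by the propagator from `a`, jointly smooth in `(t, s)`.
  refine ⟨fun p => IccExtend hab.le (solve hab.le D.isBoundedMeasurable_adj_coeff
    (fun μ => Complex.I • adj (D.param μ)) p.1 1) p.2 * D.adjKernel p.1 a y, ?_, ?_⟩
  · have h1 := (contDiffOn_solve_one hab D.isBoundedMeasurable_adj_coeff
      (fun μ => Complex.I • adj (D.param μ)) hA' hE).mono (prod_mono_left (subset_univ U))
    have h2 : ContDiffOn ℝ ∞ (fun p : (Fin 4 → ℝ) × ℝ => D.adjKernel p.1 a y) (U ×ˢ Icc a b) :=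
      (FirstOrderSystem.contDiffOn_adjKernel h y a).comp contDiffOn_fst fun p hp => hp.1
    exact h1.mul h2
  · intro t _ s hs
    obtain ⟨k, hk, hKk⟩ := (FirstOrderSystem.isPiecewiseSmooth_adjKernel (D := D) (t := t) y).2
      a b hab hd
    have h1 := eq_solve_one_mul hab D.isBoundedMeasurable_adj_coeff
      (fun μ => Complex.I • adj (D.param μ)) t hk.continuousOn (fun z hz => by
        have h2 := FirstOrderSystem.adjKernel_hasDerivWithinAt (D := D) (t := t) y z
        have h6 : D.adjKernel t z y = k z := hKk (Ioo_subset_Ico_self hz)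
        rw [I_smul_adj_symbol, h6] at h2
        have h3 : k =ᶠ[𝓝[≥] z] fun s => D.adjKernel t s y := by
          filter_upwards [Ico_mem_nhdsGE hz.2] with x hx
          exact (hKk ⟨hz.1.le.trans hx.1, hx.2⟩).symm
        exact (h2.congr_of_eventuallyEq h3 h6.symm).mono
          Ioi_subset_Ici_self) (Ico_subset_Icc_self hs)
    have h4 : D.adjKernel t a y = k a := hKk ⟨le_rfl, hab⟩
    have h5 : D.adjKernel t s y = k s := hKk hs
    rw [h5, h1, ← h4]

namespace NahmData

variable {S E : Type*} [NormedAddCommGroup S] [InnerProductSpace ℂ S]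
  [FiniteDimensional ℂ S] [NormedAddCommGroup E] [InnerProductSpace ℂ E]
  [FiniteDimensional ℂ E] {n : ℕ} {W : Fin n → Type*} [∀ α, NormedAddCommGroup (W α)]
  [∀ α, InnerProductSpace ℂ (W α)] [∀ α, FiniteDimensional ℂ (W α)]
  {N : NahmData S E n W} {t : Fin 4 → ℝ}
  {V : Type*} [NormedAddCommGroup V] [InnerProductSpace ℂ V] [FiniteDimensional ℂ V]
  {U : Set (Fin 4 → ℝ)} {χ : (Fin 4 → ℝ) → V →L[ℂ] PiLp 2 W}

theorem exists_contDiffOn_kerFst (h : ∀ t ∈ U, N.IsRegular t) {a b : ℝ} (hab : a < b)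
    (hd : Disjoint (Ioo a b) N.marks) :
    ∃ g : (Fin 4 → ℝ) × ℝ → PiLp 2 W →L[ℂ] S ⊗[ℂ] E, ContDiffOn ℝ ∞ g (U ×ˢ Icc a b) ∧
      ∀ t ∈ U, ∀ s ∈ Ico a b, N.kerFst t s = g (t, s) := by
  have h1 : ∀ α, ∃ g : (Fin 4 → ℝ) × ℝ → S ⊗[ℂ] E →L[ℂ] S ⊗[ℂ] E,
      ContDiffOn ℝ ∞ g (U ×ˢ Icc a b) ∧
      ∀ t ∈ U, ∀ s ∈ Ico a b, N.system.adjKernel t s (N.lam α) = g (t, s) := fun α =>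
    FirstOrderSystem.exists_contDiffOn_adjKernel (fun t ht => isRegular_system N (h t ht))
      (N.lam α) hab (by rwa [system_breaksWith, marksWith_lam])
  choose g hg hgE using h1
  refine ⟨fun p => -∑ α, g α p ∘L N.Q α ∘L PiLp.proj 2 W α, ?_, fun t ht s hs => ?_⟩
  · exact (ContDiffOn.sum fun α _ => ContDiffOn.complexClm_comp (hg α) contDiffOn_const).neg
  · rw [kerFst]
    simp only [hgE _ t ht s hs]

theorem isSmoothFamily_kerFst (h : ∀ t ∈ U, N.IsRegular t) {x : (Fin 4 → ℝ) → PiLp 2 W}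
    (hx : ContDiffOn ℝ ∞ x U) : IsSmoothFamily N.marks U fun t s => N.kerFst t s (x t) := by
  refine ⟨fun t _ => (isPiecewiseSmooth_kerFst (x t)).1, fun a b hab hd => ?_⟩
  obtain ⟨g, hg, hgE⟩ := exists_contDiffOn_kerFst h hab hd
  refine ⟨fun p => g p (x p.1), ContDiffOn.complexClm_apply hg
    (hx.comp contDiffOn_fst fun p hp => hp.1), fun t ht s hs => ?_⟩
  change N.kerFst t s (x t) = _
  rw [hgE t ht s hs]

/-- The first component of the trivialization with second component `χ`. -/
def frameFst (N : NahmData S E n W) (χ : (Fin 4 → ℝ) → V →L[ℂ] PiLp 2 W) (t : Fin 4 → ℝ) :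
    V →ₗ[ℂ] (ℝ → S ⊗[ℂ] E) where
  toFun w s := N.kerFst t s (χ t w)
  map_add' w w' := by
    funext s
    simp
  map_smul' c w := by
    funext s
    simp

/-- For the isometry, write `χ w' = gram v`. The relation `χ χ† = gram` and injectivity of `χ` give
`w' = χ† v`, and the product formula for kernel elements turns into `⟨w, w'⟩`. -/
theorem isFrame_frameFst (hreg : ∀ t ∈ U, N.IsRegular t) (hχ : ContDiffOn ℝ ∞ χ U)
    (hinv : ∀ t ∈ U, (χ t).IsInvertible) (hgram : ∀ t ∈ U, χ t ∘L adj (χ t) = N.gram t) :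
    N.IsFrame U (N.frameFst χ) χ where
  mem_ker t ht w := kerPair_mem_weylKer (hreg t ht) (χ t w)
  surj t ht p hp := by
    obtain ⟨e, he⟩ := hinv t ht
    refine ⟨e.symm p.2, ?_⟩
    have h1 : χ t (e.symm p.2) = p.2 := by
      rw [← he]
      exact e.apply_symm_apply p.2
    rw [eq_kerPair (hreg t ht) hp]
    change N.kerPair t (χ t (e.symm p.2)) = _
    rw [h1]
  isometry t ht w w' := by
    obtain ⟨e, he⟩ := hinv t ht
    obtain ⟨v, hv⟩ : ∃ v, N.gram t v = χ t w' :=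
      ((ContinuousLinearMap.isUnit_iff_bijective).1 (isUnit_gram (hreg t ht))).2 _
    have h1 : adj (χ t) v = w' := by
      have h2 : χ t (adj (χ t) v) = χ t w' := by rw [← hv, ← hgram t ht]; rfl
      rw [← he] at h2 ⊢
      exact e.injective h2
    change pairInner (N.kerPair t (χ t w)) (N.kerPair t (χ t w')) = _
    rw [← hv, pairInner_kerPair_gram (hreg t ht), ← h1, adj_inner_right]
  smooth_fst w := isSmoothFamily_kerFst hreg (ContDiffOn.complexClm_apply hχ contDiffOn_const)
  smooth_snd := hχ

theorem exists_isFrame_iff (hreg : ∀ t ∈ U, N.IsRegular t) :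
    (∃ ψ : (Fin 4 → ℝ) → V →ₗ[ℂ] (ℝ → S ⊗[ℂ] E), N.IsFrame U ψ χ) ↔
      ContDiffOn ℝ ∞ χ U ∧ ∀ t ∈ U, (χ t).IsInvertible ∧ χ t ∘L adj (χ t) = N.gram t :=
  ⟨fun ⟨_, hF⟩ => ⟨hF.smooth_snd, fun t ht =>
    ⟨isInvertible_of_bijective (hF.bijective ht (hreg t ht)), hF.comp_adj ht (hreg t ht)⟩⟩,
  fun ⟨h1, h2⟩ => ⟨_, isFrame_frameFst hreg h1 (fun t ht => (h2 t ht).1) fun t ht => (h2 t ht).2⟩⟩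

end NahmData

/-! ### Differentiation with respect to the parameters -/

section PairExtend

variable {Z X : Type*} [NormedAddCommGroup Z] [NormedSpace ℂ Z] [NormedAddCommGroup X]
  [InnerProductSpace ℂ X] {h : ℝ → X} {y : ℝ}

theorem IsPW.exists_bound {V : Type*} [NormedAddCommGroup V] [NormedSpace ℝ V] {f : ℝ → V}
    (hf : IsPW f) : ∃ C, ∀ s, ‖f s‖ ≤ C := by
  obtain ⟨P, hP, hf⟩ := hf
  exact hf.exists_bound hP

theorem IsPW.aestronglyMeasurable {V : Type*} [NormedAddCommGroup V] [NormedSpace ℝ V]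
    {f : ℝ → V} (hf : IsPW f) : AEStronglyMeasurable f volume := by
  obtain ⟨P, hP, hf⟩ := hf
  exact hf.aestronglyMeasurable hP

theorem IsPW.periodic {V : Type*} [NormedAddCommGroup V] [NormedSpace ℝ V]
    {f : ℝ → V} (hf : IsPW f) : Function.Periodic f (2 * Real.pi) := by
  obtain ⟨P, hP, hf⟩ := hf
  exact hf.1

theorem IsPW.intervalIntegrable_inner_continuous (hh : IsPW h) {f : ℝ → X} (hf : Continuous f)
    (a b : ℝ) : IntervalIntegrable (fun s => (inner ℂ (h s) (f s) : ℂ)) volume a b := by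
  obtain ⟨C, hC⟩ := hh.exists_bound
  refine ((hf.norm.intervalIntegrable a b).const_mul C).mono_fun
    (hh.aestronglyMeasurable.inner hf.aestronglyMeasurable).restrict
    (Eventually.of_forall fun s => ?_)
  refine (norm_inner_le_norm _ _).trans (le_trans ?_ (le_abs_self _))
  exact mul_le_mul_of_nonneg_right (hC s) (norm_nonneg _)

/-- The `L²` product with a fixed function, as a functional of functions on `[y, y + 2π]`. -/
def pairExtend (hh : IsPW h) (y : ℝ) (L : Z →L[ℂ] X) : C(Icc y (y + 2 * Real.pi), Z) →L[ℝ] ℂ :=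
  LinearMap.mkContinuousOfExistsBound
    { toFun := fun φ => ∫ s in y..(y + 2 * Real.pi),
        inner ℂ (h s) (L (IccExtend (lt_add_two_pi y).le φ s))
      map_add' := fun φ φ' => by
        have hi : ∀ φ : C(Icc y (y + 2 * Real.pi), Z), IntervalIntegrable
            (fun s => (inner ℂ (h s) (L (IccExtend (lt_add_two_pi y).le φ s)) : ℂ)) volume y
            (y + 2 * Real.pi) := fun φ => hh.intervalIntegrable_inner_continuous
          (L.continuous.comp φ.continuous.Icc_extend') _ _
        rw [← intervalIntegral.integral_add (hi φ) (hi φ')]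
        simp [IccExtend]
      map_smul' := fun c φ => by
        rw [RingHom.id_apply, ← intervalIntegral.integral_smul]
        refine intervalIntegral.integral_congr fun s _ => ?_
        have h1 : L (IccExtend (lt_add_two_pi y).le (c • φ) s)
            = (c : ℂ) • L (IccExtend (lt_add_two_pi y).le φ s) := by
          rw [← map_smul]
          rfl
        change inner ℂ (h s) (L (IccExtend (lt_add_two_pi y).le (c • φ) s)) = _
        rw [h1, inner_smul_right]
        simp } (by
      obtain ⟨C, hC⟩ := hh.exists_bound
      refine ⟨C * ‖L‖ * (2 * Real.pi), fun φ => ?_⟩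
      refine (intervalIntegral.norm_integral_le_of_norm_le_const (C := C * (‖L‖ * ‖φ‖))
        fun s _ => ?_).trans (le_of_eq ?_)
      · refine (norm_inner_le_norm _ _).trans ?_
        refine mul_le_mul (hC s) ((L.le_opNorm _).trans ?_) (norm_nonneg _)
          ((norm_nonneg _).trans (hC s))
        exact mul_le_mul_of_nonneg_left (φ.norm_coe_le_norm _) (norm_nonneg _)
      · rw [add_sub_cancel_left, abs_of_pos Real.two_pi_pos]
        ring)

theorem pairExtend_apply (hh : IsPW h) (y : ℝ) (L : Z →L[ℂ] X)
    (φ : C(Icc y (y + 2 * Real.pi), Z)) :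
    pairExtend hh y L φ = l2Inner h fun s => L (extend y φ s) := by
  rw [l2Inner_eq_integral hh.periodic (fun s => by rw [extend_periodic y φ s]) y]
  change ∫ s in y..(y + 2 * Real.pi), _ = _
  rw [intervalIntegral.integral_of_le (lt_add_two_pi y).le,
    intervalIntegral.integral_of_le (lt_add_two_pi y).le, integral_Ioc_eq_integral_Ioo,
    integral_Ioc_eq_integral_Ioo]
  refine setIntegral_congr_fun measurableSet_Ioo fun s hs => ?_
  simp only [extend, periodize_of_mem _ (Ioo_subset_Ico_self hs)]

end PairExtend

theorem HasLineDerivAt.clm {T F G : Type*} [NormedAddCommGroup T] [NormedSpace ℝ T]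
    [NormedAddCommGroup F] [NormedSpace ℝ F] [NormedAddCommGroup G] [NormedSpace ℝ G]
    {f : T → F} {f' : F} {t v : T} (L : F →L[ℝ] G) (h : HasLineDerivAt ℝ f f' t v) :
    HasLineDerivAt ℝ (fun x => L (f x)) (L f') t v :=
  L.hasFDerivAt.comp_hasDerivAt 0 h

theorem hasLineDerivAt_pd {F : Type*} [NormedAddCommGroup F] [NormedSpace ℝ F]
    {U : Set (Fin 4 → ℝ)} (hU : IsOpen U) {f : (Fin 4 → ℝ) → F} (hf : ContDiffOn ℝ ∞ f U)
    {t : Fin 4 → ℝ} (ht : t ∈ U) (μ : Fin 4) :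
    HasLineDerivAt ℝ f (pd μ f t) t (Pi.single μ 1) := by
  have h := (hf.contDiffAt (hU.mem_nhds ht)).differentiableAt (by simp)
  exact h.lineDifferentiableAt.hasLineDerivAt

theorem pd_congr {F : Type*} [NormedAddCommGroup F] [NormedSpace ℝ F]
    {U : Set (Fin 4 → ℝ)} (hU : IsOpen U) {f g : (Fin 4 → ℝ) → F} (h : EqOn f g U)
    {t : Fin 4 → ℝ} (ht : t ∈ U) (μ : Fin 4) : pd μ f t = pd μ g t :=
  (h.eventuallyEq_of_mem (hU.mem_nhds ht)).lineDeriv_eq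

theorem HasLineDerivAt.complexClm_apply {X Y : Type*} [NormedAddCommGroup X] [NormedSpace ℂ X]
    [NormedAddCommGroup Y] [NormedSpace ℂ Y] {T : Type*} [NormedAddCommGroup T] [NormedSpace ℝ T]
    {A : T → X →L[ℂ] Y} {f : T → X} {A' : X →L[ℂ] Y} {f' : X} {t v : T}
    (hA : HasLineDerivAt ℝ A A' t v) (hf : HasLineDerivAt ℝ f f' t v) :
    HasLineDerivAt ℝ (fun z => A z (f z)) (A' (f t) + A t f') t v := by
  have hA' : HasDerivAt (fun r : ℝ => A (t + r • v)) A' 0 := hA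
  have hf' : HasDerivAt (fun r : ℝ => f (t + r • v)) f' 0 := hf
  have h := ((ContinuousLinearMap.restrictScalarsL ℂ X Y ℝ ℝ).hasFDerivAt.comp_hasDerivAt 0
    hA').clm_apply hf'
  simpa [HasLineDerivAt] using h

/-- Partial derivatives of smooth families are piecewise smooth. -/
theorem IsSmoothFamily.isPiecewiseSmooth_pd {V : Type*} [NormedAddCommGroup V] [NormedSpace ℝ V]
    {P : Set ℝ} {U : Set (Fin 4 → ℝ)} (hU : IsOpen U) {f : (Fin 4 → ℝ) → ℝ → V}
    (hf : IsSmoothFamily P U f) {t : Fin 4 → ℝ} (ht : t ∈ U) (μ : Fin 4) :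
    IsPiecewiseSmooth P fun s => pd μ (fun t' => f t' s) t := by
  refine ⟨fun s => pd_congr hU (fun t' ht' => hf.1 t' ht' s) ht μ, fun a b hab hd => ?_⟩
  obtain ⟨g, hg, hfg⟩ := hf.2 a b hab hd
  have huniq : UniqueDiffOn ℝ (U ×ˢ Icc a b) := hU.uniqueDiffOn.prod (uniqueDiffOn_Icc hab)
  refine ⟨fun s => fderivWithin ℝ g (U ×ˢ Icc a b) (t, s) (Pi.single μ 1, 0), ?_, fun s hs => ?_⟩
  · have h1 : ContDiffOn ℝ ∞ (fderivWithin ℝ g (U ×ˢ Icc a b)) (U ×ˢ Icc a b) :=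
      hg.fderivWithin huniq (by simp)
    exact (h1.comp (contDiffOn_const.prodMk contDiffOn_id) fun s hs => ⟨ht, hs⟩).clm_apply
      contDiffOn_const
  · have hs' := Ico_subset_Icc_self hs
    have h1 : HasFDerivWithinAt g (fderivWithin ℝ g (U ×ˢ Icc a b) (t, s)) (U ×ˢ Icc a b) (t, s) :=
      ((hg.differentiableOn (by simp)) (t, s) ⟨ht, hs'⟩).hasFDerivWithinAt
    -- The line through `t` at fixed `s` stays in `U ×ˢ Icc a b` for small `r`, so a derivative
    -- within this set is an ordinary derivative along the line, even if `s` is an end of the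
    -- interval.
    set γ : ℝ → (Fin 4 → ℝ) × ℝ := fun r => (t + r • Pi.single μ 1, s) with hγ
    have hγd : HasDerivAt γ (Pi.single μ 1, 0) 0 := by
      have h2 : HasDerivAt (fun r : ℝ => t + r • (Pi.single μ 1 : Fin 4 → ℝ)) (Pi.single μ 1) 0 := by
        simpa using ((hasDerivAt_id (0 : ℝ)).smul_const (Pi.single μ 1 : Fin 4 → ℝ)).const_add t
      exact h2.prodMk (hasDerivAt_const 0 s)
    have hγ0 : γ 0 = (t, s) := by simp [hγ]
    have hmem : ∀ᶠ r in 𝓝 (0 : ℝ), t + r • (Pi.single μ 1 : Fin 4 → ℝ) ∈ U := by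
      have h2 : Continuous fun r : ℝ => t + r • (Pi.single μ 1 : Fin 4 → ℝ) := by fun_prop
      exact h2.continuousAt.eventually_mem (hU.mem_nhds (by simpa using ht))
    have h3 : HasDerivAt (g ∘ γ)
        (fderivWithin ℝ g (U ×ˢ Icc a b) (t, s) (Pi.single μ 1, 0)) 0 := by
      rw [← hγ0] at h1
      have h4 := h1.comp_hasDerivWithinAt (s := γ ⁻¹' (U ×ˢ Icc a b)) 0 hγd.hasDerivWithinAt
        (mapsTo_preimage _ _)
      rw [hγ0] at h4
      refine h4.hasDerivAt ?_
      filter_upwards [hmem] with r hr using ⟨hr, hs'⟩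
    have h5 : HasLineDerivAt ℝ (fun t' => f t' s)
        (fderivWithin ℝ g (U ×ˢ Icc a b) (t, s) (Pi.single μ 1, 0)) t (Pi.single μ 1) := by
      refine HasDerivAt.congr_of_eventuallyEq h3 ?_
      filter_upwards [hmem] with r hr using hfg _ hr s hs
    exact h5.lineDeriv

theorem eventually_add_smul_mem {U : Set (Fin 4 → ℝ)} (hU : IsOpen U) {t : Fin 4 → ℝ}
    (ht : t ∈ U) (v : Fin 4 → ℝ) : ∀ᶠ r in 𝓝 (0 : ℝ), t + r • v ∈ U := by
  have h : Continuous fun r : ℝ => t + r • v := by fun_prop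
  exact h.continuousAt.eventually_mem (hU.mem_nhds (by simpa using ht))

namespace FirstOrderSystem

variable {X : Type*} [NormedAddCommGroup X] [InnerProductSpace ℂ X]
  [FiniteDimensional ℂ X] {D : FirstOrderSystem X} {t : Fin 4 → ℝ} {U : Set (Fin 4 → ℝ)}

theorem op_add_single (t : Fin 4 → ℝ) (μ : Fin 4) (r : ℝ) (f : ℝ → X) (s : ℝ) :
    D.op (t + r • Pi.single μ 1) f s = D.op t f s + (r : ℂ) • D.param μ (f s) := by
  have h1 : ∑ ν, ((t + r • Pi.single μ 1 : Fin 4 → ℝ) ν : ℂ) • D.param ν (f s)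
      = ∑ ν, (t ν : ℂ) • D.param ν (f s) + (r : ℂ) • D.param μ (f s) := by
    simp only [Pi.add_apply, Pi.smul_apply, smul_eq_mul, Complex.ofReal_add, add_smul,
      Finset.sum_add_distrib]
    congr 1
    rw [Finset.sum_eq_single μ (fun ν _ hν => by simp [Pi.single_eq_of_ne hν]) (by simp)]
    simp
  have h2 : ∀ t : Fin 4 → ℝ, D.symbol t s (f s)
      = D.coeff s (f s) + ∑ ν, (t ν : ℂ) • D.param ν (f s) := fun t => by
    simp [symbol, sum_apply]
  rw [op, op, h2, h2, h1, add_assoc, add_assoc]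

theorem isSmoothFamily_adjKernel (h : ∀ t ∈ U, D.IsRegular t) (y : ℝ) :
    IsSmoothFamily (D.breaksWith y) U fun t s => D.adjKernel t s y :=
  ⟨fun _ _ => (isPiecewiseSmooth_adjKernel y).1,
    fun _ _ hab hd => exists_contDiffOn_adjKernel h y hab hd⟩

theorem pd_adjKernel (hU : IsOpen U) (h : ∀ t ∈ U, D.IsRegular t) (y s : ℝ) (ht : t ∈ U)
    (μ : Fin 4) : pd μ (fun t' => D.adjKernel t' s y) t
      = extend y (pd μ (D.adjKernelOn y) t) s := by
  have h1 := hasLineDerivAt_pd hU (contDiffOn_adjKernelOn h y) ht μ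
  have h2 := HasLineDerivAt.clm (ContinuousMap.evalCLM ℝ (circleRep y s)) h1
  simp only [adjKernel, extend_eq]
  exact h2.lineDeriv

theorem isPW_pd_adjKernel (hU : IsOpen U) (h : ∀ t ∈ U, D.IsRegular t) (y : ℝ) (ht : t ∈ U)
    (μ : Fin 4) : IsPW fun s => pd μ (fun t' => D.adjKernel t' s y) t :=
  ⟨_, isSparse_breaksWith y, (isSmoothFamily_adjKernel h y).isPiecewiseSmooth_pd hU ht μ⟩

/-- Differentiation under the integral sign. -/
theorem hasLineDerivAt_l2Inner_adjKernel (hU : IsOpen U) (h : ∀ t ∈ U, D.IsRegular t) (y : ℝ)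
    (ht : t ∈ U) (μ : Fin 4) {k : ℝ → X} (hk : IsPW k) (u : X) :
    HasLineDerivAt ℝ (fun t' => l2Inner k fun s => D.adjKernel t' s y u)
      (l2Inner k fun s => pd μ (fun t' => D.adjKernel t' s y) t u) t (Pi.single μ 1) := by
  have h1 := hasLineDerivAt_pd hU (contDiffOn_adjKernelOn h y) ht μ
  -- The kernel is differentiable as a family in the space of continuous functions, where
  -- integration against `k` is continuous linear; no dominated convergence is involved.
  have h2 := HasLineDerivAt.clm (pairExtend hk y (ContinuousLinearMap.apply ℂ X u)) h1
  simp only [pairExtend_apply, ContinuousLinearMap.apply_apply] at h2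
  simp only [pd_adjKernel hU h y _ ht]
  exact h2

end FirstOrderSystem

namespace NahmData

variable {S E : Type*} [NormedAddCommGroup S] [InnerProductSpace ℂ S]
  [FiniteDimensional ℂ S] [NormedAddCommGroup E] [InnerProductSpace ℂ E]
  [FiniteDimensional ℂ E] {n : ℕ} {W : Fin n → Type*} [∀ α, NormedAddCommGroup (W α)]
  [∀ α, InnerProductSpace ℂ (W α)] [∀ α, FiniteDimensional ℂ (W α)]
  {N : NahmData S E n W} {t : Fin 4 → ℝ} {U : Set (Fin 4 → ℝ)}

theorem hasLineDerivAt_kerFst (hU : IsOpen U) (h : ∀ t ∈ U, N.IsRegular t) (ht : t ∈ U)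
    (μ : Fin 4) (s : ℝ) : HasLineDerivAt ℝ (fun t' => N.kerFst t' s)
      (pd μ (fun t' => N.kerFst t' s) t) t (Pi.single μ 1) := by
  refine hasLineDerivAt_pd hU ?_ ht μ
  exact (ContDiffOn.sum fun α _ => ContDiffOn.complexClm_comp
    (FirstOrderSystem.contDiffOn_adjKernel (fun t ht => isRegular_system N (h t ht)) _ s)
    contDiffOn_const).neg

theorem pd_kerFst_apply (hU : IsOpen U) (h : ∀ t ∈ U, N.IsRegular t) (ht : t ∈ U)
    (μ : Fin 4) (s : ℝ) (x : PiLp 2 W) : pd μ (fun t' => N.kerFst t' s) t x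
      = -∑ α, pd μ (fun t' => N.system.adjKernel t' s (N.lam α)) t (N.Q α (x α)) := by
  have h0 := fun t ht => isRegular_system N (h t ht)
  have h1 := HasLineDerivAt.complexClm_apply (hasLineDerivAt_kerFst hU h ht μ s)
    (f := fun _ => x) (f' := 0) (hasDerivAt_const _ x)
  have h2 : ∀ α, HasLineDerivAt ℝ
      (fun t' => N.system.adjKernel t' s (N.lam α) (N.Q α (x α)))
      (pd μ (fun t' => N.system.adjKernel t' s (N.lam α)) t (N.Q α (x α))) t
      (Pi.single μ 1) := fun α => by
    have h3 := HasLineDerivAt.complexClm_apply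
      (hasLineDerivAt_pd hU (FirstOrderSystem.contDiffOn_adjKernel h0 (N.lam α) s) ht μ)
      (f := fun _ => N.Q α (x α)) (f' := 0) (hasDerivAt_const _ _)
    simpa using h3
  have h4 : HasLineDerivAt ℝ (fun t' => N.kerFst t' s x)
      (-∑ α, pd μ (fun t' => N.system.adjKernel t' s (N.lam α)) t (N.Q α (x α))) t
      (Pi.single μ 1) := by
    simp only [kerFst_apply]
    exact (HasDerivAt.fun_sum fun α _ => h2 α).neg
  rw [map_zero, add_zero] at h1
  exact HasDerivAt.unique h1 h4

theorem isPW_pd_kerFst (hU : IsOpen U) (h : ∀ t ∈ U, N.IsRegular t) (ht : t ∈ U)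
    (μ : Fin 4) (x : PiLp 2 W) : IsPW fun s => pd μ (fun t' => N.kerFst t' s) t x := by
  have h0 := fun t ht => isRegular_system N (h t ht)
  simp only [pd_kerFst_apply hU h ht]
  have h1 : ∀ α, IsPW fun s => pd μ (fun t' => N.system.adjKernel t' s (N.lam α)) t
      (N.Q α (x α)) := fun α => by
    obtain ⟨P, hP, h2⟩ := FirstOrderSystem.isPW_pd_adjKernel hU h0 (N.lam α) ht μ
    exact ⟨P, hP, h2.clm_apply (isPiecewiseSmooth_const _)⟩
  obtain ⟨P, hP, h3⟩ := IsPW.sum (u := Finset.univ) fun α _ => h1 α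
  exact ⟨P, hP, h3.neg⟩

theorem hasLineDerivAt_l2Inner_kerFst (hU : IsOpen U) (h : ∀ t ∈ U, N.IsRegular t) (ht : t ∈ U)
    (μ : Fin 4) {k : ℝ → S ⊗[ℂ] E} (hk : IsPW k) (x : PiLp 2 W) :
    HasLineDerivAt ℝ (fun t' => l2Inner k fun s => N.kerFst t' s x)
      (l2Inner k fun s => pd μ (fun t' => N.kerFst t' s) t x) t (Pi.single μ 1) := by
  have h0 := fun t ht => isRegular_system N (h t ht)
  have h1 : ∀ α, IsPW fun s => pd μ (fun t' => N.system.adjKernel t' s (N.lam α)) t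
      (N.Q α (x α)) := fun α => by
    obtain ⟨P, hP, h2⟩ := FirstOrderSystem.isPW_pd_adjKernel hU h0 (N.lam α) ht μ
    exact ⟨P, hP, h2.clm_apply (isPiecewiseSmooth_const _)⟩
  simp only [pd_kerFst_apply hU h ht, kerFst_apply]
  rw [l2Inner_neg_right, l2Inner_sum_right hk fun α _ => h1 α]
  simp only [l2Inner_neg_right]
  simp only [l2Inner_sum_right hk fun α _ => FirstOrderSystem.isPW_adjKernel _ _]
  exact (HasDerivAt.fun_sum fun α _ => FirstOrderSystem.hasLineDerivAt_l2Inner_adjKernel hU h0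
    (N.lam α) ht μ hk (N.Q α (x α))).neg

theorem dirac_add_single (t : Fin 4 → ℝ) (μ : Fin 4) (r : ℝ) (f : ℝ → S ⊗[ℂ] E) :
    N.dirac (t + r • Pi.single μ 1) f
      = fun s => N.dirac t f s + (r : ℂ) • N.spin (N.eMu μ) (f s) := by
  rw [← system_op, ← system_op]
  exact funext fun s => FirstOrderSystem.op_add_single t μ r f s

/-- The derivative of `ker 𝒟_t†` in the parameters, paired with `ker 𝒟_t†`. -/
theorem l2Inner_kerFst_pd (hU : IsOpen U) (h : ∀ t ∈ U, N.IsRegular t) (ht : t ∈ U)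
    (μ : Fin 4) (v x : PiLp 2 W) :
    l2Inner (fun s => N.kerFst t s (N.gram t v)) (fun s => pd μ (fun t' => N.kerFst t' s) t x)
      = l2Inner (fun s => N.spin (N.eMu μ) (N.weylSource t s v)) fun s => N.kerFst t s x := by
  set g := fun s => N.weylSource t s v with hg
  have hgC : IsCPW g := isCPW_weylSource (h t ht) v
  have hD := isPW_dirac (N := N) t hgC.1
  have hS : IsPW fun s => N.spin (N.eMu μ) (g s) := hgC.1.clm _
  have h1 : HasDerivAt _ _ (0 : ℝ) := hasLineDerivAt_l2Inner_kerFst hU h ht μ hD x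
  have h2 : HasDerivAt _ _ (0 : ℝ) := hasLineDerivAt_l2Inner_kerFst hU h ht μ hS x
  -- At the displaced parameter the product of `D g` with the kernel section is the constant `-⟨𝐐†
  -- g, x⟩`. Since `D` is affine in the parameter, its product at `t` is this constant minus `r`
  -- times a differentiable function, of which only the value at zero matters.
  have h3 : HasDerivAt (fun r : ℝ => -inner ℂ (N.bdry g) x
      - (r : ℂ) * l2Inner (fun s => N.spin (N.eMu μ) (g s))
        fun s => N.kerFst (t + r • Pi.single μ 1) s x)
      (-l2Inner (fun s => N.spin (N.eMu μ) (g s)) fun s => N.kerFst t s x) 0 := by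
    have h4 := ((Complex.ofRealCLM.hasDerivAt (x := (0 : ℝ))).mul h2).const_sub
      (-inner ℂ (N.bdry g) x : ℂ)
    simpa using h4
  have h5 := HasDerivAt.unique h1 (h3.congr_of_eventuallyEq ?_)
  · simp only [kerFst_gram (h t ht)]
    rw [l2Inner_neg_left, h5, neg_neg]
  · filter_upwards [eventually_add_smul_mem hU ht (Pi.single μ 1)] with r hr
    have h6 := l2Inner_kerFst_dirac (h _ hr) x hgC
    rw [← l2Inner_conj, star_eq_iff_star_eq] at h6
    rw [dirac_add_single] at h6
    rw [l2Inner_add_left hD (hS.const_smul _) (isPW_kerFst x), l2Inner_smul_left, star_neg] at h6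
    have h7 : star (inner ℂ x (N.bdry g) : ℂ) = inner ℂ (N.bdry g) x := inner_conj_symm _ _
    rw [h7] at h6
    have h8 : star (r : ℂ) = r := Complex.conj_ofReal r
    rw [h8] at h6
    rw [h6]
    ring

end NahmData

/-! ### The parameter derivatives of the Green's function -/

theorem continuousOn_l2Inner_clm_apply {T X Z : Type*} [TopologicalSpace T]
    [NormedAddCommGroup X] [InnerProductSpace ℂ X] [NormedAddCommGroup Z]
    [InnerProductSpace ℂ Z] [FiniteDimensional ℂ Z] {U : Set T} {B : T → ℝ → Z →L[ℂ] X}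
    {k : ℝ → X} {x : T → Z} (hk : IsPW k) (hB : ∀ t ∈ U, ∀ z, IsPW fun s => B t s z)
    (hc : ∀ z, ContinuousOn (fun t => l2Inner k fun s => B t s z) U) (hx : ContinuousOn x U) :
    ContinuousOn (fun t => l2Inner k fun s => B t s (x t)) U := by
  have h1 : ∀ t ∈ U, (l2Inner k fun s => B t s (x t))
      = ∑ i, inner ℂ (stdOrthonormalBasis ℂ Z i) (x t)
        * l2Inner k fun s => B t s (stdOrthonormalBasis ℂ Z i) := fun t ht => by
    conv_lhs => rw [← (stdOrthonormalBasis ℂ Z).sum_repr' (x t)]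
    simp only [map_sum, map_smul]
    rw [l2Inner_sum_right hk fun i _ => (hB t ht _).const_smul _]
    simp only [l2Inner_smul_right]
  exact (continuousOn_finsetSum _ fun i _ =>
    (continuousOn_const.inner hx).mul (hc _)).congr h1

/-- The slope at zero is `h` itself, so continuity suffices. This allows the resolvent identity to
be differentiated when the Green's function is known to depend only continuously on the parameter in
the `L²` pairings. -/
theorem hasDerivAt_ofReal_mul {h : ℝ → ℂ} (hh : ContinuousAt h 0) :
    HasDerivAt (fun r : ℝ => (r : ℂ) * h r) (h 0) 0 := by
  rw [hasDerivAt_iff_tendsto_slope_zero]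
  refine (hh.tendsto.mono_left nhdsWithin_le_nhds).congr' ?_
  filter_upwards [self_mem_nhdsWithin] with r hr
  have hr' : (r : ℂ) ≠ 0 := Complex.ofReal_ne_zero.2 hr
  simp [hr']

theorem HasLineDerivAt.inner_clm {T Z X Y : Type*} [NormedAddCommGroup T] [NormedSpace ℝ T]
    [NormedAddCommGroup Z] [NormedSpace ℂ Z] [NormedAddCommGroup X] [NormedSpace ℂ X]
    [NormedAddCommGroup Y] [InnerProductSpace ℂ Y] (L : Z →L[ℂ] X →L[ℂ] X) (B : X →L[ℂ] Y)
    (x : X) (w : Y) {K : T → Z} {K' : Z} {t e : T} (hK : HasLineDerivAt ℝ K K' t e) :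
    HasLineDerivAt ℝ (fun t => (inner ℂ w (B (L (K t) x)) : ℂ)) (inner ℂ w (B (L K' x))) t e :=
  HasLineDerivAt.clm ((innerSL ℂ w ∘L B ∘L
    ContinuousLinearMap.apply ℂ X x ∘L L).restrictScalars ℝ) hK

namespace FirstOrderSystem

variable {X : Type*} [NormedAddCommGroup X] [InnerProductSpace ℂ X]
  [FiniteDimensional ℂ X] {D : FirstOrderSystem X} {U : Set (Fin 4 → ℝ)} {k : ℝ → X}

theorem continuousOn_l2Inner_adjKernel (h : ∀ t ∈ U, D.IsRegular t) (hk : IsPW k) (y : ℝ)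
    (u : X) : ContinuousOn (fun t => l2Inner k fun s => D.adjKernel t s y u) U := by
  have h1 := (pairExtend hk y (ContinuousLinearMap.apply ℂ X u)).continuous.comp_continuousOn
    (contDiffOn_adjKernelOn h y).continuousOn
  refine h1.congr fun t _ => ?_
  simp only [Function.comp_apply, pairExtend_apply]
  rfl

theorem continuousOn_l2Inner_greenKernel (h : ∀ t ∈ U, D.IsRegular t) (hk : IsPW k) (y : ℝ)
    (u : X) : ContinuousOn (fun t => l2Inner k fun s => D.greenKernel t s y u) U := by
  have h1 := (pairExtend hk y (ContinuousLinearMap.apply ℂ X u)).continuous.comp_continuousOn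
    (contDiffOn_greenKernelOn h y).continuousOn
  refine h1.congr fun t _ => ?_
  simp only [Function.comp_apply, pairExtend_apply]
  rfl

end FirstOrderSystem

namespace NahmData

variable {S E : Type*} [NormedAddCommGroup S] [InnerProductSpace ℂ S]
  [FiniteDimensional ℂ S] [NormedAddCommGroup E] [InnerProductSpace ℂ E]
  [FiniteDimensional ℂ E] {n : ℕ} {W : Fin n → Type*} [∀ α, NormedAddCommGroup (W α)]
  [∀ α, InnerProductSpace ℂ (W α)] [∀ α, FiniteDimensional ℂ (W α)]
  {N : NahmData S E n W} {t : Fin 4 → ℝ} {U : Set (Fin 4 → ℝ)} {k : ℝ → S ⊗[ℂ] E}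

/-- `(𝒟_t† 𝒟_t)⁻¹ 𝐐 = (D_t† D_t)⁻¹ 𝐐 (id - 𝐐† 𝐅 𝐐)`. -/
theorem weylSource_eq_sourceKernel_gram (h : N.IsRegular t) (v : PiLp 2 W) (s : ℝ) :
    N.weylSource t s v = N.sourceKernel t s (N.gram t v) := by
  have h0 := isRegular_system N h
  have h1 := isCPW_weylSource h v
  have h2 := isCPW_sourceKernel h (N.gram t v)
  -- Under `D_t` both sections go to `-kerFst` at `gram v`, and `D_t` is injective.
  have h3 : N.dirac t (fun s => N.sourceKernel t s (N.gram t v))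
      = N.dirac t fun s => N.weylSource t s v := by
    funext s
    rw [← neg_neg (N.dirac t (fun s => N.weylSource t s v) s), ← kerFst_gram h, kerFst_apply,
      neg_neg]
    simp only [sourceKernel_apply]
    rw [dirac_sum fun β _ => (FirstOrderSystem.isCPW_greenKernel h0 _ _).1]
    simp only [← system_op, FirstOrderSystem.op_greenKernel]
  have h4 := FirstOrderSystem.eq_zero_of_op_eq_zero' h0 (h1.sub h2) (by
    rw [system_op, dirac_sub h1.1 h2.1, h3]
    exact funext fun s => sub_self _)
  exact sub_eq_zero.1 (congrFun h4 s)

theorem contDiffOn_gram (h : ∀ t ∈ U, N.IsRegular t) : ContDiffOn ℝ ∞ N.gram U := by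
  refine ContDiffOn.sub contDiffOn_const (contDiffOn_toPiLp fun α => ?_)
  exact ContDiffOn.complexClm_comp contDiffOn_const (ContDiffOn.sum fun β _ =>
    ContDiffOn.complexClm_comp (contDiffOn_weylGreen h _ _) contDiffOn_const)

theorem continuousOn_gram_apply (h : ∀ t ∈ U, N.IsRegular t) (v : PiLp 2 W) :
    ContinuousOn (fun t => N.gram t v) U :=
  (ContDiffOn.complexClm_apply (contDiffOn_gram h) contDiffOn_const).continuousOn

/-- After `weylSource_eq_sourceKernel_gram` the dependence on `t` sits in the vector `gram t v` and
in the kernels of `(D_t† D_t)⁻¹`, which vary continuously in the sup norm. -/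
theorem continuousOn_l2Inner_weylSource (h : ∀ t ∈ U, N.IsRegular t) (hk : IsPW k)
    (v : PiLp 2 W) : ContinuousOn (fun t => l2Inner k fun s => N.weylSource t s v) U := by
  have h0 := fun t ht => isRegular_system N (h t ht)
  have h1 : ContinuousOn
      (fun t => l2Inner k fun s => N.sourceKernel t s (N.gram t v)) U := by
    refine continuousOn_l2Inner_clm_apply hk (fun t ht z => (isCPW_sourceKernel (h t ht) z).1)
      (fun z => ?_) (continuousOn_gram_apply h v)
    have h2 : ContinuousOn (fun t => ∑ β, l2Inner k
        fun s => N.system.greenKernel t s (N.lam β) (N.Q β (z β))) U :=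
      continuousOn_finsetSum _ fun β _ =>
        FirstOrderSystem.continuousOn_l2Inner_greenKernel h0 hk _ _
    refine h2.congr fun t ht => ?_
    simp only [sourceKernel_apply]
    exact l2Inner_sum_right hk fun β _ => (FirstOrderSystem.isCPW_greenKernel (h0 t ht) _ _).1
  refine h1.congr fun t ht => ?_
  simp only [weylSource_eq_sourceKernel_gram (h t ht)]

theorem continuousOn_l2Inner_dirac_weylSource (h : ∀ t ∈ U, N.IsRegular t) (hk : IsPW k)
    (v : PiLp 2 W) :
    ContinuousOn (fun t => l2Inner k (N.dirac t fun s => N.weylSource t s v)) U := by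
  have h0 := fun t ht => isRegular_system N (h t ht)
  have h1 : ContinuousOn (fun t => -l2Inner k fun s => N.kerFst t s (N.gram t v)) U := by
    refine (continuousOn_l2Inner_clm_apply hk (fun t ht z => isPW_kerFst z)
      (fun z => ?_) (continuousOn_gram_apply h v)).neg
    have h2 : ContinuousOn (fun t => -∑ β, l2Inner k
        fun s => N.system.adjKernel t s (N.lam β) (N.Q β (z β))) U :=
      (continuousOn_finsetSum _ fun β _ =>
        FirstOrderSystem.continuousOn_l2Inner_adjKernel h0 hk _ _).neg
    refine h2.congr fun t ht => ?_
    simp only [kerFst_apply]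
    rw [l2Inner_neg_right]
    congr 1
    exact l2Inner_sum_right hk fun β _ => FirstOrderSystem.isPW_adjKernel _ _
  refine h1.congr fun t ht => ?_
  simp only [kerFst_gram (h t ht)]
  rw [l2Inner_neg_right, neg_neg]

/-- A resolvent identity. Let `k` be the fixed section `A† f_v'` at the parameter `t`, and let `f`
be the section `f_v` at the displaced parameter. The form of `k` and `f` at `t` is the function to
be differentiated, by spinor symmetry; at the displaced parameter it is the constant `⟨𝐐† k, v⟩`.
Since `D` is affine in the parameter, the two differ by `r * q r`, and the derivative is `-q 0`. -/
theorem hasLineDerivAt_inner_bdry_spin (hN : N.NahmEquations) (hU : IsOpen U)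
    (h : ∀ t ∈ U, N.IsRegular t) (ht : t ∈ U) (ν : Fin 4) (A : S →L[ℂ] S) (v' v : PiLp 2 W) :
    HasLineDerivAt ℝ
      (fun t' => (inner ℂ v' (N.bdry fun s => N.spin A (N.weylSource t' s v)) : ℂ))
      (-(l2Inner (N.dirac t fun s => N.spin (adj A) (N.weylSource t s v'))
          (fun s => N.spin (N.eMu ν) (N.weylSource t s v))
        + l2Inner (fun s => N.spin (N.eMu ν) (N.spin (adj A) (N.weylSource t s v')))
          (N.dirac t fun s => N.weylSource t s v)))
      t (Pi.single ν 1) := by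
  set k := fun s => N.spin (adj A) (N.weylSource t s v') with hkdef
  have hk : IsCPW k := (isCPW_weylSource (h t ht) v').clm _
  have hDk := isPW_dirac (N := N) t hk.1
  have hek : IsPW fun s => N.spin (N.eMu ν) (k s) := hk.1.clm _
  set p : ℝ → Fin 4 → ℝ := fun r => t + r • Pi.single ν 1 with hp
  have hp0 : p 0 = t := by simp [hp]
  have hpc : ContinuousAt p 0 := by
    have : Continuous p := by fun_prop
    exact this.continuousAt
  set q : ℝ → ℂ := fun r =>
    l2Inner (fun s => adj (N.spin (N.eMu ν)) (N.dirac t k s)) (fun s => N.weylSource (p r) s v)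
      + l2Inner (fun s => N.spin (N.eMu ν) (k s))
          (N.dirac (p r) fun s => N.weylSource (p r) s v) with hq
  have hUn : U ∈ 𝓝 (p 0) := by rw [hp0]; exact hU.mem_nhds ht
  have hqc : ContinuousAt q 0 := by
    refine ContinuousAt.add ?_ ?_
    · exact ContinuousAt.comp (f := p)
        ((continuousOn_l2Inner_weylSource h (hDk.clm _) v).continuousAt hUn) hpc
    · exact ContinuousAt.comp (f := p)
        ((continuousOn_l2Inner_dirac_weylSource h hek v).continuousAt hUn) hpc
  have h1 := (hasDerivAt_ofReal_mul hqc).const_sub (inner ℂ (N.bdry k) v)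
  have h2 : q 0 = l2Inner (N.dirac t k) (fun s => N.spin (N.eMu ν) (N.weylSource t s v))
      + l2Inner (fun s => N.spin (N.eMu ν) (k s)) (N.dirac t fun s => N.weylSource t s v) := by
    simp only [hq, hp0]
    rw [l2Inner_clm_left, adj_adj]
  rw [← h2]
  refine HasDerivAt.congr_of_eventuallyEq h1 ?_
  filter_upwards [eventually_add_smul_mem hU ht (Pi.single ν 1)] with r hr
  change inner ℂ v' (N.bdry fun s => N.spin A (N.weylSource (p r) s v))
    = inner ℂ (N.bdry k) v - r * q r
  have hf := isCPW_weylSource (h _ hr) v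
  set f := fun s => N.weylSource (p r) s v with hfdef
  have e1 : N.weylForm t k f = inner ℂ v' (N.bdry fun s => N.spin A (f s)) := by
    rw [hkdef, weylForm_spin hN (isCPW_weylSource (h t ht) v') hf, adj_adj,
      weylForm_weylSource (h t ht) v' (hf.clm _)]
  have e2 : N.weylForm (p r) k f = inner ℂ (N.bdry k) v := by
    rw [← weylForm_conj, weylForm_weylSource (h _ hr) v hk]
    exact inner_conj_symm _ _
  have hDf := isPW_dirac (N := N) t hf.1
  have hef : IsPW fun s => N.spin (N.eMu ν) (f s) := hf.1.clm _
  have e3 : l2Inner (N.dirac (p r) k) (N.dirac (p r) f)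
      = l2Inner (N.dirac t k) (N.dirac t f) + r * q r := by
    have e4 : l2Inner (N.dirac t k) (N.dirac (p r) f) = l2Inner (N.dirac t k) (N.dirac t f)
        + r * l2Inner (N.dirac t k) (fun s => N.spin (N.eMu ν) (f s)) := by
      rw [hp, dirac_add_single, l2Inner_add_right hDk hDf (hef.const_smul _), l2Inner_smul_right]
    have e5 : l2Inner (N.dirac (p r) k) (N.dirac (p r) f)
        = l2Inner (N.dirac t k) (N.dirac (p r) f)
          + r * l2Inner (fun s => N.spin (N.eMu ν) (k s)) (N.dirac (p r) f) := by
      have e6 : N.dirac (p r) k = fun s => N.dirac t k s + (r : ℂ) • N.spin (N.eMu ν) (k s) :=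
        dirac_add_single t ν r k
      rw [e6, l2Inner_add_left hDk (hek.const_smul _) (isPW_dirac _ hf.1), l2Inner_smul_left]
      congr 2
      exact Complex.conj_ofReal r
    have e7 : l2Inner (fun s => adj (N.spin (N.eMu ν)) (N.dirac t k s)) f
        = l2Inner (N.dirac t k) fun s => N.spin (N.eMu ν) (f s) := by
      rw [l2Inner_clm_left, adj_adj]
    rw [e5, e4]
    simp only [hq]
    rw [e7]
    ring
  rw [← e1, ← e2, weylForm, weylForm, e3]
  ring

theorem bdry_spin_weylSource (hN : N.NahmEquations) (h : N.IsRegular t) (A : S →L[ℂ] S)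
    (v : PiLp 2 W) : N.bdry (fun s => N.spin A (N.weylSource t s v))
      = N.sandwich A (fun β α => N.green t (N.lam β) (N.lam α)) v := by
  ext β
  rw [sandwich_apply, bdry]
  simp only [weylSource_apply, map_sum, ← mapL_green hN h, spin_mapL_apply, mul_one]

theorem hasLineDerivAt_inner_sandwich {K : (Fin 4 → ℝ) → Fin n → Fin n → E →L[ℂ] E}
    {K' : Fin n → Fin n → E →L[ℂ] E} {e : Fin 4 → ℝ}
    (hK : ∀ β α, HasLineDerivAt ℝ (fun t => K t β α) (K' β α) t e) (A : S →L[ℂ] S)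
    (v' v : PiLp 2 W) :
    HasLineDerivAt ℝ (fun t => (inner ℂ v' (N.sandwich A (K t) v) : ℂ))
      (inner ℂ v' (N.sandwich A K' v)) t e := by
  have h1 : ∀ K : Fin n → Fin n → E →L[ℂ] E, (inner ℂ v' (N.sandwich A K v) : ℂ)
      = ∑ β, ∑ α, inner ℂ (v' β) (N.Qdag β (mapRight (S := S) A (K β α) (N.Q α (v α)))) :=
    fun K => by
      rw [PiLp.inner_apply]
      refine Finset.sum_congr rfl fun β _ => ?_
      rw [sandwich_apply, inner_sum]
      rfl
  have h2 : ∀ β α, HasLineDerivAt ℝ (fun t => (inner ℂ (v' β)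
      (N.Qdag β (mapRight (S := S) A (K t β α) (N.Q α (v α)))) : ℂ))
      (inner ℂ (v' β) (N.Qdag β (mapRight (S := S) A (K' β α) (N.Q α (v α))))) t e := fun β α => by
    exact HasLineDerivAt.inner_clm (Z := E →L[ℂ] E) (X := S ⊗[ℂ] E) (mapRight (S := S) A)
      (N.Qdag β) (N.Q α (v α)) (v' β) (hK β α)
  simp only [h1]
  exact HasDerivAt.fun_sum fun β _ => HasDerivAt.fun_sum fun α _ => h2 β α

/-- The derivatives of the Green's function at the marked points. -/
theorem inner_sandwich_pd_green (hN : N.NahmEquations) (hU : IsOpen U)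
    (h : ∀ t ∈ U, N.IsRegular t) (ht : t ∈ U) (ν : Fin 4) (A : S →L[ℂ] S) (v' v : PiLp 2 W) :
    inner ℂ v' (N.sandwich A
        (fun β α => pd ν (fun t' => N.green t' (N.lam β) (N.lam α)) t) v)
      = -(l2Inner (N.dirac t fun s => N.spin (adj A) (N.weylSource t s v'))
          (fun s => N.spin (N.eMu ν) (N.weylSource t s v))
        + l2Inner (fun s => N.spin (N.eMu ν) (N.spin (adj A) (N.weylSource t s v')))
          (N.dirac t fun s => N.weylSource t s v)) := by
  have h1 := hasLineDerivAt_inner_sandwich (N := N) (t := t) (e := Pi.single ν 1)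
    (K := fun t' β α => N.green t' (N.lam β) (N.lam α))
    (fun β α => hasLineDerivAt_pd hU (contDiffOn_green h _ _) ht ν) A v' v
  have h2 : HasDerivAt _ _ (0 : ℝ) := hasLineDerivAt_inner_bdry_spin hN hU h ht ν A v' v
  refine HasDerivAt.unique h1 (h2.congr_of_eventuallyEq ?_)
  filter_upwards [eventually_add_smul_mem hU ht (Pi.single ν 1)] with r hr
  rw [bdry_spin_weylSource hN (h _ hr)]

end NahmData

/-- Integration by parts. -/
theorem l2Inner_I_smul_derivWithin {X : Type*} [NormedAddCommGroup X] [InnerProductSpace ℂ X]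
    {P : Set ℝ} {f g : ℝ → X} (hP : IsSparse P) (hf : IsContPiecewiseSmooth P f)
    (hg : IsContPiecewiseSmooth P g) :
    l2Inner (fun s => Complex.I • derivWithin f (Ici s) s) g
      = l2Inner f fun s => Complex.I • derivWithin g (Ici s) s := by
  have hc : IsContPiecewiseSmooth P fun s => (inner ℂ (f s) (g s) : ℂ) :=
    ⟨hf.1.innerProd hg.1, hf.2.inner hg.2⟩
  have h1 := hc.integral_derivWithin hP 0 (2 * Real.pi)
  have h2 : ∀ s, derivWithin (fun s => (inner ℂ (f s) (g s) : ℂ)) (Ici s) s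
      = inner ℂ (f s) (derivWithin g (Ici s) s) + inner ℂ (derivWithin f (Ici s) s) (g s) :=
    fun s => ((hf.1.exists_hasDerivWithinAt hP s).inner ℂ
      (hg.1.exists_hasDerivWithinAt hP s)).derivWithin (uniqueDiffWithinAt_Ici s)
  have i1 := (hf.1.innerProd hg.1.derivRight).intervalIntegrable hP 0 (2 * Real.pi)
  have i2 := (hf.1.derivRight.innerProd hg.1).intervalIntegrable hP 0 (2 * Real.pi)
  have h3 : inner ℂ (f (2 * Real.pi)) (g (2 * Real.pi)) = (inner ℂ (f 0) (g 0) : ℂ) := by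
    have h4 := hc.1.1 0
    rwa [zero_add] at h4
  simp only [h2] at h1
  rw [intervalIntegral.integral_add i1 i2, h3, sub_self] at h1
  rw [l2Inner_smul_left, l2Inner_smul_right]
  have h5 : l2Inner f (fun s => derivWithin g (Ici s) s)
      + l2Inner (fun s => derivWithin f (Ici s) s) g = 0 := h1
  have h6 : star Complex.I = -Complex.I := Complex.conj_I
  rw [h6]
  linear_combination -Complex.I * h5

/-! ### Clifford relations and the bracket identity -/

namespace NahmData

variable {S E : Type*} [NormedAddCommGroup S] [InnerProductSpace ℂ S]
  [FiniteDimensional ℂ S] [NormedAddCommGroup E] [InnerProductSpace ℂ E]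
  [FiniteDimensional ℂ E] {n : ℕ} {W : Fin n → Type*} [∀ α, NormedAddCommGroup (W α)]
  [∀ α, InnerProductSpace ℂ (W α)] [∀ α, FiniteDimensional ℂ (W α)]
  {N : NahmData S E n W} {t : Fin 4 → ℝ} {f g : ℝ → S ⊗[ℂ] E}

/-- The components `X_μ` are formally self-adjoint. -/
theorem l2Inner_cov (hf : IsCPW f) (hg : IsCPW g) (μ : Fin 4) :
    l2Inner (N.cov t μ f) g = l2Inner f (N.cov t μ g) := by
  obtain ⟨P, hP, hm, hf', hg'⟩ := hf.exists_sup hg N.isSparse_marks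
  set A : ℝ → S ⊗[ℂ] E →L[ℂ] S ⊗[ℂ] E :=
    fun s => TensorProduct.mapL 1 (N.T μ s + (t μ : ℂ) • 1) with hA
  have hAP : IsPiecewiseSmooth P A := (N.isPiecewiseSmooth_mapL 1 t μ).mono hm
  have h1 : l2Inner (fun s => A s (f s)) g = l2Inner f fun s => A s (g s) := by
    have h2 : ∀ s, adj (A s) = A s := fun s => by
      rw [hA, adj_mapL, adj_one, adj_T_add]
    have h3 : ∀ s, (inner ℂ (A s (f s)) (g s) : ℂ) = inner ℂ (f s) (A s (g s)) := fun s => by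
      rw [← adj_inner_right, h2]
    simp only [l2Inner, h3]
  have iA : ∀ {k : ℝ → S ⊗[ℂ] E}, IsContPiecewiseSmooth P k → IsPW fun s => A s (k s) :=
    fun hk => ⟨P, hP, hAP.clm_apply hk.1⟩
  have iD : ∀ {k : ℝ → S ⊗[ℂ] E}, IsContPiecewiseSmooth P k →
      IsPW fun s => Complex.I • derivWithin k (Ici s) s :=
    fun hk => ⟨P, hP, hk.1.derivRight.const_smul _⟩
  by_cases h : μ = 0
  · have h2 : ∀ k : ℝ → S ⊗[ℂ] E, N.cov t μ k
        = fun s => Complex.I • derivWithin k (Ici s) s + A s (k s) := fun k => by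
      funext s
      rw [cov, if_pos h]
    rw [h2, h2, l2Inner_add_left (iD hf') (iA hf') hg.1, l2Inner_add_right hf.1 (iD hg') (iA hg'),
      h1]
    congr 1
    exact l2Inner_I_smul_derivWithin hP hf' hg'
  · have h2 : ∀ k : ℝ → S ⊗[ℂ] E, N.cov t μ k = fun s => A s (k s) := fun k => by
      funext s
      rw [cov, if_neg h, zero_add]
    rw [h2, h2, h1]

theorem spin_add_apply (a b : S →L[ℂ] S) (x : S ⊗[ℂ] E) :
    N.spin (a + b) x = N.spin a x + N.spin b x := by
  exact congrArg (fun L => L x) (map_add (mapLeft (1 : E →L[ℂ] E)) a b)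

theorem spin_smul_apply (c : ℂ) (a : S →L[ℂ] S) (x : S ⊗[ℂ] E) :
    N.spin (c • a) x = c • N.spin a x := by
  exact congrArg (fun L => L x) (map_smul (mapLeft (1 : E →L[ℂ] E)) c a)

/-- `a ↦ ⟨f, (a ⊗ id) g⟩`. -/
def spinForm (N : NahmData S E n W) {f g : ℝ → S ⊗[ℂ] E} (hf : IsPW f) (hg : IsPW g) :
    (S →L[ℂ] S) →ₗ[ℂ] ℂ where
  toFun a := l2Inner f fun s => N.spin a (g s)
  map_add' a b := by
    simp only [spin_add_apply]
    exact l2Inner_add_right hf (hg.clm _) (hg.clm _)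
  map_smul' c a := by
    simp only [spin_smul_apply]
    exact l2Inner_smul_right _ _ _

/-- Here and in `l2Inner_dirac_spin` the products are brought to the common functionals `a ↦ ⟨f, a
X_κ g⟩`, in the latter by self-adjointness of `X_κ`. Relations between them thereby reduce to
algebra in `End(S)`. -/
theorem l2Inner_spin_dirac (hf : IsCPW f) (hg : IsCPW g) (a b : S →L[ℂ] S) :
    l2Inner (fun s => N.spin a (f s)) (N.dirac t fun s => N.spin b (g s))
      = ∑ κ, N.spinForm hf.1 (isPW_cov (N := N) t κ hg.1) (adj a * N.eMu κ * b) := by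
  have h1 : N.dirac t (fun s => N.spin b (g s))
      = fun s => ∑ κ, N.spin (N.eMu κ * b) (N.cov t κ g s) := by
    funext s
    simp only [dirac_eq_sum_cov, cov_spin hg.1, spin_mul_apply]
  rw [h1, l2Inner_sum_right (hf.1.clm _) fun κ _ => (isPW_cov (N := N) t κ hg.1).clm _]
  refine Finset.sum_congr rfl fun κ _ => ?_
  rw [l2Inner_clm_left, adj_spin]
  simp only [spin_mul_apply, mul_assoc]
  rfl

theorem l2Inner_dirac_spin (hf : IsCPW f) (hg : IsCPW g) (a b : S →L[ℂ] S) :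
    l2Inner (N.dirac t fun s => N.spin a (f s)) (fun s => N.spin b (g s))
      = ∑ κ, N.spinForm hf.1 (isPW_cov (N := N) t κ hg.1) (adj a * N.eBar κ * b) := by
  have h1 : N.dirac t (fun s => N.spin a (f s))
      = fun s => ∑ κ, N.spin (N.eMu κ * a) (N.cov t κ f s) := by
    funext s
    simp only [dirac_eq_sum_cov, cov_spin hf.1, spin_mul_apply]
  rw [h1, l2Inner_sum_left (hg.1.clm _) fun κ _ => (isPW_cov (N := N) t κ hf.1).clm _]
  refine Finset.sum_congr rfl fun κ _ => ?_
  rw [l2Inner_clm_left, adj_spin, adj_mul, adj_eMu]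
  simp only [spin_mul_apply]
  rw [l2Inner_cov hf (hg.clm _), cov_spin hg.1]
  rfl

/-- Polarization of the quaternion norm. It reduces the double sum over `ν` and `κ` in the bracket
identity to its diagonal. -/
theorem eBar_mul_eMu_add (ν κ : Fin 4) :
    N.eBar ν * N.eMu κ + N.eBar κ * N.eMu ν = if ν = κ then 2 else 0 := by
  have m01 : N.e 0 * N.e 1 = N.e 2 := N.e_mul 0
  have m12 : N.e 1 * N.e 2 = N.e 0 := N.e_mul 1
  have m20 : N.e 2 * N.e 0 = N.e 1 := N.e_mul 2
  have m10 : N.e 1 * N.e 0 = -N.e 2 := N.e_mul' 0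
  have m21 : N.e 2 * N.e 1 = -N.e 0 := N.e_mul' 1
  have m02 : N.e 0 * N.e 2 = -N.e 1 := N.e_mul' 2
  have e0 : N.eMu 0 = 1 := rfl
  have e1 : N.eMu 1 = N.e 0 := rfl
  have e2 : N.eMu 2 = N.e 1 := rfl
  have e3 : N.eMu 3 = N.e 2 := rfl
  have b0 : N.eBar 0 = 1 := rfl
  have b1 : N.eBar 1 = -N.e 0 := rfl
  have b2 : N.eBar 2 = -N.e 1 := rfl
  have b3 : N.eBar 3 = -N.e 2 := rfl
  fin_cases ν <;> fin_cases κ <;>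
    simp [e0, e1, e2, e3, b0, b1, b2, b3, N.e_sq, m01, m12, m20, m10, m21, m02, one_add_one_eq_two]

/-- Put `b = ē_{[ν} e_{μ]}`. The summand with index `ν` is the sum over `κ` of `⟨f, b (ē_κ e_ν + ē_ν
e_κ) X_κ g⟩`, of which the Clifford relation leaves `2 ⟨f, b X_ν g⟩`. The right side expands
directly to the sum over `ν` of `⟨f, (ē_ν e_μ - ē_μ e_ν) X_ν g⟩`. -/
theorem sum_l2Inner_eBracket (hf : IsCPW f) (hg : IsCPW g) (μ : Fin 4) :
    (1 / 2 : ℂ) * ∑ ν,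
      (l2Inner (N.dirac t fun s => N.spin (adj (N.eBracket ν μ)) (f s))
          (fun s => N.spin (N.eMu ν) (g s))
        + l2Inner (fun s => N.spin (N.eMu ν) (N.spin (adj (N.eBracket ν μ)) (f s)))
          (N.dirac t g))
      = l2Inner (N.dirac t f) (fun s => N.spin (N.eMu μ) (g s))
        - l2Inner (fun s => N.spin (N.eMu μ) (f s)) (N.dirac t g) := by
  set φ := fun κ => N.spinForm hf.1 (isPW_cov (N := N) t κ hg.1) with hφ
  have hg1 : N.dirac t g = N.dirac t fun s => N.spin 1 (g s) := by simp only [spin_one_apply]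
  have hf1 : N.dirac t f = N.dirac t fun s => N.spin 1 (f s) := by simp only [spin_one_apply]
  have h1 : ∀ ν, l2Inner (N.dirac t fun s => N.spin (adj (N.eBracket ν μ)) (f s))
          (fun s => N.spin (N.eMu ν) (g s))
        + l2Inner (fun s => N.spin (N.eMu ν) (N.spin (adj (N.eBracket ν μ)) (f s)))
          (N.dirac t g) = 2 * φ ν (N.eBracket ν μ) := fun ν => by
    rw [hg1]
    simp only [spin_mul_apply]
    rw [l2Inner_dirac_spin hf hg, l2Inner_spin_dirac hf hg, ← Finset.sum_add_distrib]
    have h2 : ∀ κ, φ κ (adj (adj (N.eBracket ν μ)) * N.eBar κ * N.eMu ν)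
        + φ κ (adj (N.eMu ν * adj (N.eBracket ν μ)) * N.eMu κ * 1)
        = if ν = κ then 2 * φ ν (N.eBracket ν μ) else 0 := fun κ => by
      rw [← map_add, adj_adj, adj_mul, adj_adj, adj_eMu, mul_one, mul_assoc, mul_assoc,
        ← mul_add, add_comm, eBar_mul_eMu_add]
      split_ifs with h
      · subst h
        rw [mul_two, map_add, two_mul]
      · rw [mul_zero, map_zero]
    simp only [hφ] at h2 ⊢
    rw [Finset.sum_congr rfl fun κ _ => h2 κ, Finset.sum_ite_eq]
    simp
  simp only [h1]
  rw [hf1, hg1, l2Inner_dirac_spin hf hg, l2Inner_spin_dirac hf hg, ← Finset.mul_sum, ← mul_assoc,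
    ← Finset.sum_sub_distrib, one_div_mul_cancel two_ne_zero, one_mul]
  refine Finset.sum_congr rfl fun ν _ => ?_
  rw [adj_one, one_mul, mul_one, adj_eMu, ← map_sub]
  rfl

end NahmData

/-! ### The projection condition and the derivative of the Gram operator -/

theorem HasLineDerivAt.adj {T X Y : Type*} [NormedAddCommGroup T] [NormedSpace ℝ T]
    [NormedAddCommGroup X] [InnerProductSpace ℂ X] [FiniteDimensional ℂ X]
    [NormedAddCommGroup Y] [InnerProductSpace ℂ Y] [FiniteDimensional ℂ Y]
    {A : T → X →L[ℂ] Y} {A' : X →L[ℂ] Y} {t e : T} (hA : HasLineDerivAt ℝ A A' t e) :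
    HasLineDerivAt ℝ (fun t => Caloron.adj (A t)) (Caloron.adj A') t e :=
  HasLineDerivAt.clm (adjCLM X Y) hA

namespace NahmData

variable {S E : Type*} [NormedAddCommGroup S] [InnerProductSpace ℂ S]
  [FiniteDimensional ℂ S] [NormedAddCommGroup E] [InnerProductSpace ℂ E]
  [FiniteDimensional ℂ E] {n : ℕ} {W : Fin n → Type*} [∀ α, NormedAddCommGroup (W α)]
  [∀ α, InnerProductSpace ℂ (W α)] [∀ α, FiniteDimensional ℂ (W α)]
  {V : Type*} [NormedAddCommGroup V] [InnerProductSpace ℂ V] [FiniteDimensional ℂ V]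
  {N : NahmData S E n W} {t : Fin 4 → ℝ} {U : Set (Fin 4 → ℝ)}
  {ψ : (Fin 4 → ℝ) → V →ₗ[ℂ] (ℝ → S ⊗[ℂ] E)} {χ : (Fin 4 → ℝ) → V →L[ℂ] PiLp 2 W}

theorem pairInner_kerPair_gram_left (h : N.IsRegular t) (v y : PiLp 2 W) :
    pairInner (N.kerPair t (N.gram t v)) (N.kerPair t y) = inner ℂ v y := by
  rw [← pairInner_conj, pairInner_kerPair_gram h]
  exact inner_conj_symm _ _

theorem gram_bijective (h : N.IsRegular t) : Function.Bijective (N.gram t) :=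
  ContinuousLinearMap.isUnit_iff_bijective.1 (isUnit_gram h)

theorem hasLineDerivAt_kerFst_comp (hU : IsOpen U) (h : ∀ t ∈ U, N.IsRegular t) (ht : t ∈ U)
    (μ : Fin 4) {x : (Fin 4 → ℝ) → PiLp 2 W} (hx : ContDiffOn ℝ ∞ x U) (s : ℝ) :
    HasLineDerivAt ℝ (fun t' => N.kerFst t' s (x t'))
      (pd μ (fun t' => N.kerFst t' s) t (x t) + N.kerFst t s (pd μ x t)) t (Pi.single μ 1) :=
  HasLineDerivAt.complexClm_apply (hasLineDerivAt_kerFst hU h ht μ s)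
    (hasLineDerivAt_pd hU hx ht μ)

theorem IsFrame.contDiffOn_apply (hF : N.IsFrame U ψ χ) {w : (Fin 4 → ℝ) → V}
    (hw : ContDiffOn ℝ ∞ w U) : ContDiffOn ℝ ∞ (fun t => χ t (w t)) U :=
  ContDiffOn.complexClm_apply hF.smooth_snd hw

theorem IsFrame.pd_apply (hF : N.IsFrame U ψ χ) (hU : IsOpen U) (ht : t ∈ U) (μ : Fin 4)
    {w : (Fin 4 → ℝ) → V} (hw : ContDiffOn ℝ ∞ w U) :
    pd μ (fun t => χ t (w t)) t = pd μ χ t (w t) + χ t (pd μ w t) :=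
  (HasLineDerivAt.complexClm_apply (hasLineDerivAt_pd hU hF.smooth_snd ht μ)
    (hasLineDerivAt_pd hU hw ht μ)).lineDeriv

theorem IsFrame.pd_fst (hF : N.IsFrame U ψ χ) (hU : IsOpen U) (h : ∀ t ∈ U, N.IsRegular t)
    (ht : t ∈ U) (μ : Fin 4) {w : (Fin 4 → ℝ) → V} (hw : ContDiffOn ℝ ∞ w U) (s : ℝ) :
    pd μ (fun t' => ψ t' (w t') s) t = pd μ (fun t' => N.kerFst t' s) t (χ t (w t))
      + N.kerFst t s (pd μ (fun t => χ t (w t)) t) := by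
  rw [pd_congr hU (g := fun t' => N.kerFst t' s (χ t' (w t'))) (fun t' ht' => ?_) ht μ]
  · exact (hasLineDerivAt_kerFst_comp hU h ht μ (hF.contDiffOn_apply hw) s).lineDeriv
  · exact congrFun (hF.fst_eq ht' (h t' ht') (w t')) s

theorem l2Inner_kerFst_gram_pd (hU : IsOpen U) (h : ∀ t ∈ U, N.IsRegular t) (ht : t ∈ U)
    (μ : Fin 4) (v' v : PiLp 2 W) :
    l2Inner (fun s => N.kerFst t s (N.gram t v'))
        (fun s => pd μ (fun t' => N.kerFst t' s) t (N.gram t v))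
      = -l2Inner (fun s => N.spin (N.eMu μ) (N.weylSource t s v'))
        (N.dirac t fun s => N.weylSource t s v) := by
  rw [l2Inner_kerFst_pd hU h ht]
  simp only [kerFst_gram (h t ht)]
  exact l2Inner_neg_right _ _

/-- The projection condition, paired with `ker 𝒟_t†`. -/
theorem IsFrame.isKerProj_iff (hF : N.IsFrame U ψ χ) (hU : IsOpen U)
    (h : ∀ t ∈ U, N.IsRegular t) (ht : t ∈ U) (μ : Fin 4) {w : (Fin 4 → ℝ) → V}
    (hw : ContDiffOn ℝ ∞ w U) {v : PiLp 2 W} (hv : adj (χ t) v = w t) (a : V) :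
    N.IsKerProj t (pdPair μ (fun t' => (ψ t' (w t'), χ t' (w t'))) t) (ψ t a, χ t a) ↔
      ∀ v', inner ℂ v' (pd μ χ t (w t) + χ t (pd μ w t) - χ t a)
        = l2Inner (fun s => N.spin (N.eMu μ) (N.weylSource t s v'))
          (N.dirac t fun s => N.weylSource t s v) := by
  set x := fun t => χ t (w t) with hx
  have hxv : N.gram t v = x t := by
    rw [← hF.comp_adj ht (h t ht), ContinuousLinearMap.comp_apply, hv]
  have hP : IsPiecewiseSmooth N.marks (pdPair μ (fun t' => (ψ t' (w t'), χ t' (w t'))) t).1 := by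
    have h1 := (isSmoothFamily_kerFst h (hF.contDiffOn_apply hw)).isPiecewiseSmooth_pd hU ht μ
    have h2 : (pdPair μ (fun t' => (ψ t' (w t'), χ t' (w t'))) t).1
        = fun s => pd μ (fun t' => N.kerFst t' s (x t')) t := by
      funext s
      exact pd_congr hU (fun t' ht' => congrFun (hF.fst_eq ht' (h t' ht') (w t')) s) ht μ
    rw [h2]
    exact h1
  have hK : (ψ t a, χ t a) ∈ N.weylKer t := hF.mem_ker t ht a
  set y := pd μ χ t (w t) + χ t (pd μ w t) - χ t a with hy
  have hsub : pdPair μ (fun t' => (ψ t' (w t'), χ t' (w t'))) t - (ψ t a, χ t a)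
      = (fun s => pd μ (fun t' => N.kerFst t' s) t (x t) + N.kerFst t s y, y) := by
    have h3 : y = pd μ x t - χ t a := by rw [hy, hx, hF.pd_apply hU ht μ hw]
    refine Prod.ext ?_ ?_
    · funext s
      change pd μ (fun t' => ψ t' (w t') s) t - ψ t a s = _
      rw [hF.pd_fst hU h ht μ hw, hF.fst_eq ht (h t ht), h3]
      change _ = _ + N.kerFst t s (pd μ x t - χ t a)
      rw [map_sub]
      exact add_sub_assoc _ _ _
    · rw [h3]
      rfl
  -- The difference is a kernel element over `y` plus the derivative of the kernel section at the
  -- fixed vector `gram v`. The former pairs by the product formula, the latter by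
  -- `l2Inner_kerFst_gram_pd`. As `gram` is bijective, these test elements exhaust the kernel.
  have key : ∀ v', pairInner (N.kerPair t (N.gram t v'))
      (pdPair μ (fun t' => (ψ t' (w t'), χ t' (w t'))) t - (ψ t a, χ t a))
      = inner ℂ v' y - l2Inner (fun s => N.spin (N.eMu μ) (N.weylSource t s v'))
          (N.dirac t fun s => N.weylSource t s v) := fun v' => by
    have h4 := pairInner_kerPair_gram_left (h t ht) v' y
    rw [pairInner, kerPair, kerPair] at h4
    rw [hsub, pairInner, kerPair, l2Inner_add_right (isPW_kerFst _) (isPW_pd_kerFst hU h ht μ _)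
      (isPW_kerFst _), ← hxv, l2Inner_kerFst_gram_pd hU h ht, add_assoc, h4]
    ring
  constructor
  · rintro ⟨-, -, h5⟩ v'
    have h6 := h5 _ (kerPair_mem_weylKer (h t ht) (N.gram t v'))
    rw [key] at h6
    exact sub_eq_zero.1 h6
  · refine fun h5 => ⟨hP, hK, fun r hr => ?_⟩
    obtain ⟨v', hv'⟩ := (gram_bijective (h t ht)).2 r.2
    rw [NahmData.eq_kerPair (h t ht) hr, ← hv', key, h5, sub_self]

/-- The derivative of `χ χ† = id - 𝐐† 𝐅 𝐐`. -/
theorem IsFrame.inner_pd_gram (hF : N.IsFrame U ψ χ) (hN : N.NahmEquations) (hU : IsOpen U)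
    (h : ∀ t ∈ U, N.IsRegular t) (ht : t ∈ U) (μ : Fin 4) (v' v : PiLp 2 W) :
    inner ℂ v' (pd μ χ t (adj (χ t) v))
        + inner ℂ (adj (χ t) v') (pd μ (fun t' => adj (χ t')) t v)
      = l2Inner (N.dirac t fun s => N.weylSource t s v')
          (fun s => N.spin (N.eMu μ) (N.weylSource t s v))
        + l2Inner (fun s => N.spin (N.eMu μ) (N.weylSource t s v'))
          (N.dirac t fun s => N.weylSource t s v) := by
  have h1 := hasLineDerivAt_pd hU hF.smooth_snd ht μ
  have h2 : HasLineDerivAt ℝ (fun t' => adj (χ t')) (pd μ (fun t' => adj (χ t')) t) t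
      (Pi.single μ 1) := by
    have h3 := HasLineDerivAt.adj h1
    exact h3.lineDifferentiableAt.hasLineDerivAt
  have h3 := HasLineDerivAt.complexClm_apply h2 (f := fun _ => v) (f' := 0) (hasDerivAt_const _ v)
  rw [map_zero, add_zero] at h3
  have h4 := HasLineDerivAt.clm ((innerSL ℂ v').restrictScalars ℝ)
    (HasLineDerivAt.complexClm_apply h1 h3)
  -- The second expression for the same derivative: near `t` the product `χ χ†` equals `id - 𝐐† 𝐅
  -- 𝐐`, to which the resolvent identity with `A = 1` applies.
  have h5 : HasDerivAt _ _ (0 : ℝ) :=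
    hasLineDerivAt_inner_bdry_spin hN hU h ht μ 1 v' v
  have h6 := h5.const_sub (inner ℂ v' v)
  have h7 := HasDerivAt.unique h4 (h6.congr_of_eventuallyEq ?_)
  · rw [adj_one] at h7
    simp only [spin_one_apply, neg_neg] at h7
    rw [← h7, adj_inner_left, ← inner_add_right]
    rfl
  · filter_upwards [eventually_add_smul_mem hU ht (Pi.single μ 1)] with r hr
    simp only [spin_one_apply]
    rw [← inner_sub_right, ← gram_apply, ← hF.comp_adj hr (h _ hr)]
    rfl

end NahmData

/-! ### The connection formula -/

namespace NahmData

variable {S E : Type*} [NormedAddCommGroup S] [InnerProductSpace ℂ S]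
  [FiniteDimensional ℂ S] [NormedAddCommGroup E] [InnerProductSpace ℂ E]
  [FiniteDimensional ℂ E] {n : ℕ} {W : Fin n → Type*} [∀ α, NormedAddCommGroup (W α)]
  [∀ α, InnerProductSpace ℂ (W α)] [∀ α, FiniteDimensional ℂ (W α)]
  {V : Type*} [NormedAddCommGroup V] [InnerProductSpace ℂ V] [FiniteDimensional ℂ V]
  {N : NahmData S E n W} {t : Fin 4 → ℝ} {U : Set (Fin 4 → ℝ)}
  {ψ : (Fin 4 → ℝ) → V →ₗ[ℂ] (ℝ → S ⊗[ℂ] E)} {χ : (Fin 4 → ℝ) → V →L[ℂ] PiLp 2 W}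

theorem IsFrame.adj_bijective (hF : N.IsFrame U ψ χ) (ht : t ∈ U) (h : N.IsRegular t) :
    Function.Bijective (adj (χ t)) := by
  have h1 := hF.bijective ht h
  have h2 : χ t ∘ adj (χ t) = N.gram t := by
    rw [← hF.comp_adj ht h]
    rfl
  refine (Function.Bijective.of_comp_iff' h1 (adj (χ t))).1 ?_
  rw [h2]
  exact gram_bijective h

/-- This gives the difference of the two products whose sum appears in `inner_pd_gram`; together
they isolate the single product that determines the connection. -/
theorem sum_inner_sandwich_eBracket (hN : N.NahmEquations) (hU : IsOpen U)
    (h : ∀ t ∈ U, N.IsRegular t) (ht : t ∈ U) (μ : Fin 4) (v' v : PiLp 2 W) :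
    -((1 / 2 : ℂ) * ∑ ν, inner ℂ v' (N.sandwich (N.eBracket ν μ)
        (fun β α => pd ν (fun t' => N.green t' (N.lam β) (N.lam α)) t) v))
      = l2Inner (N.dirac t fun s => N.weylSource t s v')
          (fun s => N.spin (N.eMu μ) (N.weylSource t s v))
        - l2Inner (fun s => N.spin (N.eMu μ) (N.weylSource t s v'))
          (N.dirac t fun s => N.weylSource t s v) := by
  rw [← sum_l2Inner_eBracket (isCPW_weylSource (h t ht) v') (isCPW_weylSource (h t ht) v)]
  simp only [inner_sandwich_pd_green hN hU h ht]
  rw [Finset.sum_neg_distrib, mul_neg, neg_neg]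

/-- The connection forms, in terms of the sections `(D_t† D_t)⁻¹ 𝐐 v`. -/
theorem IsFrame.connectionForm_iff (hF : N.IsFrame U ψ χ) (hN : N.NahmEquations) (hU : IsOpen U)
    (h : ∀ t ∈ U, N.IsRegular t) (ht : t ∈ U) (μ : Fin 4) (B : V →L[ℂ] V) :
    (2 : ℂ) • B = -((1 / 2 : ℂ) • ∑ ν : Fin 4, (χ t).inverse ∘L
          N.sandwich (N.eBracket ν μ)
            (fun β α => pd ν (fun t' => N.green t' (N.lam β) (N.lam α)) t) ∘L
          (adj (χ t)).inverse)
        + (χ t).inverse ∘L pd μ χ t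
        - pd μ (fun t' => adj (χ t')) t ∘L (adj (χ t)).inverse ↔
      ∀ v v', inner ℂ v' (pd μ χ t (adj (χ t) v) - χ t (B (adj (χ t) v)))
        = l2Inner (fun s => N.spin (N.eMu μ) (N.weylSource t s v'))
          (N.dirac t fun s => N.weylSource t s v) := by
  have hi := isInvertible_of_bijective (hF.bijective ht (h t ht))
  have hb := hF.adj_bijective ht (h t ht)
  have ha := isInvertible_of_bijective hb
  set R : V →L[ℂ] V := -((1 / 2 : ℂ) • ∑ ν : Fin 4, (χ t).inverse ∘L
          N.sandwich (N.eBracket ν μ)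
            (fun β α => pd ν (fun t' => N.green t' (N.lam β) (N.lam α)) t) ∘L
          (adj (χ t)).inverse)
        + (χ t).inverse ∘L pd μ χ t
        - pd μ (fun t' => adj (χ t')) t ∘L (adj (χ t)).inverse with hR
  have hinv : ∀ v' z : PiLp 2 W, (inner ℂ (adj (χ t) v') ((χ t).inverse z) : ℂ) = inner ℂ v' z :=
    fun v' z => by rw [adj_inner_left, hi.self_apply_inverse]
  -- Write `a = ⟨D f_v', e_μ f_v⟩`, `b = ⟨e_μ f_v', D f_v⟩`, `p = ⟨v', ∂χ χ† v⟩` and `q = ⟨χ† v',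
  -- ∂χ† v⟩`. The pairing with `R` is `(a - b) + p - q`, and `p + q = a + b` turns it into `2 (p -
  -- b)`.
  have key : ∀ v v', (inner ℂ (adj (χ t) v') (R (adj (χ t) v)) : ℂ)
      = 2 * (inner ℂ v' (pd μ χ t (adj (χ t) v))
        - l2Inner (fun s => N.spin (N.eMu μ) (N.weylSource t s v'))
          (N.dirac t fun s => N.weylSource t s v)) := fun v v' => by
    have h1 := hF.inner_pd_gram hN hU h ht μ v' v
    have h2 := sum_inner_sandwich_eBracket hN hU h ht μ v' v
    have h3 : (inner ℂ (adj (χ t) v') (R (adj (χ t) v)) : ℂ)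
        = -((1 / 2 : ℂ) * ∑ ν, inner ℂ v' (N.sandwich (N.eBracket ν μ)
            (fun β α => pd ν (fun t' => N.green t' (N.lam β) (N.lam α)) t) v))
          + inner ℂ v' (pd μ χ t (adj (χ t) v))
          - inner ℂ (adj (χ t) v') (pd μ (fun t' => adj (χ t')) t v) := by
      simp only [hR, sub_apply, add_apply, neg_apply, smul_apply, sum_apply,
        ContinuousLinearMap.comp_apply, ha.inverse_apply_self, inner_sub_right, inner_add_right,
        inner_neg_right, inner_smul_right, inner_sum, hinv]
    rw [h3, h2]
    linear_combination -h1
  have h4 : (2 : ℂ) • B = R ↔ ∀ v v', (inner ℂ (adj (χ t) v') (((2 : ℂ) • B) (adj (χ t) v)) : ℂ)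
      = inner ℂ (adj (χ t) v') (R (adj (χ t) v)) := by
    refine ⟨fun h5 v v' => by rw [h5], fun h5 => ContinuousLinearMap.ext fun w => ?_⟩
    obtain ⟨v, rfl⟩ := hb.2 w
    refine ext_inner_left ℂ fun w' => ?_
    obtain ⟨v', rfl⟩ := hb.2 w'
    exact h5 v v'
  rw [h4]
  refine forall_congr' fun v => forall_congr' fun v' => ?_
  rw [key, smul_apply, inner_smul_right, adj_inner_left, inner_sub_right,
    mul_right_inj' (two_ne_zero' ℂ)]
  exact ⟨fun h5 => by rw [h5]; ring, fun h5 => by rw [← h5]; ring⟩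

/-- The terms with `∂_μ w` cancel from the projection condition, which therefore depends only on the
value of `w` at `t`. Constant families are enough to determine `A`, and as `χ†` is onto, every value
has the form `χ† v`. -/
theorem IsFrame.isInducedConnection_iff (hF : N.IsFrame U ψ χ) (hN : N.NahmEquations)
    (hU : IsOpen U) (h : ∀ t ∈ U, N.IsRegular t) (A : Fin 4 → (Fin 4 → ℝ) → V →L[ℂ] V) :
    N.IsInducedConnection U ψ χ A ↔ ∀ t ∈ U, ∀ μ : Fin 4,
      (2 : ℂ) • A μ t = -((1 / 2 : ℂ) • ∑ ν : Fin 4, (χ t).inverse ∘L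
          N.sandwich (N.eBracket ν μ)
            (fun β α => pd ν (fun t' => N.green t' (N.lam β) (N.lam α)) t) ∘L
          (adj (χ t)).inverse)
        + (χ t).inverse ∘L pd μ χ t
        - pd μ (fun t' => adj (χ t')) t ∘L (adj (χ t)).inverse := by
  constructor
  · intro hA t ht μ
    refine (hF.connectionForm_iff hN hU h ht μ (A μ t)).2 fun v v' => ?_
    have h1 := (hF.isKerProj_iff hU h ht μ contDiffOn_const rfl _).1
      (hA (fun _ => adj (χ t) v) contDiffOn_const t ht μ) v'
    have h2 : pd μ (fun _ : Fin 4 → ℝ => adj (χ t) v) t = 0 :=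
      (hasDerivAt_const (0 : ℝ) (adj (χ t) v)).deriv
    simpa only [h2, map_zero, add_zero, zero_add] using h1
  · intro hA w hw t ht μ
    obtain ⟨v, hv⟩ := (hF.adj_bijective ht (h t ht)).2 (w t)
    refine (hF.isKerProj_iff hU h ht μ hw hv _).2 fun v' => ?_
    have h1 := (hF.connectionForm_iff hN hU h ht μ (A μ t)).1 (hA t ht μ) v v'
    rw [hv] at h1
    rw [← h1, map_add]
    congr 1
    abel

end NahmData

end Caloron

end

theorem mainTheorem1
    {S E V : Type*} [NormedAddCommGroup S] [InnerProductSpace ℂ S] [FiniteDimensional ℂ S]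
    [NormedAddCommGroup E] [InnerProductSpace ℂ E] [FiniteDimensional ℂ E]
    [NormedAddCommGroup V] [InnerProductSpace ℂ V] [FiniteDimensional ℂ V]
    {n : ℕ} {W : Fin n → Type*} [∀ α, NormedAddCommGroup (W α)]
    [∀ α, InnerProductSpace ℂ (W α)] [∀ α, FiniteDimensional ℂ (W α)]
    (N : Caloron.NahmData S E n W) (hN : N.NahmEquations)
    (U : Set (Fin 4 → ℝ)) (hU : IsOpen U) (hreg : ∀ t ∈ U, N.IsRegular t) :
    (∀ t ∈ U, ∃! F : ℝ → ℝ → E →L[ℂ] E, N.IsGreen t F) ∧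
    ∀ F : (Fin 4 → ℝ) → ℝ → ℝ → E →L[ℂ] E, (∀ t ∈ U, N.IsGreen t (F t)) →
      (∀ β α : Fin n, ContDiffOn ℝ ∞ (fun t => F t (N.lam β) (N.lam α)) U) ∧
      (∀ t ∈ U, (N.chiGram (F t)).toLinearMap.IsPositive ∧ (N.chiGram (F t)).IsInvertible) ∧
      (∀ χ : (Fin 4 → ℝ) → V →L[ℂ] PiLp 2 W,
        (∃ ψ : (Fin 4 → ℝ) → V →ₗ[ℂ] (ℝ → S ⊗[ℂ] E), N.IsFrame U ψ χ) ↔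
          ContDiffOn ℝ ∞ χ U ∧
          ∀ t ∈ U, (χ t).IsInvertible ∧ χ t ∘L Caloron.adj (χ t) = N.chiGram (F t)) ∧
      (∀ (χ : (Fin 4 → ℝ) → V →L[ℂ] PiLp 2 W)
        (ψ ψ' : (Fin 4 → ℝ) → V →ₗ[ℂ] (ℝ → S ⊗[ℂ] E)),
        N.IsFrame U ψ χ → N.IsFrame U ψ' χ → Set.EqOn ψ ψ' U) ∧
      ∀ (ψ : (Fin 4 → ℝ) → V →ₗ[ℂ] (ℝ → S ⊗[ℂ] E)) (χ : (Fin 4 → ℝ) → V →L[ℂ] PiLp 2 W),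
        N.IsFrame U ψ χ →
        ∀ A : Fin 4 → (Fin 4 → ℝ) → V →L[ℂ] V,
          N.IsInducedConnection U ψ χ A ↔
          ∀ t ∈ U, ∀ μ : Fin 4,
            (2 : ℂ) • A μ t =
              -((1 / 2 : ℂ) • ∑ ν : Fin 4,
                (χ t).inverse ∘L
                  N.sandwich (N.eBracket ν μ)
                    (fun β α => Caloron.pd ν (fun t' => F t' (N.lam β) (N.lam α)) t) ∘L
                  (Caloron.adj (χ t)).inverse)
              + (χ t).inverse ∘L Caloron.pd μ χ t
              - Caloron.pd μ (fun t' => Caloron.adj (χ t')) t ∘L (Caloron.adj (χ t)).inverse := by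
  refine ⟨fun t ht => ⟨N.green t, N.isGreen_green hN (hreg t ht), fun F hF =>
    hF.eq_green hN (hreg t ht)⟩, fun F hF => ?_⟩
  -- Uniqueness replaces an arbitrary family of Green's functions by `green` on `U`; as `U` is open,
  -- partial derivatives agree as well.
  have hFG : Set.EqOn F N.green U := fun t ht => (hF t ht).eq_green hN (hreg t ht)
  have hgram : ∀ t ∈ U, N.chiGram (F t) = N.gram t := fun t ht => by
    rw [hFG ht, Caloron.NahmData.chiGram_green hN (hreg t ht)]
  refine ⟨fun β α => ?_, fun t ht => ?_, fun χ => ?_, fun χ ψ ψ' h h' => h.eqOn hreg h', ?_⟩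
  · exact (Caloron.NahmData.contDiffOn_green hreg _ _).congr fun t ht => by rw [hFG ht]
  · rw [hgram t ht]
    exact ⟨Caloron.NahmData.gram_isPositive (hreg t ht),
      Caloron.NahmData.isInvertible_of_bijective (Caloron.NahmData.gram_bijective (hreg t ht))⟩
  · rw [Caloron.NahmData.exists_isFrame_iff hreg]
    refine and_congr_right fun _ => forall₂_congr fun t ht => ?_
    rw [hgram t ht]
  · intro ψ χ h A
    rw [h.isInducedConnection_iff hN hU hreg]
    refine forall₂_congr fun t ht => forall_congr' fun μ => ?_
    have h1 : ∀ ν β α, Caloron.pd ν (fun t' => F t' (N.lam β) (N.lam α)) t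
        = Caloron.pd ν (fun t' => N.green t' (N.lam β) (N.lam α)) t := fun ν β α =>
      Caloron.pd_congr hU (fun t' ht' => by rw [hFG ht']) ht ν
    simp only [h1]
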